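/- Let $X$ be a complex Banach space, $1\le p<\infty$, let $(B,D(B))$ be the generator of a strongly continuous semigroup $(S(t))_{t\ge 0}$ on $X$ that is immediately norm continuous (i.e. $t\mapsto S(t)$ is continuous from $(0,\infty)$ to $\mathcal L(X)$ for the operator norm), and let $C\in\mathcal L(X)$. For $\tau\in[0,1]$ consider the delay equation $$(\mathrm{DE})_\tau\qquad u'(t)=Bu(t)+Cu(t-\tau)\ (t\ge 0),\qquad u(0)=x,\qquad u|_{[-1,0]}=f .$$ Its solution semigroup is the strongly continuous semigroup on $\mathcal E=X\times L^p([-1,0],X)$ generated by the operator $$\mathcal A_\tau\begin{pmatrix}x\\ f\end{pmatrix}=\begin{pmatrix}Bx+Cf(-\tau)\\ f'\end{pmatrix},\qquad D(\mathcal A_\tau)=\left\{\begin{pmatrix}x\\ f\end{pmatrix}\in D(B)\times W^{1,p}([-1,0],X):\ f(0)=x\right\}.$$ A strongly continuous semigroup $(T(t))_{t\ge0}$ on a Banach space $E$ is called exponentially stable if there are $M\in\mathbb R$, $\varepsilon>0$ with $\|T(t)\|\le Me^{-\varepsilon t}$ for all $t\ge0$. It is called hyperbolic if $E=E_s\oplus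 E_u$ with closed $T(t)$-invariant subspaces such that the restriction of $(T(t))_{t\ge0}$ to $E_s$ is exponentially stable, every $T(t)$ is invertible on $E_u$, and the norms of the inverses $(T(t)|_{E_u})^{-1}$ decay exponentially as $t\to\infty$. **Theorem.** (i) If the semigroup generated by $(B+C,D(B))$ is exponentially stable, then there is $\kappa\in(0,1]$ such that for every $\tau\in(0,\kappa)$ the operator $\mathcal A_\tau$ generates a strongly continuous semigroup on $\mathcal E$ and this solution semigroup of $(\mathrm{DE})_\tau$ is exponentially stable. (ii) If the semigroup generated by $(B+C,D(B))$ is hyperbolic, then there is $\kappa\in(0,1]$ such that for every $\tau\in(0,\kappa)$ the operator $\mathcal A_\tau$ generates a strongly continuous semigroup on $\mathcal E$ and this solution semigroup of $(\mathrm{DE})_\tau$ is hyperbolic. -/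

import Mathlib

open MeasureTheory Set Filter Topology
open scoped NNReal ENNReal

noncomputable section

/-! ### Strongly continuous semigroups -/

/-- A strongly continuous one-parameter semigroup `(T(t))_{t ≥ 0}` of bounded linear operators. -/
structure C0Semigroup (E : Type*) [NormedAddCommGroup E] [NormedSpace ℂ E] where
  /-- The operators `T(t)`, `t ≥ 0`. -/
  op : ℝ≥0 → E →L[ℂ] E
  op_zero : op 0 = ContinuousLinearMap.id ℂ E
  op_add : ∀ s t : ℝ≥0, op (s + t) = (op s).comp (op t)
  continuous_orbit : ∀ x : E, Continuous fun t : ℝ≥0 => op t x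

namespace C0Semigroup

variable {E : Type*} [NormedAddCommGroup E] [NormedSpace ℂ E]

/-- `(A, D(A))` is the generator of `T`: a vector `x` lies in `D(A)` and `A x = y` if and only if
`(T(h) x - x) / h` converges to `y` as `h ↓ 0`. -/
def IsGeneratedBy (T : C0Semigroup E) (A : E →ₗ.[ℂ] E) : Prop :=
  ∀ x y : E, (x, y) ∈ A.graph ↔
    Tendsto (fun h : ℝ≥0 => ((h : ℝ) : ℂ)⁻¹ • (T.op h x - x)) (𝓝[>] 0) (𝓝 y)

/-- `t ↦ T(t)` is continuous on `(0, ∞)` for the operator norm. -/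
def ImmediatelyNormContinuous (T : C0Semigroup E) : Prop :=
  ContinuousOn T.op (Ioi 0)

/-- Uniform exponential stability: `‖T(t)‖ ≤ M e^{-ε t}` for some `ε > 0`. -/
def ExponentiallyStable (T : C0Semigroup E) : Prop :=
  ∃ M ε : ℝ, 0 < ε ∧ ∀ t : ℝ≥0, ‖T.op t‖ ≤ M * Real.exp (-ε * t)

/-- Hyperbolicity: `E` is the direct sum of two closed `T(t)`-invariant subspaces `Es`, `Eu` such
that `T` is uniformly exponentially stable on `Es`, and on `Eu` every `T(t)` is invertible and the
inverses `(T(t)|_{Eu})⁻¹`, `t ≥ 0`, decay exponentially. -/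
def Hyperbolic (T : C0Semigroup E) : Prop :=
  ∃ Es Eu : Submodule ℂ E,
    IsClosed (Es : Set E) ∧ IsClosed (Eu : Set E) ∧ IsCompl Es Eu ∧
    (∀ t : ℝ≥0, MapsTo (T.op t) Es Es) ∧
    (∀ t : ℝ≥0, BijOn (T.op t) Eu Eu) ∧
    ∃ M ε : ℝ, 0 < ε ∧
      (∀ t : ℝ≥0, ∀ x ∈ Es, ‖T.op t x‖ ≤ M * Real.exp (-ε * t) * ‖x‖) ∧
      (∀ t : ℝ≥0, ∀ x ∈ Eu, ‖x‖ ≤ M * Real.exp (-ε * t) * ‖T.op t x‖)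

end C0Semigroup

/-- The operator `B + C` with domain `D(B)`, for `C` bounded. -/
def boundedPerturbation {X : Type*} [NormedAddCommGroup X] [NormedSpace ℂ X]
    (B : X →ₗ.[ℂ] X) (C : X →L[ℂ] X) : X →ₗ.[ℂ] X where
  domain := B.domain
  toFun := B.toFun + (C : X →ₗ[ℂ] X).comp B.domain.subtype

/-! ### The history space and the Sobolev space `W^{1,p}([-1,0], X)` -/

/-- Lebesgue measure on `[-1,0]`. -/
abbrev historyMeasure : Measure ℝ := volume.restrict (Icc (-1) 0)

/-- The history space `L^p([-1,0], X)`. -/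
abbrev HistorySpace (X : Type*) [NormedAddCommGroup X] (p : ℝ≥0∞) : Type _ :=
  Lp X p historyMeasure

section Sobolev

set_option linter.unusedSectionVars false

variable {X : Type*} [NormedAddCommGroup X] [NormedSpace ℂ X] [CompleteSpace X]
variable {p : ℝ≥0∞} [Fact (1 ≤ p)]

/-- `F` is (on `[-1,0]`) the absolutely continuous representative of the class `f ∈ L^p`, and
`g ∈ L^p` is the derivative of `f`: `F(σ) = F(0) + ∫_0^σ g(s) ds` for `σ ∈ [-1,0]`. -/
structure IsSobolevRep (f g : HistorySpace X p) (F : ℝ → X) : Prop where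
  ae_eq : f =ᵐ[historyMeasure] F
  eq_primitive : ∀ σ ∈ Icc (-1 : ℝ) 0, F σ = F 0 + ∫ s in (0 : ℝ)..σ, g s

theorem historySpace_intervalIntegrable (g : HistorySpace X p) {σ : ℝ} (hσ : σ ∈ Icc (-1 : ℝ) 0) :
    IntervalIntegrable g volume 0 σ := by
  have h : IntegrableOn g (Icc (-1 : ℝ) 0) volume := (Lp.memLp g).integrable Fact.out
  rw [intervalIntegrable_iff]
  refine h.mono_set ?_
  rw [uIoc_of_ge hσ.2]
  exact fun s hs => ⟨hσ.1.trans hs.1.le, hs.2⟩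

theorem IsSobolevRep.continuousOn {f g : HistorySpace X p} {F : ℝ → X}
    (h : IsSobolevRep f g F) : ContinuousOn F (Icc (-1) 0) := by
  have hi := (historySpace_intervalIntegrable g (left_mem_Icc.2 (by norm_num)))
  have := intervalIntegral.continuousOn_primitive_interval' hi left_mem_uIcc
  rw [uIcc_of_ge (by norm_num)] at this
  exact (continuousOn_const.add this).congr h.eq_primitive

theorem IsSobolevRep.rep_unique {f g g' : HistorySpace X p} {F F' : ℝ → X}
    (h : IsSobolevRep f g F) (h' : IsSobolevRep f g' F') : EqOn F F' (Icc (-1) 0) :=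
  Measure.eqOn_Icc_of_ae_eq volume (by norm_num) (h.ae_eq.symm.trans h'.ae_eq)
    h.continuousOn h'.continuousOn

theorem IsSobolevRep.deriv_unique {f g g' : HistorySpace X p} {F F' : ℝ → X}
    (h : IsSobolevRep f g F) (h' : IsSobolevRep f g' F') : g = g' := by
  have hm : (-1 : ℝ) ∈ Icc (-1 : ℝ) 0 := left_mem_Icc.2 (by norm_num)
  have h0 : (0 : ℝ) ∈ Icc (-1 : ℝ) 0 := right_mem_Icc.2 (by norm_num)
  have hF := h.rep_unique h'
  have hI : EqOn (fun σ => ∫ s in (0 : ℝ)..σ, g s) (fun σ => ∫ s in (0 : ℝ)..σ, g' s)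
      (Icc (-1) 0) := by
    intro σ hσ
    have h1 := h.eq_primitive σ hσ
    have h2 := h'.eq_primitive σ hσ
    rw [hF hσ, hF h0, h2] at h1
    exact (add_left_cancel h1).symm
  have hu : uIcc (0 : ℝ) (-1) = Icc (-1) 0 := uIcc_of_ge (by norm_num)
  have d1 := (historySpace_intervalIntegrable g hm).ae_hasDerivAt_integral
  have d2 := (historySpace_intervalIntegrable g' hm).ae_hasDerivAt_integral
  rw [hu] at d1 d2
  apply Lp.ext
  have hne : ∀ᵐ x : ℝ, x ≠ -1 ∧ x ≠ 0 := by
    have h₁ : ∀ᵐ x : ℝ, x ≠ -1 := by simp [ae_iff, measure_singleton]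
    have h₂ : ∀ᵐ x : ℝ, x ≠ 0 := by simp [ae_iff, measure_singleton]
    exact h₁.and h₂
  change ∀ᵐ x ∂(volume.restrict (Icc (-1 : ℝ) 0)), _
  rw [ae_restrict_iff' measurableSet_Icc]
  filter_upwards [d1, d2, hne] with x hx1 hx2 hx hxI
  have hn : Icc (-1 : ℝ) 0 ∈ 𝓝 x :=
    Icc_mem_nhds (lt_of_le_of_ne hxI.1 (Ne.symm hx.1)) (lt_of_le_of_ne hxI.2 hx.2)
  refine (hx1 hxI 0 h0).unique ((hx2 hxI 0 h0).congr_of_eventuallyEq ?_)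
  filter_upwards [hn] with y hy using hI hy

theorem IsSobolevRep.zero : IsSobolevRep (0 : HistorySpace X p) 0 0 where
  ae_eq := Lp.coeFn_zero X p historyMeasure
  eq_primitive σ hσ := by
    have : ∫ s in (0 : ℝ)..σ, (0 : HistorySpace X p) s = ∫ s in (0 : ℝ)..σ, (0 : X) := by
      apply intervalIntegral.integral_congr_ae
      have := Lp.coeFn_zero X p historyMeasure
      rw [EventuallyEq, ae_restrict_iff' measurableSet_Icc] at this
      filter_upwards [this] with s hs hsI
      rw [uIoc_of_ge hσ.2] at hsI
      simpa using hs ⟨hσ.1.trans hsI.1.le, hsI.2⟩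
    rw [this]; simp

theorem IsSobolevRep.add {f g f' g' : HistorySpace X p} {F F' : ℝ → X}
    (h : IsSobolevRep f g F) (h' : IsSobolevRep f' g' F') :
    IsSobolevRep (f + f') (g + g') (F + F') where
  ae_eq := (Lp.coeFn_add f f').trans (h.ae_eq.add h'.ae_eq)
  eq_primitive σ hσ := by
    have : ∫ s in (0 : ℝ)..σ, (g + g') s = ∫ s in (0 : ℝ)..σ, (g s + g' s) := by
      apply intervalIntegral.integral_congr_ae
      have := Lp.coeFn_add g g'
      rw [EventuallyEq, ae_restrict_iff' measurableSet_Icc] at this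
      filter_upwards [this] with s hs hsI
      rw [uIoc_of_ge hσ.2] at hsI
      simpa using hs ⟨hσ.1.trans hsI.1.le, hsI.2⟩
    rw [this, intervalIntegral.integral_add (historySpace_intervalIntegrable g hσ)
      (historySpace_intervalIntegrable g' hσ), Pi.add_apply, Pi.add_apply,
      h.eq_primitive σ hσ, h'.eq_primitive σ hσ]
    abel

theorem IsSobolevRep.smul {f g : HistorySpace X p} {F : ℝ → X} (c : ℂ)
    (h : IsSobolevRep f g F) : IsSobolevRep (c • f) (c • g) (c • F) where
  ae_eq := (Lp.coeFn_smul c f).trans (h.ae_eq.const_smul c)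
  eq_primitive σ hσ := by
    have : ∫ s in (0 : ℝ)..σ, (c • g) s = ∫ s in (0 : ℝ)..σ, c • g s := by
      apply intervalIntegral.integral_congr_ae
      have := Lp.coeFn_smul c g
      rw [EventuallyEq, ae_restrict_iff' measurableSet_Icc] at this
      filter_upwards [this] with s hs hsI
      rw [uIoc_of_ge hσ.2] at hsI
      simpa using hs ⟨hσ.1.trans hsI.1.le, hsI.2⟩
    rw [this, intervalIntegral.integral_smul, Pi.smul_apply, Pi.smul_apply,
      h.eq_primitive σ hσ, smul_add]

variable (X p) in
/-- The Sobolev space `W^{1,p}([-1,0], X)` as a subspace of `L^p([-1,0], X)`. -/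
def SobolevSpace : Submodule ℂ (HistorySpace X p) where
  carrier := {f | ∃ (g : HistorySpace X p) (F : ℝ → X), IsSobolevRep f g F}
  zero_mem' := ⟨0, 0, IsSobolevRep.zero⟩
  add_mem' := fun ⟨g, F, h⟩ ⟨g', F', h'⟩ => ⟨g + g', F + F', h.add h'⟩
  smul_mem' := fun c _ ⟨g, F, h⟩ => ⟨c • g, c • F, h.smul c⟩

namespace SobolevSpace

/-- The derivative `f'` as an element of `L^p`, as a plain function. -/
def derivFun (f : SobolevSpace X p) : HistorySpace X p := f.2.choose

/-- The absolutely continuous representative (only its values on `[-1,0]` are meaningful). -/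
def rep (f : SobolevSpace X p) : ℝ → X := f.2.choose_spec.choose

theorem isSobolevRep (f : SobolevSpace X p) : IsSobolevRep f.1 (derivFun f) (rep f) :=
  f.2.choose_spec.choose_spec

variable (X p) in
/-- The derivative `d/dσ : W^{1,p}([-1,0], X) → L^p([-1,0], X)`. -/
def derivative : SobolevSpace X p →ₗ[ℂ] HistorySpace X p where
  toFun := derivFun
  map_add' f f' :=
    (isSobolevRep (f + f')).deriv_unique ((isSobolevRep f).add (isSobolevRep f'))
  map_smul' c f := (isSobolevRep (c • f)).deriv_unique ((isSobolevRep f).smul c)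

variable (X p) in
/-- The point evaluation `δ_r : W^{1,p}([-1,0], X) → X`, `δ_r f = f(r)`, for `r ∈ [-1,0]`. -/
def eval (r : Icc (-1 : ℝ) 0) : SobolevSpace X p →ₗ[ℂ] X where
  toFun f := rep f r
  map_add' f f' :=
    (isSobolevRep (f + f')).rep_unique ((isSobolevRep f).add (isSobolevRep f')) r.2
  map_smul' c f := (isSobolevRep (c • f)).rep_unique ((isSobolevRep f).smul c) r.2

end SobolevSpace

/-! ### The delay semigroup -/

/-- The domain `{(x, f) ∈ D(B) × W^{1,p}([-1,0], X) : f(0) = x}`. -/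
def delayDomain (p : ℝ≥0∞) [Fact (1 ≤ p)] (B : X →ₗ.[ℂ] X) :
    Submodule ℂ (X × HistorySpace X p) where
  carrier := {z | z.1 ∈ B.domain ∧ ∃ hf : z.2 ∈ SobolevSpace X p,
    SobolevSpace.eval X p ⟨0, right_mem_Icc.2 (by norm_num)⟩ ⟨z.2, hf⟩ = z.1}
  zero_mem' := ⟨B.domain.zero_mem, (SobolevSpace X p).zero_mem, map_zero _⟩
  add_mem' := by
    rintro z w ⟨hz, hf, he⟩ ⟨hw, hf', he'⟩
    refine ⟨B.domain.add_mem hz hw, (SobolevSpace X p).add_mem hf hf', ?_⟩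
    exact ((SobolevSpace.eval X p _).map_add ⟨z.2, hf⟩ ⟨w.2, hf'⟩).trans
      (congrArg₂ (· + ·) he he')
  smul_mem' := by
    rintro c z ⟨hz, hf, he⟩
    refine ⟨B.domain.smul_mem c hz, (SobolevSpace X p).smul_mem c hf, ?_⟩
    exact ((SobolevSpace.eval X p _).map_smul c ⟨z.2, hf⟩).trans (congrArg (c • ·) he)

/-- The operator matrix `𝓐 = (B, Φ; 0, d/dσ)` on `𝓔 = X × L^p([-1,0], X)`, that is
`𝓐 (x, f) = (B x + Φ f, f')`, with domain `{(x, f) ∈ D(B) × W^{1,p}([-1,0], X) : f(0) = x}`.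
The solution semigroup of the delay equation `u'(t) = B u(t) + Φ u_t`, `u(0) = x`, `u_0 = f`, is
the semigroup on `𝓔` generated by `𝓐`. -/
def delayOperator (B : X →ₗ.[ℂ] X) (Φ : SobolevSpace X p →ₗ[ℂ] X) :
    (X × HistorySpace X p) →ₗ.[ℂ] (X × HistorySpace X p) where
  domain := delayDomain p B
  toFun :=
    { toFun := fun z =>
        (B ⟨z.1.1, z.2.1⟩ + Φ ⟨z.1.2, z.2.2.1⟩, SobolevSpace.derivative X p ⟨z.1.2, z.2.2.1⟩)
      map_add' := fun z w => by
        have h1 := B.toFun.map_add ⟨z.1.1, z.2.1⟩ ⟨w.1.1, w.2.1⟩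
        have h2 := Φ.map_add ⟨z.1.2, z.2.2.1⟩ ⟨w.1.2, w.2.2.1⟩
        have h3 := (SobolevSpace.derivative X p).map_add ⟨z.1.2, z.2.2.1⟩ ⟨w.1.2, w.2.2.1⟩
        exact Prod.ext ((congrArg₂ (· + ·) h1 h2).trans (add_add_add_comm _ _ _ _)) h3
      map_smul' := fun c z => by
        have h1 := B.toFun.map_smul c ⟨z.1.1, z.2.1⟩
        have h2 := Φ.map_smul c ⟨z.1.2, z.2.2.1⟩
        have h3 := (SobolevSpace.derivative X p).map_smul c ⟨z.1.2, z.2.2.1⟩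
        exact Prod.ext ((congrArg₂ (· + ·) h1 h2).trans (smul_add c _ _).symm) h3 }

variable (p) in
/-- The delay operator `Φ = C δ_{-τ}`, that is `Φ u_t = C u(t - τ)`, for `τ ∈ [0,1]`. -/
def pointDelay (C : X →L[ℂ] X) (τ : ℝ) (hτ : τ ∈ Icc (0 : ℝ) 1) : SobolevSpace X p →ₗ[ℂ] X :=
  (C : X →ₗ[ℂ] X).comp
    (SobolevSpace.eval X p ⟨-τ, neg_le_neg hτ.2, neg_nonpos.2 hτ.1⟩)

end Sobolev

end

/-! Let `S` and `U` be the semigroups generated by `B` and `B + C`. In the mild equation `v(t) =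
S(t) x + ∫₀ᵗ S(t-s) C v(s-τ) ds`, the substitution `r = s - τ` splits off the history term `∫_{-τ}^0
S(t-τ-r) C f(r) dr`. This term need not be small (for `p = 1` the mass of `f` may concentrate on
`[-τ,0]`), but norm continuity of `S` away from `0` allows `S(t-τ-r)` to be replaced by `S(t)` at
small cost. The history therefore acts only through the effective initial value `y = x + C ∫_{-τ}^0
f`, and Grönwall's inequality gives `v(t) ≈ U(t) y`, uniformly for bounded data and for `t` in
compact subsets of `(0,∞)` (`exists_delaySolution_close`).

Hence for fixed `t > 1` the delay solution operator is norm close to `G ∘ L` with `L(x,f) = y` and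
`G y = (U(t) y, U(t+·) y)`, while `L ∘ G` differs from `U(t)` only by an integral over an interval
of length `τ` (`exists_factorization`). If `U` is exponentially stable, `‖G‖ ‖L‖` is small for large
`t`, so the delay semigroup has norm at most `1/2` at one time, and this forces exponential decay.

Hyperbolicity is encoded by invertibility of the defect operator `(f_n) ↦ (f_{n+1} - A f_n)` on
bounded two-sided sequences. It holds for `A = U(t)` with `t` large
(`Hyperbolic.exists_invertibleWithBound`), is stable under small perturbations of `A`, and passes
from `L ∘ G` to `G ∘ L` just as `1 - GL` inherits invertibility from `1 - LG`. All bounds are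
explicit and independent of `τ`. Conversely, invertibility at one positive time recovers the
splitting (`hyperbolic_of_invertibleWithBound`).

The solution semigroup itself is built by the method of steps, and its generator is identified by
computing right derivatives at time zero (`isGeneratedBy_delaySemigroup`). -/

open scoped BoundedContinuousFunction

noncomputable section

/-! ### Hyperbolicity of bounded operators through bounded two-sided sequences -/

section Sequences

variable {E F G : Type*} [NormedAddCommGroup E] [NormedSpace ℂ E]
  [NormedAddCommGroup F] [NormedSpace ℂ F] [NormedAddCommGroup G] [NormedSpace ℂ G]

/-- The operator `A` acting termwise on bounded two-sided sequences. -/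
def seqMap (A : E →L[ℂ] F) : (ℤ →ᵇ E) →L[ℂ] (ℤ →ᵇ F) := A.compLeftContinuousBounded ℤ

@[simp] theorem seqMap_apply (A : E →L[ℂ] F) (f : ℤ →ᵇ E) (n : ℤ) : seqMap A f n = A (f n) := rfl

theorem norm_seqMap_le (A : E →L[ℂ] F) : ‖seqMap A‖ ≤ ‖A‖ :=
  ContinuousLinearMap.opNorm_le_bound _ (norm_nonneg _) fun f =>
    (BoundedContinuousFunction.norm_le (by positivity)).2 fun n =>
      A.le_opNorm_of_le (f.norm_coe_le_norm n)

variable (E) in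
/-- The shift `(f_n) ↦ (f_{n+k})` on bounded two-sided sequences. -/
def seqShift (k : ℤ) : (ℤ →ᵇ E) →L[ℂ] (ℤ →ᵇ E) :=
  LinearMap.mkContinuous
    { toFun := fun f => BoundedContinuousFunction.ofNormedAddCommGroup (fun n => f (n + k))
        continuous_of_discreteTopology ‖f‖ fun n => f.norm_coe_le_norm _
      map_add' := fun f g => by ext; simp
      map_smul' := fun c f => by ext; simp } 1 fun f => by
        rw [one_mul]
        exact BoundedContinuousFunction.norm_ofNormedAddCommGroup_le _ (norm_nonneg f)
          fun n => f.norm_coe_le_norm _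

@[simp] theorem seqShift_apply (k : ℤ) (f : ℤ →ᵇ E) (n : ℤ) : seqShift E k f n = f (n + k) := rfl

theorem norm_seqShift_le (k : ℤ) : ‖seqShift E k‖ ≤ 1 :=
  LinearMap.mkContinuous_norm_le _ zero_le_one _

/-- The sequence with the value `x` at `-1` and zero elsewhere. -/
def seqSingle : E →L[ℂ] (ℤ →ᵇ E) :=
  LinearMap.mkContinuous
    { toFun := fun x => BoundedContinuousFunction.ofNormedAddCommGroup
        (fun n : ℤ => if n = -1 then x else 0) continuous_of_discreteTopology ‖x‖ fun n => by
          split_ifs <;> simp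
      map_add' := fun x y => by ext n; by_cases h : n = -1 <;> simp [h]
      map_smul' := fun c x => by ext n; by_cases h : n = -1 <;> simp [h] } 1 fun x => by
        rw [one_mul]
        exact BoundedContinuousFunction.norm_ofNormedAddCommGroup_le _ (norm_nonneg x) fun n => by
          split_ifs <;> simp

@[simp] theorem seqSingle_apply (x : E) (n : ℤ) :
    seqSingle x n = if n = -1 then x else 0 := rfl

theorem norm_seqSingle_apply_le (x : E) : ‖seqSingle x‖ ≤ ‖x‖ :=
  BoundedContinuousFunction.norm_ofNormedAddCommGroup_le _ (norm_nonneg x) fun n => by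
    split_ifs <;> simp

/-- The operator `(f_n) ↦ (f_{n+1} - A f_n)` on bounded two-sided sequences. -/
def seqDefect (A : E →L[ℂ] E) : (ℤ →ᵇ E) →L[ℂ] (ℤ →ᵇ E) := seqShift E 1 - seqMap A

@[simp] theorem seqDefect_apply (A : E →L[ℂ] E) (f : ℤ →ᵇ E) (n : ℤ) :
    seqDefect A f n = f (n + 1) - A (f n) := rfl

/-- `a` is invertible, and its inverse has norm at most `K`. -/
def InvertibleWithBound {R : Type*} [NormedRing R] (a : R) (K : ℝ) : Prop :=
  ∃ b : R, a * b = 1 ∧ b * a = 1 ∧ ‖b‖ ≤ K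

/-- Neumann series: with `b` the inverse of `a`, one has `a - d = a (1 - b d)` and `‖b d‖ ≤ 1/2`. -/
theorem InvertibleWithBound.sub {E : Type*} [NormedAddCommGroup E] [NormedSpace ℂ E]
    [CompleteSpace E] {a d : E →L[ℂ] E} {K : ℝ} (h : InvertibleWithBound a K)
    (hd : K * ‖d‖ ≤ 1 / 2) : InvertibleWithBound (a - d) (2 * K) := by
  obtain ⟨b, hab, hba, hb⟩ := h
  have hbd : ‖b * d‖ ≤ 1 / 2 := by
    calc ‖b * d‖ ≤ ‖b‖ * ‖d‖ := norm_mul_le _ _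
      _ ≤ K * ‖d‖ := by gcongr
      _ ≤ _ := hd
  set u : (E →L[ℂ] E)ˣ := Units.oneSub (b * d) (by linarith) with hu
  have hu1 : (u : E →L[ℂ] E) = 1 - b * d := rfl
  set c : E →L[ℂ] E := ↑u⁻¹ with hc
  have huc : (1 - b * d) * c = 1 := u.mul_inv
  have hcu : c * (1 - b * d) = 1 := u.inv_mul
  have hfac : a - d = a * (1 - b * d) := by rw [mul_sub, mul_one, ← mul_assoc, hab, one_mul]
  refine ⟨c * b, ?_, ?_, ?_⟩
  · rw [hfac, mul_assoc, ← mul_assoc _ c, huc, one_mul, hab]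
  · rw [hfac, mul_assoc, ← mul_assoc b, hba, one_mul, hcu]
  -- The fixed point identity for `c = (1 - b d)⁻¹` gives `‖c‖ ≤ 1 + ‖c‖ / 2`, hence `‖c‖ ≤ 2`. Only
  -- `‖1‖ ≤ 1` is available, since the space may be trivial.
  · have h1 : c = 1 + b * d * c := by
      rw [sub_mul, one_mul, sub_eq_iff_eq_add] at huc; exact huc
    have hone : ‖(1 : E →L[ℂ] E)‖ ≤ 1 := ContinuousLinearMap.norm_id_le
    have h2 : ‖c‖ ≤ 1 + 1 / 2 * ‖c‖ := by
      calc ‖c‖ = ‖1 + b * d * c‖ := by rw [← h1]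
        _ ≤ ‖(1 : E →L[ℂ] E)‖ + ‖b * d * c‖ := norm_add_le _ _
        _ ≤ 1 + ‖b * d‖ * ‖c‖ := add_le_add hone (norm_mul_le _ _)
        _ ≤ _ := by gcongr
    calc ‖c * b‖ ≤ ‖c‖ * ‖b‖ := norm_mul_le _ _
      _ ≤ 2 * K := by
        have : ‖c‖ ≤ 2 := by linarith
        gcongr

theorem InvertibleWithBound.seqDefect_sub [CompleteSpace E] {A D : E →L[ℂ] E} {K : ℝ}
    (h : InvertibleWithBound (seqDefect A) K) (hD : K * ‖D‖ ≤ 1 / 2) :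
    InvertibleWithBound (seqDefect (A + D)) (2 * K) := by
  have : seqDefect (A + D) = seqDefect A - seqMap D := by
    ext f n; simp [sub_sub]
  rw [this]
  refine h.sub (le_trans ?_ hD)
  obtain ⟨b, -, -, hb⟩ := h
  exact mul_le_mul_of_nonneg_left (norm_seqMap_le D) ((norm_nonneg b).trans hb)

/-- Invertibility of the defect operator passes from `L ∘ G` to `G ∘ L`. -/
theorem InvertibleWithBound.seqDefect_swap {L : E →L[ℂ] F} {G : F →L[ℂ] E} {K : ℝ}
    (h : InvertibleWithBound (seqDefect (L.comp G)) K) :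
    InvertibleWithBound (seqDefect (G.comp L)) (1 + ‖G‖ * K * ‖L‖) := by
  obtain ⟨b, hab, hba, hb⟩ := h
  have h1 : ∀ (f : ℤ →ᵇ F) (n : ℤ), (b f) (n + 1) - L (G (b f n)) = f n := fun f n => by
    have := congrArg (fun T : (ℤ →ᵇ F) →L[ℂ] (ℤ →ᵇ F) => T f n) hab
    simpa using this
  have hinj : ∀ f g : ℤ →ᵇ F, seqDefect (L.comp G) f = seqDefect (L.comp G) g → f = g := by
    intro f g hfg
    have := congrArg b hfg
    have hb' : ∀ f, b (seqDefect (L.comp G) f) = f := fun f => by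
      have := congrArg (fun T : (ℤ →ᵇ F) →L[ℂ] (ℤ →ᵇ F) => T f) hba
      simpa using this
    rwa [hb', hb'] at this
  -- If `f_{n+1} - G L f_n = h_n`, applying `L` shows that `L f` solves the equation for `L ∘ G`
  -- with right side `L h`. So `L f = b (L h)` and `f_{n+1} = h_n + G (b (L h))_n`.
  refine ⟨seqShift E (-1) * (1 + (seqMap G).comp (b.comp (seqMap L))), ?_, ?_, ?_⟩
  · ext f n
    have := h1 (seqMap L f) (n - 1)
    simp only [sub_add_cancel, seqMap_apply] at this
    simp only [mul_apply_eq_comp, seqDefect_apply, seqShift_apply,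
      add_apply, one_apply_eq_self, ContinuousLinearMap.comp_apply,
      BoundedContinuousFunction.coe_add, Pi.add_apply, seqMap_apply,
      ← sub_eq_add_neg, map_add, ← this]
    simp
  · ext f n
    have hb' : b (seqMap L (seqDefect (G.comp L) f)) = seqMap L f := by
      apply hinj
      ext m
      simp [h1]
    simp only [mul_apply_eq_comp, seqDefect_apply, seqShift_apply,
      add_apply, one_apply_eq_self, ContinuousLinearMap.comp_apply,
      BoundedContinuousFunction.coe_add, Pi.add_apply, seqMap_apply, hb']
    simp
  · have hone : ‖(1 : (ℤ →ᵇ E) →L[ℂ] (ℤ →ᵇ E))‖ ≤ 1 := ContinuousLinearMap.norm_id_le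
    have h2 : ‖(seqMap G).comp (b.comp (seqMap L))‖ ≤ ‖G‖ * K * ‖L‖ := by
      calc _ ≤ ‖seqMap G‖ * (‖b‖ * ‖seqMap L‖) :=
            (ContinuousLinearMap.opNorm_comp_le _ _).trans
              (mul_le_mul_of_nonneg_left (ContinuousLinearMap.opNorm_comp_le _ _) (norm_nonneg _))
        _ ≤ ‖G‖ * (K * ‖L‖) := by
            have := (norm_nonneg b).trans hb
            have := norm_seqMap_le G
            have := norm_seqMap_le L
            gcongr
        _ = _ := by ring
    calc _ ≤ ‖seqShift E (-1)‖ * ‖1 + (seqMap G).comp (b.comp (seqMap L))‖ := norm_mul_le _ _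
      _ ≤ 1 * (1 + ‖G‖ * K * ‖L‖) := by
          have := (norm_add_le (1 : (ℤ →ᵇ E) →L[ℂ] (ℤ →ᵇ E))
            ((seqMap G).comp (b.comp (seqMap L)))).trans (add_le_add hone h2)
          exact mul_le_mul (norm_seqShift_le _) this (norm_nonneg _) zero_le_one
      _ = _ := one_mul _

/-- Invertibility of the defect operator of `A` when `A` is a contraction on the kernel of a
projection `P` and has a contractive inverse `V` on the range of `P`. -/
theorem invertibleWithBound_seqDefect_of_splitting [CompleteSpace E] {A P V : E →L[ℂ] E}
    (hPP : P * P = P) (hPA : P * A = A * P) (hAV : A * V = P) (hVA : V * A = P) (hPV : P * V = V)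
    (hVP : V * P = V) (hs : ‖A * (1 - P)‖ < 1) (hu : ‖V‖ < 1) :
    ∃ K, InvertibleWithBound (seqDefect A) K := by
  have e (x : E) : P (P x) = P x := congrArg (· x) hPP
  have eA (x : E) : P (A x) = A (P x) := congrArg (· x) hPA
  have eAV (x : E) : A (V x) = P x := congrArg (· x) hAV
  have eVA (x : E) : V (A x) = P x := congrArg (· x) hVA
  have ePV (x : E) : P (V x) = V x := congrArg (· x) hPV
  have eVP (x : E) : V (P x) = V x := congrArg (· x) hVP
  have hn1 : ‖seqShift E (-1) * seqMap (A * (1 - P))‖ < 1 :=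
    calc _ ≤ ‖seqShift E (-1)‖ * ‖seqMap (A * (1 - P))‖ := norm_mul_le _ _
      _ ≤ 1 * ‖A * (1 - P)‖ := mul_le_mul (norm_seqShift_le _) (norm_seqMap_le _) (norm_nonneg _)
          zero_le_one
      _ < 1 := by rwa [one_mul]
  have hn2 : ‖seqMap V * seqShift E 1‖ < 1 :=
    calc _ ≤ ‖seqMap V‖ * ‖seqShift E 1‖ := norm_mul_le _ _
      _ ≤ ‖V‖ * 1 := mul_le_mul (norm_seqMap_le _) (norm_seqShift_le _) (norm_nonneg _)
          (norm_nonneg _)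
      _ < 1 := by rwa [mul_one]
  -- On `ker P` the shift dominates and the defect is `shift (1 - shift⁻¹ A)`; on the range of `P`
  -- the operator `A` dominates and it is `-A (1 - V shift)`. The unit `w` collects the two leading
  -- factors, and the remaining ones are Neumann units.
  let w : ((ℤ →ᵇ E) →L[ℂ] (ℤ →ᵇ E))ˣ :=
    { val := seqShift E 1 * seqMap (1 - P) - seqMap (A * P)
      inv := seqShift E (-1) * seqMap (1 - P) - seqMap V
      val_inv := by ext f n; simp [e, eAV, ePV]
      inv_val := by ext f n; simp [e, eA, eVA, eVP] }
  have hunit : seqDefect A = ↑(w * Units.oneSub _ hn1 * Units.oneSub _ hn2) := by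
    ext f n
    simp [w, e, eA, eAV, ePV]
    abel
  rw [hunit]
  exact ⟨_, _, Units.mul_inv _, Units.inv_mul _, le_rfl⟩

end Sequences

/-! ### Green sequences and the stable and unstable subspaces. -/

section Sequences

variable {E : Type*} [NormedAddCommGroup E] [NormedSpace ℂ E]

/-- The Green sequence: given an inverse `b` of `seqDefect A`, the bounded sequence `y` with
`y_{n+1} - A y_n = x` for `n = -1` and `0` otherwise. -/
def seqGreen (b : (ℤ →ᵇ E) →L[ℂ] (ℤ →ᵇ E)) : E →L[ℂ] (ℤ →ᵇ E) := b.comp seqSingle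

variable {A : E →L[ℂ] E} {b : (ℤ →ᵇ E) →L[ℂ] (ℤ →ᵇ E)}

theorem seqGreen_defect (hab : seqDefect A * b = 1) (x : E) (n : ℤ) :
    seqGreen b x (n + 1) - A (seqGreen b x n) = if n = -1 then x else 0 := by
  have := congrArg (fun T : (ℤ →ᵇ E) →L[ℂ] (ℤ →ᵇ E) => T (seqSingle x) n) hab
  simpa [seqGreen] using this

theorem seqGreen_eq_of_defect (hba : b * seqDefect A = 1) {x : E} {f : ℤ →ᵇ E}
    (h : ∀ n, f (n + 1) - A (f n) = if n = -1 then x else 0) : seqGreen b x = f := by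
  have h1 : seqDefect A f = seqSingle x := by ext n; simp [h]
  have := congrArg (fun T : (ℤ →ᵇ E) →L[ℂ] (ℤ →ᵇ E) => T f) hba
  simpa [seqGreen, h1] using this

theorem norm_seqGreen_apply_le (x : E) (n : ℤ) : ‖seqGreen b x n‖ ≤ ‖b‖ * ‖x‖ :=
  ((seqGreen b x).norm_coe_le_norm n).trans
    (b.le_opNorm_of_le (norm_seqSingle_apply_le x))

/-- With the source at index `-1`, the jump between `-1` and `0` decomposes `x`: `y_0` will be its
stable part and `-A y_{-1}` its unstable part. -/
theorem seqGreen_zero_sub (hab : seqDefect A * b = 1) (x : E) :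
    seqGreen b x 0 - A (seqGreen b x (-1)) = x := by
  simpa using seqGreen_defect hab x (-1)

/-- Applying `T` termwise to the Green sequence of `x` solves the equation with source `T x`, and
bounded solutions are unique. This makes the splitting invariant under the whole semigroup and not
just under `A`. -/
theorem seqGreen_map_of_commute (hab : seqDefect A * b = 1) (hba : b * seqDefect A = 1)
    {T : E →L[ℂ] E} (hT : ∀ x, A (T x) = T (A x)) (x : E) (n : ℤ) :
    seqGreen b (T x) n = T (seqGreen b x n) := by
  rw [seqGreen_eq_of_defect hba (f := seqMap T (seqGreen b x))]
  · rfl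
  · intro n
    rw [seqMap_apply, seqMap_apply, hT, ← map_sub, seqGreen_defect hab]
    split_ifs <;> simp

/-- The Green sequence decays: `|n| ‖y_n‖ ≤ ‖b‖ (‖b‖ + 1) ‖x‖`. -/
theorem seqGreen_decay (hab : seqDefect A * b = 1) (hba : b * seqDefect A = 1) (x : E) (n : ℤ) :
    |(n : ℝ)| * ‖seqGreen b x n‖ ≤ ‖b‖ * ((‖b‖ + 1) * ‖x‖) := by
  set N : ℤ := |n| with hN
  -- A weight with increments at most `1`, truncated so that the weighted sequence stays bounded.
  -- Its defect consists of the increment times `y_{k+1}` and the weighted source, and is bounded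
  -- independently of `N`. Applying `b` and evaluating at `n`, where the weight is `|n|`, gives the
  -- decay.
  set c : ℤ → ℤ := fun k => min |k| N with hc
  have hc0 : ∀ k, 0 ≤ c k := fun k => le_min (abs_nonneg _) (abs_nonneg _)
  have hcN : ∀ k, c k ≤ N := fun k => min_le_right _ _
  have hc1 : ∀ k, |c (k + 1) - c k| ≤ 1 := by
    intro k
    simp only [hc]
    have h1 : |k + 1| ≤ |k| + 1 := by simpa using abs_add_le k 1
    have h2 : |k| ≤ |k + 1| + 1 := by
      have := abs_add_le (k + 1) (-1); simpa using this
    rw [abs_le]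
    constructor <;> omega
  have hc' : ∀ k, ‖((c k : ℝ) : ℂ)‖ ≤ N := fun k => by
    rw [Complex.norm_real, Real.norm_eq_abs, abs_of_nonneg (by exact_mod_cast hc0 k)]
    exact_mod_cast hcN k
  set z : ℤ →ᵇ E := BoundedContinuousFunction.ofNormedAddCommGroup
    (fun k => ((c k : ℝ) : ℂ) • seqGreen b x k) continuous_of_discreteTopology
    (N * ‖seqGreen b x‖) (fun k => by
      rw [norm_smul]
      exact mul_le_mul (hc' k) ((seqGreen b x).norm_coe_le_norm k) (norm_nonneg _)
        (by exact_mod_cast abs_nonneg n)) with hz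
  have hza : ∀ k, z k = ((c k : ℝ) : ℂ) • seqGreen b x k := fun k => rfl
  have hbz : b (seqDefect A z) = z := by
    have := congrArg (fun T : (ℤ →ᵇ E) →L[ℂ] (ℤ →ᵇ E) => T z) hba
    simpa using this
  have hdz : ‖seqDefect A z‖ ≤ (‖b‖ + 1) * ‖x‖ := by
    refine (BoundedContinuousFunction.norm_le (by positivity)).2 fun k => ?_
    have hk : seqDefect A z k = (((c (k + 1) - c k : ℤ) : ℝ) : ℂ) • seqGreen b x (k + 1) +
        ((c k : ℝ) : ℂ) • (if k = -1 then x else 0) := by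
      rw [← seqGreen_defect hab x k, seqDefect_apply, hza, hza, map_smul]
      push_cast
      module
    have h1 : ‖(((c (k + 1) - c k : ℤ) : ℝ) : ℂ)‖ ≤ 1 := by
      rw [Complex.norm_real, Real.norm_eq_abs]
      exact_mod_cast hc1 k
    have h2 : ‖((c k : ℝ) : ℂ) • (if k = -1 then x else 0)‖ ≤ ‖x‖ := by
      split_ifs with hk1
      · have : ‖((c k : ℝ) : ℂ)‖ ≤ 1 := by
          rw [Complex.norm_real, Real.norm_eq_abs, abs_of_nonneg (by exact_mod_cast hc0 k)]
          have : c k ≤ 1 := by subst hk1; exact (min_le_left _ _).trans (by simp)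
          exact_mod_cast this
        rw [norm_smul]
        exact mul_le_of_le_one_left (norm_nonneg _) this
      · simp
    rw [hk]
    calc _ ≤ ‖(((c (k + 1) - c k : ℤ) : ℝ) : ℂ)‖ * ‖seqGreen b x (k + 1)‖ + ‖x‖ :=
          (norm_add_le _ _).trans (by rw [norm_smul]; gcongr)
      _ ≤ 1 * (‖b‖ * ‖x‖) + ‖x‖ := by
          gcongr
          exact norm_seqGreen_apply_le x _
      _ = _ := by ring
  calc |(n : ℝ)| * ‖seqGreen b x n‖ = ‖z n‖ := by
        rw [hza, norm_smul, Complex.norm_real, Real.norm_eq_abs]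
        simp [hc, hN]
    _ ≤ ‖z‖ := z.norm_coe_le_norm n
    _ = ‖b (seqDefect A z)‖ := by rw [hbz]
    _ ≤ _ := b.le_opNorm_of_le hdz

/-- The stable subspace: the Green sequence vanishes at negative times. -/
def stableSpace (b : (ℤ →ᵇ E) →L[ℂ] (ℤ →ᵇ E)) : Submodule ℂ E where
  carrier := {x | seqGreen b x (-1) = 0}
  zero_mem' := by simp
  add_mem' := fun {x y} hx hy => by
    simp only [Set.mem_ofPred_eq] at *; simp [hx, hy]
  smul_mem' := fun c x hx => by
    simp only [Set.mem_ofPred_eq] at *; simp [hx]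

/-- The unstable subspace: the Green sequence vanishes at nonnegative times. -/
def unstableSpace (b : (ℤ →ᵇ E) →L[ℂ] (ℤ →ᵇ E)) : Submodule ℂ E where
  carrier := {x | seqGreen b x 0 = 0}
  zero_mem' := by simp
  add_mem' := fun {x y} hx hy => by
    simp only [Set.mem_ofPred_eq] at *; simp [hx, hy]
  smul_mem' := fun c x hx => by
    simp only [Set.mem_ofPred_eq] at *; simp [hx]

theorem mem_stableSpace {x : E} : x ∈ stableSpace b ↔ seqGreen b x (-1) = 0 := Iff.rfl

theorem mem_unstableSpace {x : E} : x ∈ unstableSpace b ↔ seqGreen b x 0 = 0 := Iff.rfl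

theorem continuous_seqGreen_apply (n : ℤ) : Continuous fun x => seqGreen b x n :=
  (continuous_eval_const n).comp (seqGreen b).continuous

theorem isClosed_stableSpace : IsClosed (stableSpace b : Set E) :=
  isClosed_eq (continuous_seqGreen_apply (-1)) continuous_const

theorem isClosed_unstableSpace : IsClosed (unstableSpace b : Set E) :=
  isClosed_eq (continuous_seqGreen_apply 0) continuous_const

theorem seqGreen_natCast (hab : seqDefect A * b = 1) (x : E) (n : ℕ) :
    seqGreen b x n = (A ^ n) (seqGreen b x 0) := by
  induction n with
  | zero => simp
  | succ n ih =>
    have := seqGreen_defect hab x n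
    rw [if_neg (by omega), sub_eq_zero] at this
    rw [Nat.cast_succ, this, ih, pow_succ']
    rfl

theorem pow_seqGreen_neg (hab : seqDefect A * b = 1) (x : E) (n : ℕ) :
    (A ^ n) (seqGreen b x (-(n + 1 : ℤ))) = seqGreen b x (-1) := by
  induction n with
  | zero => simp
  | succ n ih =>
    have := seqGreen_defect hab x (-(n + 1 + 1 : ℤ))
    rw [if_neg (by omega), sub_eq_zero] at this
    rw [pow_succ, ← ih, Nat.cast_succ]
    change (A ^ n) (A _) = _
    rw [← this]
    congr 2

theorem eq_zero_of_mem_of_mem (hab : seqDefect A * b = 1) {x : E} (hs : x ∈ stableSpace b)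
    (hu : x ∈ unstableSpace b) : x = 0 := by
  have := seqGreen_zero_sub hab x
  rw [mem_stableSpace.1 hs, mem_unstableSpace.1 hu] at this
  simpa using this.symm

/-- Cutting the Green sequence of `x` off at negative indices leaves a bounded sequence whose only
jump is from `0` to `y_0` at index `-1`. It is therefore the Green sequence of `y_0`. -/
theorem seqGreen_zero_mem_stableSpace (hab : seqDefect A * b = 1) (hba : b * seqDefect A = 1)
    (x : E) : seqGreen b x 0 ∈ stableSpace b := by
  rw [mem_stableSpace, seqGreen_eq_of_defect hba (f :=
    BoundedContinuousFunction.ofNormedAddCommGroup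
      (fun n : ℤ => if 0 ≤ n then seqGreen b x n else 0) continuous_of_discreteTopology
      (‖b‖ * ‖x‖) fun n => by
        split_ifs
        · exact norm_seqGreen_apply_le x n
        · simp; positivity)]
  · simp
  · intro n
    have := seqGreen_defect hab x n
    by_cases h1 : n = -1
    · subst h1; simp
    · rw [if_neg h1] at this ⊢
      by_cases h2 : 0 ≤ n
      · simpa [h2, show (0 : ℤ) ≤ n + 1 by omega] using this
      · simp [h2, show ¬ (0 : ℤ) ≤ n + 1 by omega]

theorem map_mem_stableSpace (hab : seqDefect A * b = 1) (hba : b * seqDefect A = 1)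
    {T : E →L[ℂ] E} (hT : ∀ x, A (T x) = T (A x)) {x : E} (hx : x ∈ stableSpace b) :
    T x ∈ stableSpace b := by
  rw [mem_stableSpace] at *
  rw [seqGreen_map_of_commute hab hba hT, hx, map_zero]

theorem map_mem_unstableSpace (hab : seqDefect A * b = 1) (hba : b * seqDefect A = 1)
    {T : E →L[ℂ] E} (hT : ∀ x, A (T x) = T (A x)) {x : E} (hx : x ∈ unstableSpace b) :
    T x ∈ unstableSpace b := by
  rw [mem_unstableSpace] at *
  rw [seqGreen_map_of_commute hab hba hT, hx, map_zero]

/-- The map `x ↦ y_0` is idempotent: the Green sequence of the stable vector `y_0` takes the value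
`y_0` at `0`. So it is the projection onto the stable part. -/
theorem sub_seqGreen_zero_mem_unstableSpace (hab : seqDefect A * b = 1)
    (hba : b * seqDefect A = 1) (x : E) : x - seqGreen b x 0 ∈ unstableSpace b := by
  have hs := mem_stableSpace.1 (seqGreen_zero_mem_stableSpace hab hba x)
  have h1 := seqGreen_zero_sub hab (seqGreen b x 0)
  rw [hs, map_zero A, sub_zero] at h1
  rw [mem_unstableSpace, map_sub, BoundedContinuousFunction.sub_apply, h1, sub_self]

theorem isCompl_stableSpace_unstableSpace (hab : seqDefect A * b = 1)
    (hba : b * seqDefect A = 1) : IsCompl (stableSpace b) (unstableSpace b) := by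
  constructor
  · rw [Submodule.disjoint_def]
    exact fun x => eq_zero_of_mem_of_mem hab
  · rw [codisjoint_iff, eq_top_iff]
    intro x _
    rw [← add_sub_cancel (seqGreen b x 0) x]
    exact Submodule.add_mem_sup (seqGreen_zero_mem_stableSpace hab hba x)
      (sub_seqGreen_zero_mem_unstableSpace hab hba x)

/-- The vector `-y_{-1}` is a preimage of `x`, but may have a stable component. The image of that
component under `A` lies in both subspaces, so it vanishes and the component can be removed. -/
theorem exists_mem_unstableSpace_map_eq (hab : seqDefect A * b = 1) (hba : b * seqDefect A = 1)
    {x : E} (hx : x ∈ unstableSpace b) : ∃ y ∈ unstableSpace b, A y = x := by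
  set z := seqGreen b x (-1)
  have h1 : -A z = x := by
    have := seqGreen_zero_sub hab x
    rwa [mem_unstableSpace.1 hx, zero_sub] at this
  set s := seqGreen b z 0 with hs
  have hsm := seqGreen_zero_mem_stableSpace hab hba z
  have hum := sub_seqGreen_zero_mem_unstableSpace hab hba z
  have hcomm : ∀ x, A (A x) = A (A x) := fun _ => rfl
  have hAs := map_mem_stableSpace hab hba hcomm hsm
  have hAu := map_mem_unstableSpace hab hba hcomm hum
  have hAs0 : A s = 0 := by
    refine eq_zero_of_mem_of_mem hab hAs ?_
    have : A s = -(A (z - s) + x) := by rw [← h1, map_sub]; abel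
    rw [this]
    exact neg_mem (add_mem hAu hx)
  refine ⟨-(z - s), neg_mem hum, ?_⟩
  rw [map_neg, map_sub, hAs0, sub_zero, h1]

/-- For stable `x` the Green sequence at nonnegative indices is the forward orbit of `x`. The decay
is only of order `1/n`, but this suffices for a factor `1/2` at one time. -/
theorem norm_pow_le_of_mem_stableSpace (hab : seqDefect A * b = 1) (hba : b * seqDefect A = 1)
    {x : E} (hx : x ∈ stableSpace b) (n : ℕ) :
    n * ‖(A ^ n) x‖ ≤ ‖b‖ * ((‖b‖ + 1) * ‖x‖) := by
  have h := seqGreen_decay hab hba x n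
  have h0 := seqGreen_zero_sub hab x
  rw [mem_stableSpace.1 hx, map_zero A, sub_zero] at h0
  rw [seqGreen_natCast hab, h0] at h
  simpa using h

/-- For unstable `x` and `n ≥ 1` the Green sequence of `A ^ n x` takes the value `-x` at index `-n`,
so its decay bounds `x` by `A ^ n x`. -/
theorem norm_le_of_mem_unstableSpace (hab : seqDefect A * b = 1) (hba : b * seqDefect A = 1)
    {x : E} (hx : x ∈ unstableSpace b) (n : ℕ) :
    n * ‖x‖ ≤ ‖b‖ * ((‖b‖ + 1) * ‖(A ^ n) x‖) := by
  rcases n with _ | n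
  · simp; positivity
  have h := seqGreen_decay hab hba ((A ^ (n + 1)) x) (-(n + 1 : ℤ))
  have hcomm : ∀ x, A ((A ^ (n + 1)) x) = (A ^ (n + 1)) (A x) := fun x => by
    change (A * A ^ (n + 1)) x = (A ^ (n + 1) * A) x
    rw [← pow_succ', ← pow_succ]
  have h0 := seqGreen_zero_sub hab x
  rw [mem_unstableSpace.1 hx, zero_sub] at h0
  have h1 : (A ^ (n + 1)) (seqGreen b x (-(n + 1 : ℤ))) = -x := by
    rw [pow_succ']
    change A ((A ^ n) _) = _
    rw [pow_seqGreen_neg hab]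
    exact neg_eq_iff_eq_neg.1 h0
  rw [seqGreen_map_of_commute hab hba hcomm, h1, norm_neg] at h
  have h2 : |((-(n + 1 : ℤ) : ℤ) : ℝ)| = ((n + 1 : ℕ) : ℝ) := by
    push_cast
    rw [abs_neg, abs_of_nonneg (by positivity)]
  rwa [h2] at h

end Sequences

/-! ### From one time of a semigroup to all times, and back. -/

namespace C0Semigroup

variable {E : Type*} [NormedAddCommGroup E] [NormedSpace ℂ E]

theorem op_add_apply (T : C0Semigroup E) (s t : ℝ≥0) (x : E) :
    T.op (s + t) x = T.op s (T.op t x) := by rw [T.op_add]; rfl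

theorem op_zero_apply (T : C0Semigroup E) (x : E) : T.op 0 x = x := by rw [T.op_zero]; rfl

theorem op_comm (T : C0Semigroup E) (s t : ℝ≥0) (x : E) :
    T.op s (T.op t x) = T.op t (T.op s x) := by
  rw [← op_add_apply, add_comm, op_add_apply]

theorem op_nsmul (T : C0Semigroup E) (n : ℕ) (t : ℝ≥0) : T.op (n * t) = T.op t ^ n := by
  induction n with
  | zero => rw [Nat.cast_zero, zero_mul, T.op_zero, pow_zero]; rfl
  | succ n ih => rw [Nat.cast_succ, add_mul, one_mul, T.op_add, ih, pow_succ]; rfl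

theorem exists_bound [CompleteSpace E] (T : C0Semigroup E) (b : ℝ≥0) :
    ∃ M : ℝ, 1 ≤ M ∧ ∀ t ≤ b, ‖T.op t‖ ≤ M := by
  obtain ⟨M, hM⟩ := banach_steinhaus (g := fun t : Icc (0 : ℝ≥0) b => T.op t) fun x => by
    obtain ⟨C, hC⟩ := (isCompact_Icc (a := (0 : ℝ≥0)) (b := b)).exists_bound_of_continuousOn
      (T.continuous_orbit x).continuousOn
    exact ⟨C, fun t => hC t t.2⟩
  exact ⟨max M 1, le_max_right _ _, fun t ht => (hM ⟨t, zero_le, ht⟩).trans (le_max_left _ _)⟩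

/-- Contraction at one time on an invariant set yields exponential decay there. -/
theorem exists_decay_of_contraction [CompleteSpace E] (T : C0Semigroup E) {t₁ : ℝ≥0}
    (ht₁ : 0 < t₁) : ∃ M ε : ℝ, 0 < ε ∧
      (∀ Y : Set E, MapsTo (T.op t₁) Y Y → (∀ x ∈ Y, ‖T.op t₁ x‖ ≤ 1 / 2 * ‖x‖) →
        ∀ t : ℝ≥0, ∀ x ∈ Y, ‖T.op t x‖ ≤ M * Real.exp (-ε * t) * ‖x‖) ∧
      (∀ Y : Set E, MapsTo (T.op t₁) Y Y → (∀ x ∈ Y, ‖x‖ ≤ 1 / 2 * ‖T.op t₁ x‖) →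
        ∀ t : ℝ≥0, ∀ x ∈ Y, ‖x‖ ≤ M * Real.exp (-ε * t) * ‖T.op t x‖) := by
  obtain ⟨M, hM1, hM⟩ := T.exists_bound t₁
  have hM0 : 0 ≤ M := zero_le_one.trans hM1
  have ht₁' : (0 : ℝ) < t₁ := ht₁
  -- Chosen so that `(1/2) ^ n = exp (-ε n t₁)`.
  set ε := Real.log 2 / t₁ with hε
  have hε0 : 0 < ε := div_pos (Real.log_pos one_lt_two) ht₁'
  have hexp (t : ℝ) (n : ℕ) (h : t ≤ n * t₁) : (1 / 2 : ℝ) ^ n ≤ Real.exp (-ε * t) := by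
    have : (1 / 2 : ℝ) ^ n = Real.exp (-ε * (n * t₁)) := by
      rw [hε, show -(Real.log 2 / t₁) * (n * t₁) = n * (-Real.log 2) by field_simp,
        Real.exp_nat_mul, Real.exp_neg, Real.exp_log two_pos, one_div]
    rw [this, Real.exp_le_exp]
    nlinarith
  have key (t : ℝ≥0) : ∃ n : ℕ, n * t₁ ≤ t ∧ t ≤ n * t₁ + t₁ := by
    refine ⟨⌊t / t₁⌋₊, ?_, ?_⟩
    · exact (le_div_iff₀ ht₁).1 (Nat.floor_le zero_le)
    · have := (Nat.lt_floor_add_one (t / t₁)).le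
      rw [div_le_iff₀ ht₁] at this
      simpa [add_mul] using this
  -- The factor `2` pays for rounding `t` down to a multiple of `t₁`. The constants do not depend on
  -- `Y`, so the same pair serves the stable and the unstable subspace.
  refine ⟨2 * M, ε, hε0, fun Y hY hc t x hx => ?_, fun Y hY hc t x hx => ?_⟩
  · obtain ⟨n, h1, h2⟩ := key t
    have hpow : ∀ n : ℕ, ‖T.op (n * t₁) x‖ ≤ (1 / 2) ^ n * ‖x‖ ∧ T.op (n * t₁) x ∈ Y := by
      intro n
      induction n with
      | zero => simp [op_zero_apply, hx]
      | succ n ih =>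
        rw [Nat.cast_succ, add_mul, one_mul, add_comm _ t₁, op_add_apply]
        refine ⟨(hc _ ih.2).trans ?_, hY ih.2⟩
        rw [pow_succ']
        nlinarith [ih.1]
    have ht : t = (t - n * t₁) + n * t₁ := (tsub_add_cancel_of_le h1).symm
    calc ‖T.op t x‖ = ‖T.op (t - n * t₁) (T.op (n * t₁) x)‖ := by rw [← op_add_apply, ← ht]
      _ ≤ M * ((1 / 2) ^ n * ‖x‖) := by
        refine (ContinuousLinearMap.le_opNorm _ _).trans ?_
        refine mul_le_mul (hM _ ?_) (hpow n).1 (norm_nonneg _) hM0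
        rw [tsub_le_iff_left]; exact h2
      _ = 2 * M * (1 / 2) ^ (n + 1) * ‖x‖ := by rw [pow_succ]; ring
      _ ≤ _ := by
        gcongr
        apply hexp
        have : (t : ℝ) ≤ n * t₁ + t₁ := by exact_mod_cast h2
        push_cast
        linarith
  · obtain ⟨n, h1, h2⟩ := key t
    have hpow : ∀ n : ℕ, ‖x‖ ≤ (1 / 2) ^ n * ‖T.op (n * t₁) x‖ ∧ T.op (n * t₁) x ∈ Y := by
      intro n
      induction n with
      | zero => simp [op_zero_apply, hx]
      | succ n ih =>
        rw [Nat.cast_succ, add_mul, one_mul, add_comm _ t₁, op_add_apply]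
        refine ⟨ih.1.trans ?_, hY ih.2⟩
        rw [pow_succ, mul_assoc]
        exact mul_le_mul_of_nonneg_left (hc _ ih.2) (by positivity)
    -- Backward estimates round up instead: the overshoot `(n + 1) t₁ - t` is at most `t₁`, so its
    -- operator is bounded by `M`.
    have h2' : t ≤ (n + 1 : ℕ) * t₁ := by push_cast; rwa [add_mul, one_mul]
    have ht : ((n + 1 : ℕ) : ℝ≥0) * t₁ = ((n + 1 : ℕ) * t₁ - t) + t :=
      (tsub_add_cancel_of_le h2').symm
    calc ‖x‖ ≤ (1 / 2) ^ (n + 1) * ‖T.op ((n + 1 : ℕ) * t₁) x‖ := (hpow (n + 1)).1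
      _ = (1 / 2) ^ (n + 1) * ‖T.op ((n + 1 : ℕ) * t₁ - t) (T.op t x)‖ := by
        rw [← op_add_apply, ← ht]
      _ ≤ (1 / 2) ^ (n + 1) * (M * ‖T.op t x‖) := by
        gcongr
        refine ContinuousLinearMap.le_of_opNorm_le _ (hM _ ?_) _
        rw [tsub_le_iff_left]
        push_cast
        rw [add_mul, one_mul]
        exact add_le_add_left h1 _
      _ ≤ Real.exp (-ε * t) * (2 * M * ‖T.op t x‖) := by
        gcongr
        · apply hexp; exact_mod_cast h2'
        · linarith
      _ = _ := by ring

theorem exponentiallyStable_of_norm_le_half [CompleteSpace E] (T : C0Semigroup E) {t₁ : ℝ≥0}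
    (ht₁ : 0 < t₁) (h : ‖T.op t₁‖ ≤ 1 / 2) : T.ExponentiallyStable := by
  obtain ⟨M, ε, hε, h1, -⟩ := T.exists_decay_of_contraction ht₁
  have := h1 univ (mapsTo_univ _ _) fun x _ => ContinuousLinearMap.le_of_opNorm_le _ h x
  refine ⟨max M 0, ε, hε, fun t => ContinuousLinearMap.opNorm_le_bound _ (by positivity) fun x => ?_⟩
  refine (this t x (mem_univ x)).trans ?_
  gcongr
  exact le_max_left _ _

/-- The Green sequences of `T(t₀)` supply the splitting, which every `T(t)` respects because it
commutes with `T(t₀)`. The `1/n` decay becomes a contraction at time `N t₀`, hence exponential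
decay. -/
theorem hyperbolic_of_invertibleWithBound [CompleteSpace E] (T : C0Semigroup E) {t₀ : ℝ≥0}
    (ht₀ : 0 < t₀) {K : ℝ} (h : InvertibleWithBound (seqDefect (T.op t₀)) K) :
    T.Hyperbolic := by
  obtain ⟨b, hab, hba, -⟩ := h
  -- Large enough that the decay constant `‖b‖ (‖b‖ + 1)` divided by `N` is below `1/2`.
  obtain ⟨N, hN⟩ := exists_nat_gt (2 * (‖b‖ * (‖b‖ + 1)))
  have hN0 : 0 < N := by
    have : (0 : ℝ) < N := lt_of_le_of_lt (by positivity) hN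
    exact_mod_cast this
  have hcomm (t : ℝ≥0) (x : E) : T.op t₀ (T.op t x) = T.op t (T.op t₀ x) := T.op_comm _ _ _
  have hms (t : ℝ≥0) : MapsTo (T.op t) (stableSpace b) (stableSpace b) := fun x hx =>
    map_mem_stableSpace hab hba (hcomm t) hx
  have hmu (t : ℝ≥0) : MapsTo (T.op t) (unstableSpace b) (unstableSpace b) := fun x hx =>
    map_mem_unstableSpace hab hba (hcomm t) hx
  have ht₁ : 0 < N * t₀ := mul_pos (by exact_mod_cast hN0) ht₀
  obtain ⟨M, ε, hε, h1, h2⟩ := T.exists_decay_of_contraction ht₁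
  have hhalf {u v : ℝ} (hu : 0 ≤ u) (hv : 0 ≤ v)
      (h : N * u ≤ ‖b‖ * ((‖b‖ + 1) * v)) : u ≤ 1 / 2 * v := by
    have hN' : (0 : ℝ) < N := by exact_mod_cast hN0
    have : N * u ≤ N * (1 / 2 * v) := h.trans (by nlinarith)
    exact le_of_mul_le_mul_left this hN'
  have hes := h1 (stableSpace b) (hms _) fun x hx => by
    rw [op_nsmul]
    exact hhalf (norm_nonneg _) (norm_nonneg _) (norm_pow_le_of_mem_stableSpace hab hba hx N)
  have heu := h2 (unstableSpace b) (hmu _) fun x hx => by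
    rw [op_nsmul]
    exact hhalf (norm_nonneg _) (norm_nonneg _) (norm_le_of_mem_unstableSpace hab hba hx N)
  refine ⟨stableSpace b, unstableSpace b, isClosed_stableSpace, isClosed_unstableSpace,
    isCompl_stableSpace_unstableSpace hab hba, hms, fun t => ⟨hmu t, ?_, ?_⟩, M, ε, hε, hes, heu⟩
  · intro x hx y hy hxy
    have := heu t (x - y) (sub_mem hx hy)
    rw [map_sub, hxy, sub_self, norm_zero, mul_zero] at this
    exact sub_eq_zero.1 (norm_le_zero_iff.1 this)
  · have hsurj : ∀ n : ℕ, ∀ x ∈ unstableSpace b, ∃ y ∈ unstableSpace b, T.op (n * t₀) y = x := by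
      intro n
      induction n with
      | zero => exact fun x hx => ⟨x, hx, by simp [op_zero_apply]⟩
      | succ n ih =>
        intro x hx
        obtain ⟨y, hy, rfl⟩ := exists_mem_unstableSpace_map_eq hab hba hx
        obtain ⟨z, hz, rfl⟩ := ih y hy
        exact ⟨z, hz, by
          rw [Nat.cast_succ, add_mul, one_mul, add_comm _ t₀, op_add_apply]⟩
    -- Surjectivity of `T(t)` comes from that of `T(n t₀)` with `n t₀ ≥ t`: if `x = T(n t₀) y`, then
    -- `T(n t₀ - t) y` is a preimage of `x`.
    intro x hx
    obtain ⟨n, hn⟩ := exists_nat_ge (t / t₀)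
    have hn' : t ≤ n * t₀ := (div_le_iff₀ ht₀).1 hn
    obtain ⟨y, hy, rfl⟩ := hsurj n x hx
    refine ⟨T.op (n * t₀ - t) y, hmu _ hy, ?_⟩
    rw [← op_add_apply, add_tsub_cancel_of_le hn']

/-- Closed complements have a bounded projection `P` onto `Eu`. The inverse of `U(t)` on `Eu`,
composed with `P`, is a bounded operator `V`, and for large `t` the exponential estimates make both
`U(t) (1 - P)` and `V` strict contractions. -/
theorem Hyperbolic.exists_invertibleWithBound [CompleteSpace E] {U : C0Semigroup E}
    (hU : U.Hyperbolic) :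
    ∃ t₁ : ℝ≥0, ∀ t ≥ t₁, ∃ K, InvertibleWithBound (seqDefect (U.op t)) K := by
  obtain ⟨Es, Eu, hEs, hEu, hc, hms, hbu, M, ε, hε, hs, hu⟩ := hU
  have htc : Submodule.IsTopCompl Eu Es :=
    Submodule.isTopCompl_iff_isCompl_isClosed.2 ⟨hc.symm, hEu, hEs⟩
  set P : E →L[ℂ] E := Eu.projectionL Es htc with hP
  have hPmem (x : E) : P x ∈ Eu := Submodule.projectionL_apply_mem htc x
  have hPu {x : E} (hx : x ∈ Eu) : P x = x := Submodule.projectionL_apply_left htc ⟨x, hx⟩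
  have hPs {x : E} (hx : x ∈ Es) : P x = 0 := (Submodule.projectionL_apply_eq_zero_iff htc).2 hx
  have hQmem (x : E) : x - P x ∈ Es := by
    rw [← Submodule.projectionL_apply_eq_zero_iff htc, map_sub, ← hP, hPu (hPmem x), sub_self]
  -- The sum of both prefactors, so that one threshold for `t` controls both contractions.
  set κ := |M| * (‖(1 : E →L[ℂ] E) - P‖ + ‖P‖) with hκ
  have hlim : Tendsto (fun t : ℝ => κ * Real.exp (-ε * t)) atTop (𝓝 (κ * 0)) := by
    refine Tendsto.const_mul _ (Real.tendsto_exp_atBot.comp ?_)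
    exact tendsto_id.const_mul_atTop_of_neg (neg_neg_of_pos hε)
  rw [mul_zero] at hlim
  obtain ⟨t₁, ht₁⟩ := eventually_atTop.1 (hlim.eventually_lt_const (zero_lt_one' ℝ))
  refine ⟨t₁.toNNReal, fun t ht => ?_⟩
  have hlt := ht₁ t (Real.toNNReal_le_iff_le_coe.1 ht)
  set A := U.op t with hA
  have hinj : Function.Injective ((A : E →ₗ[ℂ] E).restrict (hbu t).mapsTo) := by
    intro x y hxy
    exact Subtype.ext ((hbu t).injOn x.2 y.2 (congrArg Subtype.val hxy))
  have hsurj : Function.Surjective ((A : E →ₗ[ℂ] E).restrict (hbu t).mapsTo) := by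
    intro y
    obtain ⟨x, hx, hxy⟩ := (hbu t).surjOn y.2
    exact ⟨⟨x, hx⟩, Subtype.ext hxy⟩
  set e := LinearEquiv.ofBijective _ ⟨hinj, hsurj⟩ with he
  have hAe (y : Eu) : A (e.symm y) = y := congrArg Subtype.val (e.apply_symm_apply y)
  have heA (x : Eu) : e.symm ⟨A x, (hbu t).mapsTo x.2⟩ = x := e.symm_apply_apply x
  have hVb (x : E) : ‖(e.symm ⟨P x, hPmem x⟩ : E)‖ ≤ |M| * Real.exp (-ε * t) * ‖P‖ * ‖x‖ := by
    have := hu t _ (e.symm ⟨P x, hPmem x⟩).2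
    rw [← hA, hAe] at this
    calc _ ≤ _ := this
      _ ≤ |M| * Real.exp (-ε * t) * (‖P‖ * ‖x‖) := by
        gcongr
        · exact le_abs_self M
        · exact P.le_opNorm x
      _ = _ := by ring
  let V : E →L[ℂ] E := LinearMap.mkContinuous
    { toFun := fun x => (e.symm ⟨P x, hPmem x⟩ : E)
      map_add' := fun x y => by
        rw [← Submodule.coe_add, ← map_add]; congr 2; exact Subtype.ext (map_add P x y)
      map_smul' := fun c x => by
        rw [RingHom.id_apply, ← Submodule.coe_smul, ← map_smul]; congr 2
        exact Subtype.ext (map_smul P c x) } _ hVb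
  have hV (x : E) : V x = e.symm ⟨P x, hPmem x⟩ := rfl
  have hVmem (x : E) : V x ∈ Eu := (e.symm ⟨P x, hPmem x⟩).2
  have hPA (x : E) : P (A x) = A (P x) := by
    have h1 : A x = A (P x) + A (x - P x) := by rw [← map_add, add_sub_cancel]
    rw [h1, map_add, hPu ((hbu t).mapsTo (hPmem x)), hPs (hms t (hQmem x)), add_zero]
  refine invertibleWithBound_seqDefect_of_splitting (P := P) (V := V) ?_ ?_ ?_ ?_ ?_ ?_ ?_ ?_
  · ext x; exact hPu (hPmem x)
  · ext x; exact hPA x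
  · ext x; exact hAe _
  · ext x
    change V (A x) = P x
    rw [hV]
    have := heA ⟨P x, hPmem x⟩
    simp only [hPA, this]
  · ext x; exact hPu (hVmem x)
  · ext x
    change V (P x) = V x
    rw [hV, hV]
    simp only [hPu (hPmem x)]
  · refine lt_of_le_of_lt (ContinuousLinearMap.opNorm_le_bound _
      (M := |M| * Real.exp (-ε * t) * ‖(1 : E →L[ℂ] E) - P‖) (by positivity) fun x => ?_) ?_
    · calc _ ≤ _ := hs t _ (hQmem x)
        _ ≤ |M| * Real.exp (-ε * t) * (‖(1 : E →L[ℂ] E) - P‖ * ‖x‖) := by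
          gcongr
          · exact le_abs_self M
          · exact ((1 : E →L[ℂ] E) - P).le_opNorm x
        _ = _ := by ring
    · refine lt_of_le_of_lt ?_ hlt
      rw [hκ]
      nlinarith [mul_nonneg (mul_nonneg (abs_nonneg M) (Real.exp_nonneg (-ε * t))) (norm_nonneg P)]
  · refine lt_of_le_of_lt (LinearMap.mkContinuous_norm_le _ (by positivity) _) ?_
    refine lt_of_le_of_lt ?_ hlt
    rw [hκ]
    nlinarith [mul_nonneg (mul_nonneg (abs_nonneg M) (Real.exp_nonneg (-ε * t)))
      (norm_nonneg ((1 : E →L[ℂ] E) - P))]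

end C0Semigroup

/-! ### Strongly continuous semigroups in real time -/

namespace C0Semigroup

variable {X : Type*} [NormedAddCommGroup X] [NormedSpace ℂ X]

/-- The operators of a semigroup indexed by real times, constant for negative times. -/
def opReal (T : C0Semigroup X) (t : ℝ) : X →L[ℂ] X := T.op t.toNNReal

theorem opReal_coe (T : C0Semigroup X) (t : ℝ≥0) : T.opReal t = T.op t := by
  rw [opReal, Real.toNNReal_coe]

theorem opReal_zero_apply (T : C0Semigroup X) (x : X) : T.opReal 0 x = x := by
  rw [opReal, Real.toNNReal_zero, op_zero_apply]

theorem opReal_add_apply (T : C0Semigroup X) {s t : ℝ} (hs : 0 ≤ s) (ht : 0 ≤ t) (x : X) :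
    T.opReal (s + t) x = T.opReal s (T.opReal t x) := by
  rw [opReal, Real.toNNReal_add hs ht, op_add_apply]; rfl

theorem continuous_opReal (T : C0Semigroup X) (x : X) : Continuous fun t => T.opReal t x :=
  (T.continuous_orbit x).comp continuous_real_toNNReal

theorem exists_bound_opReal [CompleteSpace X] (T : C0Semigroup X) (b : ℝ) :
    ∃ M : ℝ, 1 ≤ M ∧ ∀ t ≤ b, ‖T.opReal t‖ ≤ M := by
  obtain ⟨M, h1, h⟩ := T.exists_bound b.toNNReal
  exact ⟨M, h1, fun t ht => h _ (Real.toNNReal_le_toNNReal ht)⟩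

theorem continuous_opReal_uncurry [CompleteSpace X] (T : C0Semigroup X) :
    Continuous fun q : ℝ × X => T.opReal q.1 q.2 := by
  rw [continuous_iff_continuousAt]
  rintro ⟨t, x⟩
  obtain ⟨M, hM1, hM⟩ := T.exists_bound_opReal (t + 1)
  have h1 : Tendsto (fun q : ℝ × X => T.opReal q.1 x) (𝓝 (t, x)) (𝓝 (T.opReal t x)) :=
    ((T.continuous_opReal x).comp continuous_fst).tendsto (t, x)
  have h2 : Tendsto (fun q : ℝ × X => T.opReal q.1 (q.2 - x)) (𝓝 (t, x)) (𝓝 0) := by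
    have hb : ∀ᶠ q : ℝ × X in 𝓝 (t, x), ‖T.opReal q.1 (q.2 - x)‖ ≤ M * ‖q.2 - x‖ := by
      have : ∀ᶠ q : ℝ × X in 𝓝 (t, x), q.1 < t + 1 :=
        (continuous_fst.tendsto (t, x)).eventually_lt_const (by simp)
      filter_upwards [this] with q hq
      exact ContinuousLinearMap.le_of_opNorm_le _ (hM _ hq.le) _
    refine squeeze_zero_norm' hb ?_
    have : Continuous fun q : ℝ × X => M * ‖q.2 - x‖ := by fun_prop
    simpa using this.tendsto (t, x)
  have := h1.add h2
  rw [add_zero] at this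
  refine this.congr fun q => ?_
  rw [← map_add, add_sub_cancel]

theorem aestronglyMeasurable_opReal_sub [CompleteSpace X] (T : C0Semigroup X) {μ : Measure ℝ}
    {g : ℝ → X} (hg : AEStronglyMeasurable g μ) (t : ℝ) :
    AEStronglyMeasurable (fun s => T.opReal (t - s) (g s)) μ :=
  T.continuous_opReal_uncurry.comp_aestronglyMeasurable
    (f := fun s => (t - s, g s)) ((by fun_prop : Continuous fun s : ℝ => t - s).aestronglyMeasurable.prodMk hg)

theorem integrableOn_opReal_sub [CompleteSpace X] (T : C0Semigroup X) {a c : ℝ}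
    {g : ℝ → X} (hg : IntegrableOn g (Ioc a c)) (t : ℝ) :
    IntegrableOn (fun s => T.opReal (t - s) (g s)) (Ioc a c) := by
  obtain ⟨M, hM1, hM⟩ := T.exists_bound_opReal (t - a)
  refine (hg.norm.const_mul M).mono' (T.aestronglyMeasurable_opReal_sub hg.1 t) ?_
  filter_upwards [ae_restrict_mem measurableSet_Ioc] with s hs
  exact ContinuousLinearMap.le_of_opNorm_le _ (hM _ (by linarith [hs.1])) _

/-- The convolution `∫₀ᵗ T(t-s) g(s) ds`. -/
def conv (T : C0Semigroup X) (g : ℝ → X) (t : ℝ) : X :=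
  ∫ s in (0 : ℝ)..t, T.opReal (t - s) (g s)

theorem norm_conv_le (T : C0Semigroup X) {M b : ℝ}
    (hM : ∀ t ≤ b, ‖T.opReal t‖ ≤ M) {g : ℝ → X} {t : ℝ} (ht0 : 0 ≤ t) (htb : t ≤ b)
    (hg : IntegrableOn g (Ioc 0 t)) : ‖T.conv g t‖ ≤ M * ∫ s in (0 : ℝ)..t, ‖g s‖ := by
  rw [← intervalIntegral.integral_const_mul]
  refine intervalIntegral.norm_integral_le_of_norm_le ht0 ?_ ?_
  · filter_upwards with s hs
    exact ContinuousLinearMap.le_of_opNorm_le _ (hM _ (by linarith [hs.1])) _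
  · rw [intervalIntegrable_iff_integrableOn_Ioc_of_le ht0]
    exact hg.norm.const_mul M

/-- The variable endpoint is removed by integrating over the fixed interval `[0, b]`. As `opReal` is
the identity at negative times, the surplus is `∫_t^b g`, which is continuous in `t`; dominated
convergence handles the fixed interval. -/
theorem continuousOn_conv [CompleteSpace X] (T : C0Semigroup X) {b : ℝ} (hb : 0 ≤ b) {g : ℝ → X}
    (hg : IntegrableOn g (Ioc 0 b)) : ContinuousOn (T.conv g) (Icc 0 b) := by
  obtain ⟨M, hM1, hM⟩ := T.exists_bound_opReal b
  have hgi : IntervalIntegrable g volume 0 b :=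
    (intervalIntegrable_iff_integrableOn_Ioc_of_le hb).2 hg
  have h1 : ContinuousOn (fun t => ∫ s in (0 : ℝ)..b, T.opReal (t - s) (g s)) (Icc 0 b) := by
    intro t ht
    refine intervalIntegral.continuousWithinAt_of_dominated_interval
      (bound := fun s => M * ‖g s‖) ?_ ?_ (hgi.norm.const_mul M) ?_
    · filter_upwards with u
      rw [uIoc_of_le hb]
      exact T.aestronglyMeasurable_opReal_sub hg.1 u
    · filter_upwards [self_mem_nhdsWithin] with u hu
      filter_upwards with s hs
      rw [uIoc_of_le hb] at hs
      exact ContinuousLinearMap.le_of_opNorm_le _ (hM _ (by linarith [hs.1, hu.2])) _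
    · filter_upwards with s _
      exact ((T.continuous_opReal (g s)).comp
        (by fun_prop : Continuous fun u : ℝ => u - s)).continuousWithinAt
  have h2 : ContinuousOn (fun t => ∫ s in t..b, g s) (Icc 0 b) := by
    have := intervalIntegral.continuousOn_primitive_interval' hgi left_mem_uIcc
    rw [uIcc_of_le hb] at this
    refine ((continuousOn_const (c := ∫ s in (0 : ℝ)..b, g s)).sub this).congr fun t ht => ?_
    refine (intervalIntegral.integral_interval_sub_left hgi ?_).symm
    exact hgi.mono_set (by rw [uIcc_of_le hb, uIcc_of_le ht.1]; exact Icc_subset_Icc_right ht.2)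
  refine (h1.sub h2).congr fun t ht => ?_
  have hi1 : IntervalIntegrable (fun s => T.opReal (t - s) (g s)) volume 0 t :=
    (intervalIntegrable_iff_integrableOn_Ioc_of_le ht.1).2
      (T.integrableOn_opReal_sub (hg.mono_set (Ioc_subset_Ioc_right ht.2)) t)
  have hi2 : IntervalIntegrable (fun s => T.opReal (t - s) (g s)) volume t b :=
    (intervalIntegrable_iff_integrableOn_Ioc_of_le ht.2).2
      (T.integrableOn_opReal_sub (hg.mono_set (Ioc_subset_Ioc_left ht.1)) t)
  have h3 : ∫ s in t..b, T.opReal (t - s) (g s) = ∫ s in t..b, g s := by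
    refine intervalIntegral.integral_congr fun s hs => ?_
    rw [uIcc_of_le ht.2] at hs
    simp only [opReal, Real.toNNReal_of_nonpos (sub_nonpos.2 hs.1), op_zero_apply]
  simp only [conv, Pi.sub_apply]
  rw [← intervalIntegral.integral_add_adjacent_intervals hi1 hi2, h3, add_sub_cancel_right]

theorem conv_add [CompleteSpace X] (T : C0Semigroup X) {s t : ℝ} (hs : 0 ≤ s) (ht : 0 ≤ t)
    {g : ℝ → X} (hg : IntegrableOn g (Ioc 0 (t + s))) :
    T.conv g (t + s) = T.opReal t (T.conv g s) + T.conv (fun r => g (r + s)) t := by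
  have hi1 : IntervalIntegrable (fun r => T.opReal (t + s - r) (g r)) volume 0 s :=
    (intervalIntegrable_iff_integrableOn_Ioc_of_le hs).2
      (T.integrableOn_opReal_sub (hg.mono_set (Ioc_subset_Ioc_right (by linarith))) _)
  have hi2 : IntervalIntegrable (fun r => T.opReal (t + s - r) (g r)) volume s (t + s) :=
    (intervalIntegrable_iff_integrableOn_Ioc_of_le (by linarith)).2
      (T.integrableOn_opReal_sub (hg.mono_set (Ioc_subset_Ioc_left hs)) _)
  have hi3 : IntervalIntegrable (fun r => T.opReal (s - r) (g r)) volume 0 s :=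
    (intervalIntegrable_iff_integrableOn_Ioc_of_le hs).2
      (T.integrableOn_opReal_sub (hg.mono_set (Ioc_subset_Ioc_right (by linarith))) _)
  simp only [conv]
  rw [← intervalIntegral.integral_add_adjacent_intervals hi1 hi2]
  congr 1
  · rw [← ContinuousLinearMap.intervalIntegral_comp_comm _ hi3]
    refine intervalIntegral.integral_congr fun r hr => ?_
    rw [uIcc_of_le hs] at hr
    rw [← opReal_add_apply _ ht (sub_nonneg.2 hr.2), add_sub_assoc]
  · have := intervalIntegral.integral_comp_add_right (a := 0) (b := t)
      (fun r => T.opReal (t + s - r) (g r)) s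
    rw [zero_add] at this
    rw [← this]
    refine intervalIntegral.integral_congr fun r _ => ?_
    congr 2
    ring

/-- Averages `h⁻¹ ∫₀ʰ T(h-s) g(s) ds` converge to the right limit of `g` at `0`. -/
theorem tendsto_inv_smul_conv [CompleteSpace X] (T : C0Semigroup X) {g : ℝ → X} {y : X}
    (hg : Tendsto g (𝓝[>] 0) (𝓝 y)) (hgi : ∀ᶠ h in 𝓝[>] (0 : ℝ), IntegrableOn g (Ioc 0 h)) :
    Tendsto (fun h : ℝ => h⁻¹ • T.conv g h) (𝓝[>] 0) (𝓝 y) := by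
  rw [Metric.tendsto_nhds]
  intro ε hε
  have h0 : Tendsto (fun q : ℝ × ℝ => T.opReal q.1 (g q.2)) (𝓝 0 ×ˢ 𝓝[>] 0) (𝓝 y) := by
    have h1 : Tendsto (fun q : ℝ × ℝ => (q.1, g q.2)) (𝓝 0 ×ˢ 𝓝[>] 0) (𝓝 (0, y)) := by
      rw [nhds_prod_eq]
      exact tendsto_fst.prodMk (hg.comp tendsto_snd)
    have h2 := (T.continuous_opReal_uncurry.tendsto (0, y)).comp h1
    rw [opReal_zero_apply] at h2
    exact h2
  have h1 := (Metric.tendsto_nhds.1 h0) (ε / 2) (half_pos hε)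
  obtain ⟨p, hp, q, hq, hpq⟩ := eventually_prod_iff.1 h1
  obtain ⟨δ₁, hδ₁, hp'⟩ := Metric.eventually_nhds_iff.1 hp
  obtain ⟨δ₂, hδ₂, hq'⟩ := (nhdsGT_basis (0 : ℝ)).eventually_iff.1 hq
  have hmem : Ioo (0 : ℝ) (min δ₁ δ₂) ∈ 𝓝[>] (0 : ℝ) := Ioo_mem_nhdsGT (lt_min hδ₁ hδ₂)
  filter_upwards [hmem, hgi] with h hh hgh
  have hh1 : h < δ₁ := hh.2.trans_le (min_le_left _ _)
  have hh2 : h < δ₂ := hh.2.trans_le (min_le_right _ _)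
  have hh0 : 0 < h := hh.1
  have hpt (s : ℝ) (hs : s ∈ Ioc 0 h) : ‖T.opReal (h - s) (g s) - y‖ ≤ ε / 2 := by
    have := hpq (hp' (y := h - s) (by
      rw [Real.dist_eq, sub_zero, abs_of_nonneg (by linarith [hs.2])]; linarith [hs.1]))
      (hq' (x := s) ⟨hs.1, by linarith [hs.2]⟩)
    rw [dist_eq_norm] at this
    exact this.le
  have hint : IntervalIntegrable (fun s => T.opReal (h - s) (g s)) volume 0 h :=
    (intervalIntegrable_iff_integrableOn_Ioc_of_le hh0.le).2 (T.integrableOn_opReal_sub hgh h)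
  have h3 : h⁻¹ • T.conv g h - y = h⁻¹ • ∫ s in (0 : ℝ)..h, (T.opReal (h - s) (g s) - y) := by
    rw [intervalIntegral.integral_sub hint intervalIntegrable_const,
      intervalIntegral.integral_const, sub_zero, smul_sub, inv_smul_smul₀ hh0.ne']
    rfl
  rw [dist_eq_norm, h3, norm_smul, norm_inv, Real.norm_eq_abs, abs_of_pos hh0]
  have h4 : ‖∫ s in (0 : ℝ)..h, (T.opReal (h - s) (g s) - y)‖ ≤ ε / 2 * |h - 0| :=
    intervalIntegral.norm_integral_le_of_norm_le_const fun s hs => by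
      rw [uIoc_of_le hh0.le] at hs; exact hpt s hs
  rw [sub_zero, abs_of_pos hh0] at h4
  calc h⁻¹ * ‖_‖ ≤ h⁻¹ * (ε / 2 * h) := by gcongr
    _ = ε / 2 := by field_simp
    _ < ε := half_lt_self hε

theorem tendsto_nhdsGT_iff {α : Type*} {l : Filter α} {f : ℝ≥0 → α} :
    Tendsto f (𝓝[>] 0) l ↔ Tendsto (fun h : ℝ => f h.toNNReal) (𝓝[>] 0) l := by
  constructor
  · intro h
    refine h.comp (tendsto_nhdsWithin_iff.2 ⟨?_, ?_⟩)
    · have := continuous_real_toNNReal.tendsto 0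
      rw [Real.toNNReal_zero] at this
      exact this.mono_left nhdsWithin_le_nhds
    · filter_upwards [self_mem_nhdsWithin] with h hh using Real.toNNReal_pos.2 hh
  · intro h
    have h1 : Tendsto ((↑) : ℝ≥0 → ℝ) (𝓝[>] 0) (𝓝[>] 0) := by
      refine tendsto_nhdsWithin_iff.2 ⟨?_, ?_⟩
      · exact (NNReal.continuous_coe.tendsto 0).mono_left nhdsWithin_le_nhds
      · filter_upwards [self_mem_nhdsWithin] with h hh using NNReal.coe_pos.2 hh
    refine (h.comp h1).congr fun t => ?_
    simp

theorem IsGeneratedBy.mem_graph_iff {T : C0Semigroup X} {A : X →ₗ.[ℂ] X}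
    (hT : T.IsGeneratedBy A) {x y : X} : (x, y) ∈ A.graph ↔
      Tendsto (fun h : ℝ => h⁻¹ • (T.opReal h x - x)) (𝓝[>] 0) (𝓝 y) := by
  rw [hT x y, tendsto_nhdsGT_iff]
  refine tendsto_congr' ?_
  filter_upwards [self_mem_nhdsWithin] with h hh
  rw [Real.coe_toNNReal _ (le_of_lt hh), ← Complex.ofReal_inv, Complex.coe_smul]
  rfl

theorem isGeneratedBy_iff {T : C0Semigroup X} {A : X →ₗ.[ℂ] X} :
    T.IsGeneratedBy A ↔ ∀ x y : X, (x, y) ∈ A.graph ↔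
      Tendsto (fun h : ℝ => h⁻¹ • (T.opReal h x - x)) (𝓝[>] 0) (𝓝 y) := by
  refine ⟨fun h x y => h.mem_graph_iff, fun h x y => ?_⟩
  rw [h x y, tendsto_nhdsGT_iff]
  refine tendsto_congr' ?_
  filter_upwards [self_mem_nhdsWithin] with h hh
  rw [Real.coe_toNNReal _ (le_of_lt hh), ← Complex.ofReal_inv, Complex.coe_smul]
  rfl

theorem IsGeneratedBy.opReal_mem_graph {T : C0Semigroup X} {A : X →ₗ.[ℂ] X}
    (hT : T.IsGeneratedBy A) {x y : X} (h : (x, y) ∈ A.graph) {t : ℝ} (ht : 0 ≤ t) :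
    (T.opReal t x, T.opReal t y) ∈ A.graph := by
  rw [hT.mem_graph_iff] at h ⊢
  refine (((T.opReal t).continuous.tendsto y).comp h).congr' ?_
  filter_upwards [self_mem_nhdsWithin] with s hs
  simp only [Function.comp_apply]
  rw [(T.opReal t).map_smul_of_tower, map_sub, ← opReal_add_apply _ ht (le_of_lt hs),
    ← opReal_add_apply _ (le_of_lt hs) ht, add_comm]

/-- The domain of a generator is dense. -/
theorem IsGeneratedBy.dense_domain [CompleteSpace X] {T : C0Semigroup X} {A : X →ₗ.[ℂ] X}
    (hT : T.IsGeneratedBy A) : Dense (A.domain : Set X) := by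
  intro x
  have hc := T.continuous_opReal x
  have hint (a b : ℝ) : IntervalIntegrable (fun s => T.opReal s x) volume a b :=
    hc.intervalIntegrable a b
  have hF (a : ℝ) : HasDerivAt (fun t => ∫ s in (0 : ℝ)..t, T.opReal s x) (T.opReal a x) a :=
    intervalIntegral.integral_hasDerivAt_right (hint _ _)
      (hc.stronglyMeasurableAtFilter _ _) hc.continuousAt
  have hslope (a : ℝ) : Tendsto (fun h : ℝ => h⁻¹ • ((∫ s in (0 : ℝ)..(a + h), T.opReal s x) -
      ∫ s in (0 : ℝ)..a, T.opReal s x)) (𝓝[>] 0) (𝓝 (T.opReal a x)) :=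
    (hasDerivAt_iff_tendsto_slope_zero.1 (hF a)).mono_left
      (nhdsWithin_mono _ fun h (hh : (0 : ℝ) < h) => hh.ne')
  have hmem : ∀ t > (0 : ℝ), (∫ s in (0 : ℝ)..t, T.opReal s x) ∈ A.domain := by
    intro t ht
    refine LinearPMap.mem_domain_of_mem_graph (y := T.opReal t x - T.opReal 0 x) ?_
    rw [hT.mem_graph_iff]
    refine ((hslope t).sub (hslope 0)).congr' ?_
    filter_upwards [self_mem_nhdsWithin] with h hh
    rw [← smul_sub]
    congr 1
    rw [← ContinuousLinearMap.intervalIntegral_comp_comm _ (hint _ _)]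
    have h1 : ∫ s in (0 : ℝ)..t, T.opReal h (T.opReal s x) = ∫ s in h..(t + h), T.opReal s x := by
      have := intervalIntegral.integral_comp_add_right (a := 0) (b := t)
        (fun r => T.opReal r x) h
      rw [zero_add] at this
      rw [← this]
      refine intervalIntegral.integral_congr fun s hs => ?_
      rw [uIcc_of_le ht.le] at hs
      rw [← opReal_add_apply _ (le_of_lt hh) hs.1, add_comm]
    rw [h1, ← intervalIntegral.integral_interval_sub_left (hint 0 (t + h)) (hint 0 h)]
    simp only [intervalIntegral.integral_same, sub_zero, zero_add]
    abel
  have h0 := hslope 0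
  rw [opReal_zero_apply] at h0
  refine mem_closure_of_tendsto h0 ?_
  filter_upwards [self_mem_nhdsWithin] with h hh
  simp only [zero_add, intervalIntegral.integral_same, sub_zero]
  rw [← Complex.coe_smul]
  exact A.domain.smul_mem _ (hmem h hh)

theorem mem_graph_boundedPerturbation {B : X →ₗ.[ℂ] X} {C : X →L[ℂ] X} {x y : X} :
    (x, y) ∈ (boundedPerturbation B C).graph ↔ (x, y - C x) ∈ B.graph := by
  rw [LinearPMap.mem_graph_iff, LinearPMap.mem_graph_iff]
  constructor
  · rintro ⟨z, hz, hy⟩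
    refine ⟨z, hz, ?_⟩
    simp only at hz hy ⊢
    rw [← hy, ← hz]
    exact (add_sub_cancel_right (B z) (C z)).symm
  · rintro ⟨z, hz, hy⟩
    refine ⟨z, hz, ?_⟩
    simp only at hz hy ⊢
    rw [← hz, eq_sub_iff_add_eq] at hy
    exact hy

/-- The variation of constants formula for a bounded perturbation of a generator. -/
theorem opReal_eq_add_conv [CompleteSpace X] {S U : C0Semigroup X} {B : X →ₗ.[ℂ] X}
    {C : X →L[ℂ] X} (hS : S.IsGeneratedBy B) (hU : U.IsGeneratedBy (boundedPerturbation B C))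
    {t : ℝ} (ht : 0 ≤ t) (x : X) :
    U.opReal t x = S.opReal t x + S.conv (fun s => C (U.opReal s x)) t := by
  have hcont (y : X) : Continuous fun s => S.opReal (t - s) (C (U.opReal s y)) :=
    S.continuous_opReal_uncurry.comp
      ((by fun_prop : Continuous fun s : ℝ => t - s).prodMk
        (C.continuous.comp (U.continuous_opReal y)))
  have hdom : ∀ y ∈ (boundedPerturbation B C).domain,
      U.opReal t y = S.opReal t y + S.conv (fun s => C (U.opReal s y)) t := by
    intro y hy
    obtain ⟨w, hw⟩ := LinearPMap.mem_domain_iff.1 hy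
    -- For `y` in the domain, `s ↦ S(t-s) U(s) y` has right derivative `S(t-s) C U(s) y`. Generators
    -- provide right derivatives only, and these suffice because the function is continuous.
    have h := intervalIntegral.integral_eq_sub_of_hasDeriv_right
      (f := fun s => S.opReal (t - s) (U.opReal s y))
      (f' := fun s => S.opReal (t - s) (C (U.opReal s y))) (a := 0) (b := t)
      (S.continuous_opReal_uncurry.comp
        ((by fun_prop : Continuous fun s : ℝ => t - s).prodMk
          (U.continuous_opReal y))).continuousOn ?_ ((hcont y).intervalIntegrable _ _)
    · simp only [sub_self, sub_zero, opReal_zero_apply] at h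
      rw [conv, h, add_sub_cancel]
    · intro s hs
      rw [min_eq_left ht, max_eq_right ht] at hs
      have hg := hU.opReal_mem_graph hw hs.1.le
      have hg1 := hU.mem_graph_iff.1 hg
      have hg2 := hS.mem_graph_iff.1 (mem_graph_boundedPerturbation.1 hg)
      set u := U.opReal s y with hu
      have h3 := hg1.sub hg2
      rw [sub_sub_cancel] at h3
      have hmul : Tendsto (fun r : ℝ => t - s - r) (𝓝[>] 0) (𝓝 (t - s)) := by
        have : Continuous fun r : ℝ => t - s - r := by fun_prop
        simpa using (this.tendsto 0).mono_left nhdsWithin_le_nhds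
      -- The increment over `[s, s + r]` is `S(t-s-r) (U(r) u - S(r) u)`. Divided by `r`, the
      -- argument tends to `C u`, and joint continuity absorbs the moving operator.
      have h4 := (S.continuous_opReal_uncurry.tendsto (t - s, C u)).comp (hmul.prodMk_nhds h3)
      have h5 : Tendsto (fun r : ℝ => r⁻¹ • (S.opReal (t - (s + r)) (U.opReal (s + r) y) -
          S.opReal (t - s) u)) (𝓝[>] 0) (𝓝 (S.opReal (t - s) (C u))) := by
        refine h4.congr' ?_
        filter_upwards [Ioo_mem_nhdsGT (sub_pos.2 hs.2)] with r hr
        simp only [Function.comp_apply]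
        rw [← smul_sub, (S.opReal _).map_smul_of_tower, sub_sub_sub_cancel_right, map_sub,
          ← opReal_add_apply _ (by linarith [hr.2]) hr.1.le, sub_add_cancel, hu,
          ← opReal_add_apply _ hr.1.le hs.1.le, sub_sub, add_comm r s]
      rw [hasDerivWithinAt_iff_tendsto_slope]
      have h6 : Tendsto (fun z : ℝ => z - s) (𝓝[>] s) (𝓝[>] 0) := by
        refine tendsto_nhdsWithin_iff.2 ⟨?_, ?_⟩
        · have : Continuous fun z : ℝ => z - s := by fun_prop
          simpa using (this.tendsto s).mono_left nhdsWithin_le_nhds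
        · filter_upwards [self_mem_nhdsWithin] with z hz using sub_pos.2 (mem_Ioi.1 hz)
      have h7 : Ioi s \ {s} = Ioi s := by simp
      rw [h7]
      refine (h5.comp h6).congr fun z => ?_
      simp only [Function.comp_apply, slope, vsub_eq_sub, add_sub_cancel, hu]
  have hcl : IsClosed {y : X | U.opReal t y = S.opReal t y +
      S.conv (fun s => C (U.opReal s y)) t} := by
    refine isClosed_eq (U.opReal t).continuous ((S.opReal t).continuous.add ?_)
    refine intervalIntegral.continuous_parametric_intervalIntegral_of_continuous'
      (f := fun y s => S.opReal (t - s) (C (U.opReal s y))) ?_ 0 t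
    exact S.continuous_opReal_uncurry.comp
      ((by fun_prop : Continuous fun q : X × ℝ => t - q.2).prodMk
        (C.continuous.comp (U.continuous_opReal_uncurry.comp continuous_swap)))
  exact hcl.closure_subset_iff.2 (fun y hy => hdom y hy) (hU.dense_domain x)

end C0Semigroup

/-! ### Integral inequalities and the history space -/

/-- Grönwall's inequality in integral form. -/
theorem le_mul_exp_of_le_add_integral {φ : ℝ → ℝ} {a b c K : ℝ} (hφ : ContinuousOn φ (Icc a b))
    (hφ0 : ∀ t ∈ Icc a b, 0 ≤ φ t) (hc : 0 ≤ c) (hK : 0 ≤ K)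
    (h : ∀ t ∈ Icc a b, φ t ≤ c + K * ∫ s in a..t, φ s) :
    ∀ t ∈ Icc a b, φ t ≤ c * Real.exp (K * (t - a)) := by
  intro t ht
  have hab : a ≤ b := ht.1.trans ht.2
  have hint : IntervalIntegrable φ volume a b := by
    rw [← uIcc_of_le hab] at hφ; exact hφ.intervalIntegrable
  have hcont : ContinuousOn (fun t => c + K * ∫ s in a..t, φ s) (Icc a b) := by
    have := intervalIntegral.continuousOn_primitive_interval' hint left_mem_uIcc
    rw [uIcc_of_le hab] at this
    exact continuousOn_const.add (continuousOn_const.mul this)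
  have hpos : ∀ t ∈ Icc a b, 0 ≤ c + K * ∫ s in a..t, φ s := fun t ht =>
    add_nonneg hc (mul_nonneg hK (intervalIntegral.integral_nonneg ht.1
      fun u hu => hφ0 u ⟨hu.1, hu.2.trans ht.2⟩))
  have hderiv : ∀ x ∈ Ico a b, HasDerivWithinAt (fun t => c + K * ∫ s in a..t, φ s)
      (K * φ x) (Ici x) x := by
    intro x hx
    refine (HasDerivWithinAt.const_mul K ?_).const_add c
    have hx' : x ∈ Icc a b := ⟨hx.1, hx.2.le⟩
    have hnhds : Icc a b ∈ 𝓝[>] x := Filter.mem_of_superset (Ioo_mem_nhdsGT hx.2)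
      fun y hy => ⟨hx.1.trans hy.1.le, hy.2.le⟩
    refine intervalIntegral.integral_hasDerivWithinAt_right (t := Ioi x) ?_ ?_ ?_
    · exact hint.mono_set (by rw [uIcc_of_le hx.1, uIcc_of_le hab]; exact Icc_subset_Icc_right hx.2.le)
    · exact ⟨Icc a b, hnhds, hφ.aestronglyMeasurable measurableSet_Icc⟩
    · exact ((hφ x hx').mono_of_mem_nhdsWithin hnhds)
  -- The differential form of Grönwall is applied to the majorant `c + K ∫ φ`, which is right
  -- differentiable although `φ` is merely continuous.
  have := norm_le_gronwallBound_of_norm_deriv_right_le (δ := c) (K := K) (ε := 0) hcont hderiv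
    (by simp [abs_of_nonneg hc]) (fun x hx => ?_) t ht
  · rw [gronwallBound_ε0, Real.norm_of_nonneg (hpos t ht)] at this
    exact (h t ht).trans this
  · have hx' : x ∈ Icc a b := ⟨hx.1, hx.2.le⟩
    rw [add_zero, Real.norm_of_nonneg (mul_nonneg hK (hφ0 x hx')), Real.norm_of_nonneg (hpos x hx')]
    exact mul_le_mul_of_nonneg_left (h x hx') hK

/-- Since `[-1,0]` has length one, the `L^1` norm is at most the `L^p` norm, which is at most the
essential supremum, with no constants. -/
instance : IsProbabilityMeasure historyMeasure := ⟨by simp⟩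

section History

set_option linter.unusedSectionVars false

variable {X : Type*} [NormedAddCommGroup X] {p : ℝ≥0∞} [Fact (1 ≤ p)]

theorem norm_historySpace_le_of_bound {f : HistorySpace X p} {N : ℝ} (hN : 0 ≤ N)
    (h : ∀ᵐ σ ∂historyMeasure, ‖f σ‖ ≤ N) : ‖f‖ ≤ N := by
  have := Lp.norm_le_of_ae_bound hN h
  simpa [measureUnivNNReal] using this

theorem integrable_historySpace (f : HistorySpace X p) : Integrable f historyMeasure :=
  (Lp.memLp f).integrable Fact.out

theorem integral_norm_historySpace_le (f : HistorySpace X p) :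
    ∫ s, ‖f s‖ ∂historyMeasure ≤ ‖f‖ := by
  rw [integral_norm_eq_lintegral_enorm (Lp.aestronglyMeasurable f), ← eLpNorm_one_eq_lintegral_enorm,
    Lp.norm_def]
  exact ENNReal.toReal_mono (Lp.eLpNorm_ne_top f)
    (eLpNorm_le_eLpNorm_of_exponent_le Fact.out (Lp.aestronglyMeasurable f))

open Classical in
/-- The history segment `σ ↦ v(σ + t)`, `σ ∈ [-1,0]`, as an element of `L^p`. -/
def historySegment (p : ℝ≥0∞) (v : ℝ → X) (t : ℝ) : HistorySpace X p :=
  if h : MemLp (fun σ => v (σ + t)) p historyMeasure then h.toLp else 0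

theorem coeFn_historySegment {v : ℝ → X} {t : ℝ} (h : MemLp (fun σ => v (σ + t)) p historyMeasure) :
    historySegment p v t =ᵐ[historyMeasure] fun σ => v (σ + t) := by
  rw [historySegment, dif_pos h]; exact h.coeFn_toLp

theorem eq_historySegment {f : HistorySpace X p} {v : ℝ → X} {t : ℝ}
    (h : f =ᵐ[historyMeasure] fun σ => v (σ + t)) : f = historySegment p v t := by
  have hm : MemLp (fun σ => v (σ + t)) p historyMeasure := (memLp_congr_ae h).1 (Lp.memLp f)
  exact Lp.ext (h.trans (coeFn_historySegment hm).symm)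

theorem historySegment_comp_add (v : ℝ → X) (s t : ℝ) :
    historySegment p (fun r => v (r + t)) s = historySegment p v (s + t) := by
  have : (fun σ => v (σ + s + t)) = fun σ => v (σ + (s + t)) := by simp only [add_assoc]
  simp only [historySegment]
  congr!

theorem memLp_comp_add {v : ℝ → X} {t : ℝ} (h : MemLp v p (volume.restrict (Icc (t - 1) t))) :
    MemLp (fun σ => v (σ + t)) p historyMeasure := by
  have hmp := (measurePreserving_add_right volume t).restrict_preimage
    (measurableSet_Icc (a := t - 1) (b := t))
  rw [Set.preimage_add_const_Icc, sub_self, show t - 1 - t = -1 by ring] at hmp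
  exact h.comp_measurePreserving hmp

theorem ae_comp_add {P : ℝ → Prop} {t : ℝ} (ht : 0 ≤ t)
    (h : ∀ᵐ s ∂volume.restrict (Ici (-1)), P s) : ∀ᵐ σ ∂historyMeasure, P (σ + t) := by
  rw [ae_restrict_iff' measurableSet_Ici] at h
  rw [ae_restrict_iff' measurableSet_Icc]
  filter_upwards [(measurePreserving_add_right volume t).quasiMeasurePreserving.ae h] with σ hσ hI
  exact hσ (by simp only [mem_Ici]; linarith [hI.1])

theorem historySegment_congr {v w : ℝ → X} {t : ℝ} (ht : 0 ≤ t)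
    (hv : MemLp (fun σ => v (σ + t)) p historyMeasure)
    (h : v =ᵐ[volume.restrict (Ici (-1))] w) : historySegment p v t = historySegment p w t :=
  eq_historySegment ((coeFn_historySegment hv).trans (ae_comp_add ht h))

/-- Translation on `L^p(ℝ, X)`. -/
def translateLp (t : ℝ) (f : Lp X p (volume : Measure ℝ)) : Lp X p (volume : Measure ℝ) :=
  Lp.compMeasurePreserving (· + t) (measurePreserving_add_right volume t) f

theorem coeFn_translateLp (t : ℝ) (f : Lp X p (volume : Measure ℝ)) :
    translateLp t f =ᵐ[volume] fun s => f (s + t) :=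
  Lp.coeFn_compMeasurePreserving _ _

theorem continuous_translateLp (hp : p ≠ ∞) (f : Lp X p (volume : Measure ℝ)) :
    Continuous fun t => translateLp t f := by
  have hg : Continuous fun t : ℝ => (⟨fun s => s + t, by fun_prop⟩ : C(ℝ, ℝ)) :=
    (ContinuousMap.mk (fun a : ℝ × ℝ => a.2 + a.1) (by fun_prop)).curry.continuous
  exact Continuous.compMeasurePreservingLp (continuous_const (y := f)) hg
    (fun t => measurePreserving_add_right volume t) hp

/-- History segments of a function that is locally `L^p` depend continuously on time. -/
theorem continuousOn_historySegment [NormedSpace ℂ X] (hp : p ≠ ∞) {v : ℝ → X} {b : ℝ}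
    (h : MemLp v p (volume.restrict (Icc (-1) b))) :
    ContinuousOn (historySegment p v) (Icc 0 b) := by
  -- Extended by zero to the line, `v` has continuous translates in `L^p(ℝ)` because `p < ∞`;
  -- history segments are restrictions of these translates.
  have hV : MemLp (indicator (Icc (-1) b) v) p volume :=
    (memLp_indicator_iff_restrict measurableSet_Icc).2 h
  have h1 : Continuous fun t => LpToLpRestrictCLM ℝ X ℂ volume p (Icc (-1) 0)
      (translateLp t hV.toLp) :=
    (ContinuousLinearMap.continuous _).comp (continuous_translateLp hp _)
  refine h1.continuousOn.congr fun t ht => (eq_historySegment ?_).symm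
  refine (LpToLpRestrictCLM_coeFn ℂ _ _).trans ?_
  have h2 : ∀ᵐ s, translateLp t (hV.toLp) s = indicator (Icc (-1) b) v (s + t) :=
    (coeFn_translateLp t _).trans
      ((measurePreserving_add_right volume t).quasiMeasurePreserving.ae hV.coeFn_toLp)
  refine (ae_restrict_iff' measurableSet_Icc).2 (h2.mono fun s hs hI => ?_)
  rw [hs, indicator_of_mem]
  exact ⟨by linarith [hI.1, ht.1], by linarith [hI.2, ht.2]⟩

end History

/-! ### Mild solutions of the delay equation -/

section Delay

set_option linter.unusedSectionVars false

variable {X : Type*} [NormedAddCommGroup X] [NormedSpace ℂ X]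
  {p : ℝ≥0∞} [Fact (1 ≤ p)] {S : C0Semigroup X} {C : X →L[ℂ] X} {τ : ℝ}

/-- `v` is the mild solution of `u'(t) = B u(t) + C u(t - τ)` with initial datum `z`, where `B`
generates `S`. -/
structure IsDelaySolution (S : C0Semigroup X) (C : X →L[ℂ] X) (τ : ℝ) (z : X × HistorySpace X p)
    (v : ℝ → X) : Prop where
  history : z.2 =ᵐ[historyMeasure] v
  mild : ∀ t, 0 ≤ t → v t = S.opReal t z.1 + S.conv (fun s => C (v (s - τ))) t

variable (S C τ) in
/-- One step of the method of steps: extend the history `g` by one delay interval. -/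
def delayStep (x : X) (g v : ℝ → X) (t : ℝ) : X :=
  if t < 0 then g t else S.opReal t x + S.conv (fun s => C (v (s - τ))) t

theorem delayStep_congr {x : X} {g v w : ℝ → X} {t : ℝ} (h : ∀ s ≤ t, v (s - τ) = w (s - τ)) :
    delayStep S C τ x g v t = delayStep S C τ x g w t := by
  unfold delayStep
  split_ifs with ht
  · rfl
  · congr 1
    refine intervalIntegral.integral_congr fun s hs => ?_
    rw [uIcc_of_le (not_lt.1 ht)] at hs
    simp only [h s hs.2]

/-- The new value at `t` uses the old function only up to time `t - τ`, so each iteration settles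
one further delay interval. -/
theorem iterate_delayStep_succ (x : X) (g : ℝ → X) (n : ℕ) :
    ∀ t < n * τ, (delayStep S C τ x g)^[n + 1] g t = (delayStep S C τ x g)^[n] g t := by
  induction n with
  | zero =>
    intro t ht
    rw [Nat.cast_zero, zero_mul] at ht
    simp [delayStep, ht]
  | succ n ih =>
    intro t ht
    rw [Function.iterate_succ_apply', Function.iterate_succ_apply' _ n]
    refine delayStep_congr fun s hs => ?_
    rw [← Function.iterate_succ_apply' (delayStep S C τ x g)]
    refine ih _ ?_
    push_cast at ht
    linarith

theorem iterate_delayStep_of_le (hτ : 0 < τ) (x : X) (g : ℝ → X) {n m : ℕ} (hnm : n ≤ m) {t : ℝ}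
    (ht : t < n * τ) : (delayStep S C τ x g)^[m] g t = (delayStep S C τ x g)^[n] g t := by
  induction m, hnm using Nat.le_induction with
  | base => rfl
  | succ m hm ih =>
    rw [iterate_delayStep_succ x g m t, ih]
    exact ht.trans_le (by gcongr)

/-- At each `t` the iterates are eventually constant, so their pointwise limit is a fixed point. No
integrability is needed at this stage. -/
theorem exists_delayStep_fixed (hτ : 0 < τ) (x : X) (g : ℝ → X) :
    ∃ v : ℝ → X, delayStep S C τ x g v = v := by
  set w : ℕ → ℝ → X := fun n => (delayStep S C τ x g)^[n] g with hw
  set v : ℝ → X := fun t => w (⌊t / τ⌋₊ + 1) t with hv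
  have hlt (t : ℝ) : t < (⌊t / τ⌋₊ + 1 : ℕ) * τ := by
    rw [← div_lt_iff₀ hτ]; exact_mod_cast Nat.lt_floor_add_one (t / τ)
  have hvw (n : ℕ) (t : ℝ) (ht : t < n * τ) : v t = w n t := by
    rcases le_total n (⌊t / τ⌋₊ + 1) with h | h
    · exact iterate_delayStep_of_le hτ x g h ht
    · exact (iterate_delayStep_of_le hτ x g h (hlt t)).symm
  refine ⟨v, funext fun t => ?_⟩
  obtain ⟨n, hn⟩ : ∃ n : ℕ, t < n * τ := ⟨_, hlt t⟩
  rw [hvw (n + 1) t (by push_cast; linarith)]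
  simp only [hw, Function.iterate_succ_apply']
  exact delayStep_congr fun s hs => hvw n _ (by linarith)

theorem exists_isDelaySolution (hτ : 0 < τ) (z : X × HistorySpace X p) :
    ∃ v, IsDelaySolution S C τ z v := by
  obtain ⟨v, hv⟩ := exists_delayStep_fixed (S := S) (C := C) hτ z.1 z.2
  refine ⟨v, ?_, fun t ht => ?_⟩
  -- At `0` the mild formula overrides the history; this is a null set.
  · have h0 : ∀ᵐ s : ℝ, s ≠ 0 := by simp [ae_iff, measure_singleton]
    refine (ae_restrict_iff' measurableSet_Icc).2 (h0.mono fun s hs hI => ?_)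
    rw [← hv, delayStep, if_pos (lt_of_le_of_ne hI.2 hs)]
  · conv_lhs => rw [← hv]
    rw [delayStep, if_neg (not_lt.2 ht)]

theorem integrableOn_comp_sub {v : ℝ → X} {a b c : ℝ} (h : IntegrableOn v (Ioc (a - c) (b - c))) :
    IntegrableOn (fun s => v (s - c)) (Ioc a b) := by
  have hmp := (measurePreserving_sub_right volume c).restrict_preimage
    (measurableSet_Ioc (a := a - c) (b := b - c))
  rw [Set.preimage_sub_const_Ioc, sub_add_cancel, sub_add_cancel] at hmp
  exact hmp.integrable_comp_of_integrable h

namespace IsDelaySolution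

variable {z z' : X × HistorySpace X p} {v v' : ℝ → X}

theorem zero_eq (h : IsDelaySolution S C τ z v) : v 0 = z.1 := by
  rw [h.mild 0 le_rfl, C0Semigroup.opReal_zero_apply, C0Semigroup.conv,
    intervalIntegral.integral_same, add_zero]

theorem integrableOn_history (h : IsDelaySolution S C τ z v) : IntegrableOn v (Ioc (-1) 0) :=
  IntegrableOn.mono_set ((integrable_historySpace z.2).congr h.history) Ioc_subset_Icc_self

theorem integral_norm_history_le (h : IsDelaySolution S C τ z v) :
    ∫ s in (-1 : ℝ)..0, ‖v s‖ ≤ ‖z.2‖ := by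
  rw [intervalIntegral.integral_of_le (by norm_num), ← integral_Icc_eq_integral_Ioc]
  refine le_trans (le_of_eq ?_) (integral_norm_historySpace_le z.2)
  exact integral_congr_ae (h.history.mono fun s hs => by simp only [hs])

variable [CompleteSpace X]

/-- Regularity propagates one delay interval at a time: the forcing on `(0, (n+1) τ]` only sees `v`
up to `n τ`. -/
theorem continuousOn_and_integrableOn (hτ1 : τ ≤ 1)
    (h : IsDelaySolution S C τ z v) (n : ℕ) :
    ContinuousOn v (Icc 0 (n * τ)) ∧ IntegrableOn v (Ioc (-1) (n * τ)) := by
  induction n with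
  | zero => simpa using h.integrableOn_history
  | succ n ih =>
    by_cases hneg : ((n + 1 : ℕ) : ℝ) * τ < 0
    · have hτ : τ < 0 := by
        by_contra! hh
        exact absurd hneg (not_lt.2 (mul_nonneg (by positivity) hh))
      have hn : ((n : ℝ) + 1) * τ ≤ 0 := by push_cast at hneg; exact hneg.le
      push_cast at hneg ⊢
      exact ⟨by rw [Icc_eq_empty (not_le.2 hneg)]; exact continuousOn_empty _,
        h.integrableOn_history.mono_set (Ioc_subset_Ioc_right hn)⟩
    have hpos := not_lt.1 hneg
    have hg : IntegrableOn (fun s => C (v (s - τ))) (Ioc 0 ((n + 1 : ℕ) * τ)) := by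
      refine C.integrable_comp (integrableOn_comp_sub (ih.2.mono_set ?_))
      push_cast
      exact Ioc_subset_Ioc (by linarith) (by linarith)
    have hc : ContinuousOn v (Icc 0 ((n + 1 : ℕ) * τ)) :=
      (((S.continuous_opReal z.1).continuousOn).add (S.continuousOn_conv hpos hg)).congr
        fun t ht => h.mild t ht.1
    refine ⟨hc, (h.integrableOn_history.union (hc.integrableOn_compact isCompact_Icc)).mono_set ?_⟩
    intro s hs
    rcases le_or_gt s 0 with h0 | h0
    · exact Or.inl ⟨hs.1, h0⟩
    · exact Or.inr ⟨h0.le, hs.2⟩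

theorem continuousOn (hτ0 : 0 < τ) (hτ1 : τ ≤ 1) (h : IsDelaySolution S C τ z v) (b : ℝ) :
    ContinuousOn v (Icc 0 b) := by
  obtain ⟨n, hn⟩ := exists_nat_ge (b / τ)
  exact (h.continuousOn_and_integrableOn hτ1 n).1.mono
    (Icc_subset_Icc_right ((div_le_iff₀ hτ0).1 hn))

theorem integrableOn (hτ0 : 0 < τ) (hτ1 : τ ≤ 1) (h : IsDelaySolution S C τ z v) (b : ℝ) :
    IntegrableOn v (Ioc (-1) b) := by
  obtain ⟨n, hn⟩ := exists_nat_ge (b / τ)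
  exact (h.continuousOn_and_integrableOn hτ1 n).2.mono_set
    (Ioc_subset_Ioc_right ((div_le_iff₀ hτ0).1 hn))

theorem integrableOn_forcing (hτ0 : 0 < τ) (hτ1 : τ ≤ 1) (h : IsDelaySolution S C τ z v) (b : ℝ) :
    IntegrableOn (fun s => C (v (s - τ))) (Ioc 0 b) :=
  C.integrable_comp (integrableOn_comp_sub ((h.integrableOn hτ0 hτ1 (b - τ)).mono_set
    (Ioc_subset_Ioc_left (by linarith))))

theorem memLp (hτ0 : 0 < τ) (hτ1 : τ ≤ 1) (h : IsDelaySolution S C τ z v) (b : ℝ) :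
    MemLp v p (volume.restrict (Icc (-1) b)) := by
  have h1 : MemLp (indicator (Iio 0) v) p (volume.restrict (Icc (-1) b)) := by
    rw [memLp_indicator_iff_restrict measurableSet_Iio, Measure.restrict_restrict measurableSet_Iio]
    refine ((memLp_congr_ae h.history).1 (Lp.memLp z.2)).mono_measure
      (Measure.restrict_mono_set _ ?_)
    exact fun s hs => ⟨hs.2.1, le_of_lt hs.1⟩
  have h2 : MemLp (indicator (Ici 0) v) p (volume.restrict (Icc (-1) b)) := by
    rw [memLp_indicator_iff_restrict measurableSet_Ici, Measure.restrict_restrict measurableSet_Ici]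
    have hc := h.continuousOn hτ0 hτ1 b
    obtain ⟨N, hN⟩ := isCompact_Icc.exists_bound_of_continuousOn hc
    have h3 : MemLp v p (volume.restrict (Icc 0 b)) :=
      MemLp.of_bound (hc.aestronglyMeasurable measurableSet_Icc) N
        ((ae_restrict_mem measurableSet_Icc).mono hN)
    exact h3.mono_measure (Measure.restrict_mono_set _
      (show Ici 0 ∩ Icc (-1) b ⊆ Icc 0 b from fun s hs => ⟨hs.1, hs.2.2⟩))
  have h3 : indicator (Iio 0) v + indicator (Ici 0) v = v := by
    rw [← compl_Iio]; exact indicator_self_add_compl _ _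
  rw [← h3]
  exact h1.add h2

theorem memLp_comp_add (hτ0 : 0 < τ) (hτ1 : τ ≤ 1) (h : IsDelaySolution S C τ z v) {t : ℝ}
    (ht : 0 ≤ t) : MemLp (fun σ => v (σ + t)) p historyMeasure :=
  _root_.memLp_comp_add ((h.memLp hτ0 hτ1 t).mono_measure
    (Measure.restrict_mono_set _ (Icc_subset_Icc_left (by linarith))))

theorem add (hτ0 : 0 < τ) (hτ1 : τ ≤ 1) (h : IsDelaySolution S C τ z v)
    (h' : IsDelaySolution S C τ z' v') : IsDelaySolution S C τ (z + z') (v + v') where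
  history := (Lp.coeFn_add z.2 z'.2).trans (h.history.add h'.history)
  mild t ht := by
    have hi := S.integrableOn_opReal_sub (h.integrableOn_forcing hτ0 hτ1 t) t
    have hi' := S.integrableOn_opReal_sub (h'.integrableOn_forcing hτ0 hτ1 t) t
    rw [← intervalIntegrable_iff_integrableOn_Ioc_of_le ht] at hi hi'
    have hadd := intervalIntegral.integral_add hi hi'
    simp only [Pi.add_apply, h.mild t ht, h'.mild t ht, C0Semigroup.conv, map_add, hadd,
      Prod.fst_add]
    abel

theorem smul (c : ℂ) (h : IsDelaySolution S C τ z v) :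
    IsDelaySolution S C τ (c • z) (c • v) where
  history := (Lp.coeFn_smul c z.2).trans (h.history.const_smul c)
  mild t ht := by
    simp only [Pi.smul_apply, h.mild t ht, C0Semigroup.conv, map_smul,
      intervalIntegral.integral_smul, Prod.smul_fst, smul_add]

/-- Solutions are bounded on `[0,b]` by the initial datum, uniformly in the delay. -/
theorem _root_.exists_delaySolution_bound (p : ℝ≥0∞) [Fact (1 ≤ p)]
    (S : C0Semigroup X) (C : X →L[ℂ] X) (b : ℝ) :
    ∃ K : ℝ, 0 ≤ K ∧ ∀ τ : ℝ, 0 < τ → τ ≤ 1 → ∀ (z : X × HistorySpace X p) (v : ℝ → X),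
      IsDelaySolution S C τ z v → ∀ t ∈ Icc 0 b, ‖v t‖ ≤ K * ‖z‖ := by
  obtain ⟨M, hM1, hM⟩ := S.exists_bound_opReal b
  have hM0 : 0 ≤ M := zero_le_one.trans hM1
  refine ⟨M * (1 + ‖C‖) * Real.exp (M * ‖C‖ * (b - 0)), by positivity, ?_⟩
  intro τ hτ0 hτ1 z v h t ht
  have key := le_mul_exp_of_le_add_integral (φ := fun t => ‖v t‖) (a := 0) (b := b)
    (c := M * (1 + ‖C‖) * ‖z‖) (K := M * ‖C‖) (h.continuousOn hτ0 hτ1 b).norm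
    (fun t _ => norm_nonneg _) (by positivity) (by positivity) ?_ t ht
  · calc ‖v t‖ ≤ _ := key
      _ ≤ M * (1 + ‖C‖) * ‖z‖ * Real.exp (M * ‖C‖ * (b - 0)) := by
        gcongr
        exact ht.2
      _ = _ := by ring
  · intro t ht
    have hi (a c : ℝ) (ha : -1 ≤ a) (hac : a ≤ c) : IntervalIntegrable (fun s => ‖v s‖) volume a c :=
      ((intervalIntegrable_iff_integrableOn_Ioc_of_le hac).2
        ((h.integrableOn hτ0 hτ1 c).mono_set (Ioc_subset_Ioc_left ha))).norm
    -- The shifted window `[-τ, t - τ]` is enlarged to `[-1, t]`, which makes the estimate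
    -- independent of the delay.
    have h1 : ∫ s in (0 : ℝ)..t, ‖C (v (s - τ))‖ ≤ ‖C‖ * (‖z‖ + ∫ s in (0 : ℝ)..t, ‖v s‖) := by
      calc ∫ s in (0 : ℝ)..t, ‖C (v (s - τ))‖ ≤ ∫ s in (0 : ℝ)..t, ‖C‖ * ‖v (s - τ)‖ := by
            refine intervalIntegral.integral_mono_on ht.1 ?_ ?_ fun s _ => C.le_opNorm _
            · exact ((intervalIntegrable_iff_integrableOn_Ioc_of_le ht.1).2
                (h.integrableOn_forcing hτ0 hτ1 t)).norm
            · have := (hi (0 - τ) (t - τ) (by linarith) (by linarith [ht.1])).comp_sub_right τ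
              simpa using this.const_mul ‖C‖
        _ = ‖C‖ * ∫ s in (-τ)..(t - τ), ‖v s‖ := by
            rw [intervalIntegral.integral_const_mul,
              intervalIntegral.integral_comp_sub_right (fun s => ‖v s‖), zero_sub]
        _ ≤ ‖C‖ * ∫ s in (-1 : ℝ)..t, ‖v s‖ := by
            gcongr
            refine intervalIntegral.integral_mono_interval (by linarith) (by linarith [ht.1])
              (by linarith) ?_ (hi _ _ le_rfl (by linarith [ht.1]))
            exact Eventually.of_forall fun _ => norm_nonneg _
        _ = ‖C‖ * ((∫ s in (-1 : ℝ)..0, ‖v s‖) + ∫ s in (0 : ℝ)..t, ‖v s‖) := by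
            rw [intervalIntegral.integral_add_adjacent_intervals (hi _ _ le_rfl (by norm_num))
              (hi _ _ (by norm_num) ht.1)]
        _ ≤ _ := by
            gcongr
            exact h.integral_norm_history_le.trans (norm_snd_le z)
    calc ‖v t‖ ≤ ‖S.opReal t z.1‖ + ‖S.conv (fun s => C (v (s - τ))) t‖ := by
          rw [h.mild t ht.1]; exact norm_add_le _ _
      _ ≤ M * ‖z‖ + M * (‖C‖ * (‖z‖ + ∫ s in (0 : ℝ)..t, ‖v s‖)) := by
          refine add_le_add ?_ ?_
          · exact ((S.opReal t).le_opNorm _).trans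
              (mul_le_mul (hM t ht.2) (norm_fst_le z) (norm_nonneg _) hM0)
          · exact (S.norm_conv_le hM ht.1 ht.2 (h.integrableOn_forcing hτ0 hτ1 t)).trans
              (mul_le_mul_of_nonneg_left h1 hM0)
      _ = _ := by ring

/-- By linearity the difference is a solution with zero datum, which the a priori bound forces to
vanish. -/
theorem unique (hτ0 : 0 < τ) (hτ1 : τ ≤ 1) (h : IsDelaySolution S C τ z v)
    (h' : IsDelaySolution S C τ z v') {t : ℝ} (ht : 0 ≤ t) : v t = v' t := by
  obtain ⟨K, -, hK⟩ := exists_delaySolution_bound p S C t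
  have := hK τ hτ0 hτ1 _ _ (h.add hτ0 hτ1 (h'.smul (-1))) t ⟨ht, le_rfl⟩
  simpa [← sub_eq_add_neg, sub_eq_zero] using this

theorem ae_unique (hτ0 : 0 < τ) (hτ1 : τ ≤ 1) (h : IsDelaySolution S C τ z v)
    (h' : IsDelaySolution S C τ z v') : v =ᵐ[volume.restrict (Ici (-1))] v' := by
  have h1 := (ae_restrict_iff' measurableSet_Icc).1 (h.history.symm.trans h'.history)
  refine (ae_restrict_iff' measurableSet_Ici).2 (h1.mono fun s hs hI => ?_)
  rcases le_total s 0 with h0 | h0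
  · exact hs ⟨hI, h0⟩
  · exact h.unique hτ0 hτ1 h' h0

theorem historySegment_zero (h : IsDelaySolution S C τ z v) : historySegment p v 0 = z.2 :=
  (eq_historySegment (by simpa using h.history)).symm

/-- A solution restarted at time `t` is a solution. -/
theorem shift (hτ0 : 0 < τ) (hτ1 : τ ≤ 1) (h : IsDelaySolution S C τ z v) {t : ℝ} (ht : 0 ≤ t) :
    IsDelaySolution S C τ (v t, historySegment p v t) (fun s => v (s + t)) where
  history := coeFn_historySegment (h.memLp_comp_add hτ0 hτ1 ht)
  mild s hs := by
    rw [h.mild (s + t) (by linarith), S.opReal_add_apply hs ht,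
      S.conv_add ht hs (h.integrableOn_forcing hτ0 hτ1 _), ← add_assoc, ← map_add, ← h.mild t ht]
    simp only [sub_add_eq_add_sub]

/-- The window is split at absolute time `0`. The part still reading the initial history is a
translate, so its norm is at most that of `z.2`; the rest is bounded by `N` on a window of length
one. -/
theorem norm_historySegment_le (hτ0 : 0 < τ) (hτ1 : τ ≤ 1) (h : IsDelaySolution S C τ z v)
    {t N : ℝ} (ht : 0 ≤ t) (hN0 : 0 ≤ N) (hN : ∀ s ∈ Icc 0 t, ‖v s‖ ≤ N) :
    ‖historySegment p v t‖ ≤ ‖z.2‖ + N := by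
  have hm := h.memLp_comp_add hτ0 hτ1 ht
  set g : ℝ → X := indicator (Ico (-1) 0) v with hg
  set k : ℝ → X := indicator (Ici 0) v with hk
  have hgm : MemLp g p volume := by
    rw [hg, memLp_indicator_iff_restrict measurableSet_Ico]
    exact ((memLp_congr_ae h.history).1 (Lp.memLp z.2)).mono_measure
      (Measure.restrict_mono_set _ Ico_subset_Icc_self)
  have hgn : eLpNorm g p volume ≤ eLpNorm z.2 p historyMeasure := by
    rw [hg, eLpNorm_indicator_eq_eLpNorm_restrict measurableSet_Ico, eLpNorm_congr_ae h.history]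
    exact eLpNorm_mono_measure _ (Measure.restrict_mono_set _ Ico_subset_Icc_self)
  have hgtm : MemLp (fun σ => g (σ + t)) p volume :=
    hgm.comp_measurePreserving (measurePreserving_add_right volume t)
  have hgt : eLpNorm (fun σ => g (σ + t)) p historyMeasure ≤ eLpNorm z.2 p historyMeasure := by
    refine (eLpNorm_mono_measure _ Measure.restrict_le_self).trans (le_trans (le_of_eq ?_) hgn)
    have := eLpNorm_comp_measurePreserving (p := p) hgm.1 (measurePreserving_add_right volume t)
    rwa [Function.comp_def] at this
  have hsum : ∀ σ ∈ Icc (-1 : ℝ) 0, v (σ + t) = g (σ + t) + k (σ + t) := by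
    intro σ hσ
    rcases lt_or_ge (σ + t) 0 with h0 | h0
    · rw [hg, hk, indicator_of_mem (show σ + t ∈ Ico (-1) 0 from ⟨by linarith [hσ.1], h0⟩),
        indicator_of_notMem (show σ + t ∉ Ici 0 from not_le.2 h0), add_zero]
    · rw [hg, hk, indicator_of_notMem (fun h' => not_lt.2 h0 h'.2),
        indicator_of_mem (show σ + t ∈ Ici 0 from h0), zero_add]
  have hsum' : (fun σ => v (σ + t)) =ᵐ[historyMeasure]
      (fun σ => g (σ + t)) + fun σ => k (σ + t) :=
    (ae_restrict_mem measurableSet_Icc).mono hsum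
  have hkm : AEStronglyMeasurable (fun σ => k (σ + t)) historyMeasure := by
    have h1 : (fun σ => k (σ + t)) =ᵐ[historyMeasure]
        (fun σ => v (σ + t)) - fun σ => g (σ + t) :=
      (ae_restrict_mem measurableSet_Icc).mono fun σ hσ => by
        simp [hsum σ hσ]
    exact (hm.1.sub (hgtm.1.mono_measure Measure.restrict_le_self)).congr h1.symm
  have hkn : eLpNorm (fun σ => k (σ + t)) p historyMeasure ≤ ENNReal.ofReal N := by
    refine (eLpNorm_le_of_ae_bound (C := N) ?_).trans (by simp)
    refine (ae_restrict_mem measurableSet_Icc).mono fun σ hσ => ?_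
    rw [hk]
    by_cases h0 : 0 ≤ σ + t
    · rw [indicator_of_mem (show σ + t ∈ Ici 0 from h0)]
      exact hN _ ⟨h0, by linarith [hσ.2]⟩
    · rw [indicator_of_notMem (show σ + t ∉ Ici 0 from h0), norm_zero]
      exact hN0
  rw [Lp.norm_def, eLpNorm_congr_ae ((coeFn_historySegment hm).trans hsum'), Lp.norm_def,
    ← ENNReal.toReal_ofReal hN0, ← ENNReal.toReal_add (Lp.eLpNorm_ne_top _) ENNReal.ofReal_ne_top]
  refine ENNReal.toReal_mono (ENNReal.add_ne_top.2 ⟨Lp.eLpNorm_ne_top _, ENNReal.ofReal_ne_top⟩) ?_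
  exact (eLpNorm_add_le (hgtm.1.mono_measure Measure.restrict_le_self) hkm Fact.out).trans
    (add_le_add hgt hkn)

end IsDelaySolution

/-! ### The solution semigroup -/

variable [CompleteSpace X]

variable (S C) in
/-- The mild solution with initial datum `z`. -/
def delaySolution (hτ : 0 < τ) (z : X × HistorySpace X p) : ℝ → X :=
  (exists_isDelaySolution (S := S) (C := C) hτ z).choose

theorem isDelaySolution_delaySolution (hτ : 0 < τ) (z : X × HistorySpace X p) :
    IsDelaySolution S C τ z (delaySolution S C hτ z) :=
  (exists_isDelaySolution (S := S) (C := C) hτ z).choose_spec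

theorem IsDelaySolution.state_eq (hτ0 : 0 < τ) (hτ1 : τ ≤ 1) {z : X × HistorySpace X p}
    {v w : ℝ → X} (h : IsDelaySolution S C τ z v) (h' : IsDelaySolution S C τ z w) {t : ℝ}
    (ht : 0 ≤ t) : (v t, historySegment p v t) = (w t, historySegment p w t) :=
  Prod.ext (h.unique hτ0 hτ1 h' ht)
    (historySegment_congr ht (h.memLp_comp_add hτ0 hτ1 ht) (h.ae_unique hτ0 hτ1 h'))

variable (S C) in
/-- The solution operator of the delay equation at time `t`. -/
def delayEvolution (hτ0 : 0 < τ) (hτ1 : τ ≤ 1) (t : ℝ≥0) :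
    (X × HistorySpace X p) →L[ℂ] (X × HistorySpace X p) :=
  LinearMap.mkContinuousOfExistsBound
    { toFun := fun z => (delaySolution S C hτ0 z t, historySegment p (delaySolution S C hτ0 z) t)
      map_add' := fun z w => by
        have hz := isDelaySolution_delaySolution (S := S) (C := C) hτ0 z
        have hw := isDelaySolution_delaySolution (S := S) (C := C) hτ0 w
        rw [(isDelaySolution_delaySolution hτ0 (z + w)).state_eq hτ0 hτ1 (hz.add hτ0 hτ1 hw) t.coe_nonneg]
        refine Prod.ext rfl (eq_historySegment ?_).symm
        exact (Lp.coeFn_add _ _).trans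
          ((coeFn_historySegment (hz.memLp_comp_add hτ0 hτ1 t.coe_nonneg)).add
            (coeFn_historySegment (hw.memLp_comp_add hτ0 hτ1 t.coe_nonneg)))
      map_smul' := fun c z => by
        have hz := isDelaySolution_delaySolution (S := S) (C := C) hτ0 z
        rw [(isDelaySolution_delaySolution hτ0 (c • z)).state_eq hτ0 hτ1 (hz.smul c) t.coe_nonneg]
        refine Prod.ext rfl (eq_historySegment ?_).symm
        exact (Lp.coeFn_smul _ _).trans
          ((coeFn_historySegment (hz.memLp_comp_add hτ0 hτ1 t.coe_nonneg)).const_smul c) }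
    (by
      obtain ⟨K, hK0, hK⟩ := exists_delaySolution_bound p S C t
      refine ⟨1 + K, fun z => ?_⟩
      have hz := isDelaySolution_delaySolution (S := S) (C := C) hτ0 z
      have hb := hK τ hτ0 hτ1 z _ hz
      refine max_le ?_ ?_
      · exact (hb t ⟨t.coe_nonneg, le_rfl⟩).trans (by nlinarith [norm_nonneg z])
      · refine (hz.norm_historySegment_le hτ0 hτ1 t.coe_nonneg (by positivity) hb).trans ?_
        rw [add_mul, one_mul]
        gcongr
        exact norm_snd_le z)

theorem delayEvolution_apply (hτ0 : 0 < τ) (hτ1 : τ ≤ 1) {z : X × HistorySpace X p} {v : ℝ → X}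
    (h : IsDelaySolution S C τ z v) (t : ℝ≥0) :
    delayEvolution S C hτ0 hτ1 t z = (v t, historySegment p v t) :=
  (isDelaySolution_delaySolution hτ0 z).state_eq hτ0 hτ1 h t.coe_nonneg

variable (p S C) in
/-- The solution semigroup of the delay equation. -/
def delaySemigroup (hp : p ≠ ∞) (hτ0 : 0 < τ) (hτ1 : τ ≤ 1) :
    C0Semigroup (X × HistorySpace X p) where
  op := delayEvolution S C hτ0 hτ1
  op_zero := by
    refine ContinuousLinearMap.ext fun z => ?_
    have hz := isDelaySolution_delaySolution (S := S) (C := C) hτ0 z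
    rw [delayEvolution_apply hτ0 hτ1 hz, NNReal.coe_zero, hz.historySegment_zero, hz.zero_eq]
    rfl
  op_add s t := by
    refine ContinuousLinearMap.ext fun z => ?_
    have hz := isDelaySolution_delaySolution (S := S) (C := C) hτ0 z
    rw [ContinuousLinearMap.comp_apply, delayEvolution_apply hτ0 hτ1 hz,
      delayEvolution_apply hτ0 hτ1 hz, delayEvolution_apply hτ0 hτ1 (hz.shift hτ0 hτ1 t.coe_nonneg),
      NNReal.coe_add]
    rw [historySegment_comp_add]
  continuous_orbit z := by
    have hz := isDelaySolution_delaySolution (S := S) (C := C) hτ0 z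
    have h1 : ContinuousOn (fun t => ((delaySolution S C hτ0 z) t,
        historySegment p (delaySolution S C hτ0 z) t)) (Ici 0) := by
      intro t ht
      have hm : Icc 0 (t + 1) ∈ 𝓝[Ici 0] t :=
        inter_mem_nhdsWithin (Ici 0) (Iic_mem_nhds (lt_add_one t))
      refine ContinuousWithinAt.mono_of_mem_nhdsWithin ?_ hm
      exact ((hz.continuousOn hτ0 hτ1 (t + 1)).prodMk
        (continuousOn_historySegment hp (hz.memLp hτ0 hτ1 (t + 1)))) t ⟨ht, by linarith⟩
    simp only [delayEvolution_apply hτ0 hτ1 hz]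
    exact h1.comp_continuous NNReal.continuous_coe fun t => t.2

theorem delaySemigroup_opReal_apply (hp : p ≠ ∞) (hτ0 : 0 < τ) (hτ1 : τ ≤ 1)
    {z : X × HistorySpace X p} {v : ℝ → X} (h : IsDelaySolution S C τ z v) {t : ℝ} (ht : 0 ≤ t) :
    (delaySemigroup p S C hp hτ0 hτ1).opReal t z = (v t, historySegment p v t) := by
  change delayEvolution S C hτ0 hτ1 t.toNNReal z = _
  rw [delayEvolution_apply hτ0 hτ1 h, Real.coe_toNNReal _ ht]

end Delay

/-! ### The generator of the solution semigroup -/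

section Averages

set_option linter.unusedSectionVars false

variable {X : Type*} [NormedAddCommGroup X] [NormedSpace ℝ X] {p : ℝ≥0∞} [Fact (1 ≤ p)]

theorem translateLp_zero (f : Lp X p (volume : Measure ℝ)) : translateLp 0 f = f :=
  Lp.ext ((coeFn_translateLp 0 f).trans (Eventually.of_forall fun s => by simp))

theorem integrableOn_Ioc_of_memLp {f : ℝ → X} (hf : MemLp f p volume) (a b : ℝ) :
    IntegrableOn f (Ioc a b) :=
  (hf.mono_measure Measure.restrict_le_self).integrable Fact.out

/-- Forward averages `h⁻¹ ∫_σ^{σ+h} f` converge to `f` in `L^p(ℝ, X)` as `h ↓ 0`. -/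
theorem eventually_eLpNorm_average_sub_le [CompleteSpace X] (hp : p ≠ ∞)
    (f : Lp X p (volume : Measure ℝ)) {ε : ℝ} (hε : 0 < ε) :
    ∀ᶠ h in 𝓝[>] (0 : ℝ),
      eLpNorm (fun σ => h⁻¹ • (∫ s in σ..(σ + h), f s) - f σ) p volume ≤ ENNReal.ofReal ε := by
  have hp0 : p ≠ 0 := (one_pos.trans_le (Fact.out : 1 ≤ p)).ne'
  have hp1 : 1 ≤ p.toReal := (ENNReal.dichotomy p).resolve_left hp
  have hp1' : 0 < p.toReal := one_pos.trans_le hp1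
  have htend : Tendsto (fun t => translateLp t f) (𝓝 0) (𝓝 f) := by
    simpa [translateLp_zero] using (continuous_translateLp hp f).tendsto 0
  obtain ⟨δ, hδ, hball⟩ := Metric.eventually_nhds_iff.1 ((Metric.tendsto_nhds.1 htend) ε hε)
  filter_upwards [Ioo_mem_nhdsGT hδ] with h hh
  have hh0 : 0 < h := hh.1
  have hfm : StronglyMeasurable f := Lp.stronglyMeasurable f
  -- The average minus `f` is the mean of `f(σ + s) - f(σ)` for the normalized measure on `(0, h]`.
  -- Monotonicity of `L^p` norms for a probability measure, then Tonelli, bounds its `L^p` norm by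
  -- the largest translation error with `0 < s ≤ h`.
  set μ : Measure ℝ := (ENNReal.ofReal h)⁻¹ • volume.restrict (Ioc 0 h) with hμ
  have hne0 : ENNReal.ofReal h ≠ 0 := (ENNReal.ofReal_pos.2 hh0).ne'
  have : IsProbabilityMeasure μ := ⟨by
    simp [hμ, ENNReal.inv_mul_cancel hne0 ENNReal.ofReal_ne_top]⟩
  have hshift (σ : ℝ) : IntegrableOn (fun s => f (σ + s)) (Ioc 0 h) := by
    have := ((Lp.memLp f).comp_measurePreserving (measurePreserving_add_left volume σ))
    exact integrableOn_Ioc_of_memLp this 0 h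
  have hpt (σ : ℝ) : ‖h⁻¹ • (∫ s in σ..(σ + h), f s) - f σ‖ₑ ^ p.toReal ≤
      ∫⁻ s, ‖f (σ + s) - f σ‖ₑ ^ p.toReal ∂μ := by
    have hmeas : AEStronglyMeasurable (fun s => f (σ + s) - f σ) μ :=
      ((hfm.comp_measurable (measurable_const_add σ)).sub
        stronglyMeasurable_const).aestronglyMeasurable
    have h1 : h⁻¹ • (∫ s in σ..(σ + h), f s) - f σ = ∫ s, (f (σ + s) - f σ) ∂μ := by
      have h2 := intervalIntegral.integral_comp_add_left (a := 0) (b := h) (fun s => f s) σ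
      rw [add_zero] at h2
      rw [hμ, integral_smul_measure, integral_sub (hshift σ) (integrable_const _), ← h2,
        intervalIntegral.integral_of_le hh0.le, ENNReal.toReal_inv, ENNReal.toReal_ofReal hh0.le,
        integral_const, smul_sub]
      simp [hh0.le, smul_smul, hh0.ne']
    have h3 : ‖∫ s, (f (σ + s) - f σ) ∂μ‖ₑ ≤ eLpNorm (fun s => f (σ + s) - f σ) p μ := by
      refine (enorm_integral_le_lintegral_enorm _).trans ?_
      rw [← eLpNorm_one_eq_lintegral_enorm]
      exact eLpNorm_le_eLpNorm_of_exponent_le Fact.out hmeas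
    rw [h1]
    calc _ ≤ eLpNorm (fun s => f (σ + s) - f σ) p μ ^ p.toReal := by gcongr
      _ = _ := by
        rw [eLpNorm_eq_lintegral_rpow_enorm_toReal hp0 hp, ← ENNReal.rpow_mul, one_div,
          inv_mul_cancel₀ hp1'.ne', ENNReal.rpow_one]
  have hs (s : ℝ) (hs : s ∈ Ioc 0 h) :
      ∫⁻ σ, ‖f (σ + s) - f σ‖ₑ ^ p.toReal ≤ ENNReal.ofReal ε ^ p.toReal := by
    have h1 := hball (y := s) (by
      rw [Real.dist_eq, sub_zero, abs_of_pos hs.1]; exact hs.2.trans_lt hh.2)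
    rw [Lp.dist_def] at h1
    have h2 : eLpNorm (⇑(translateLp s f) - ⇑f) p volume = eLpNorm (fun σ => f (σ + s) - f σ) p volume :=
      eLpNorm_congr_ae ((coeFn_translateLp s f).sub EventuallyEq.rfl)
    have hfin : eLpNorm (⇑(translateLp s f) - ⇑f) p volume ≠ ∞ :=
      ((Lp.memLp (translateLp s f)).sub (Lp.memLp f)).2.ne
    have h3 : eLpNorm (fun σ => f (σ + s) - f σ) p volume ≤ ENNReal.ofReal ε := by
      rw [← h2, ← ENNReal.ofReal_toReal hfin]
      exact ENNReal.ofReal_le_ofReal h1.le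
    calc _ = eLpNorm (fun σ => f (σ + s) - f σ) p volume ^ p.toReal := by
          rw [eLpNorm_eq_lintegral_rpow_enorm_toReal hp0 hp, ← ENNReal.rpow_mul, one_div,
            inv_mul_cancel₀ hp1'.ne', ENNReal.rpow_one]
      _ ≤ _ := by gcongr
  have hmeas2 : AEMeasurable (Function.uncurry fun σ s => ‖f (σ + s) - f σ‖ₑ ^ p.toReal)
      (volume.prod μ) := by
    refine (Measurable.pow_const ?_ _).aemeasurable
    exact ((hfm.comp_measurable (measurable_fst.add measurable_snd)).sub
      (hfm.comp_measurable measurable_fst)).enorm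
  rw [eLpNorm_eq_lintegral_rpow_enorm_toReal hp0 hp, one_div, ENNReal.rpow_inv_le_iff hp1']
  calc _ ≤ ∫⁻ σ, ∫⁻ s, ‖f (σ + s) - f σ‖ₑ ^ p.toReal ∂μ := lintegral_mono hpt
    _ = ∫⁻ s, (∫⁻ σ, ‖f (σ + s) - f σ‖ₑ ^ p.toReal) ∂μ := lintegral_lintegral_swap hmeas2
    _ ≤ ∫⁻ s, ENNReal.ofReal ε ^ p.toReal ∂μ := by
      refine lintegral_mono_ae ?_
      have : ∀ᵐ s ∂μ, s ∈ Ioc 0 h := Measure.ae_smul_measure (ae_restrict_mem measurableSet_Ioc) _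
      exact this.mono hs
    _ = _ := by simp

end Averages

/-! ### The graph of the delay operator and right derivatives at time zero. -/

section Generator

variable {X : Type*} [NormedAddCommGroup X] [NormedSpace ℂ X] [CompleteSpace X]
  {p : ℝ≥0∞} [Fact (1 ≤ p)]

/-- Uniqueness of representative and derivative frees the graph from the chosen ones: any absolutely
continuous representative `F` may be used. -/
theorem mem_graph_delayOperator {B : X →ₗ.[ℂ] X} {C : X →L[ℂ] X} {τ : ℝ} {hτ : τ ∈ Icc (0 : ℝ) 1}
    {z w : X × HistorySpace X p} : (z, w) ∈ (delayOperator B (pointDelay p C τ hτ)).graph ↔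
      ∃ F, IsSobolevRep z.2 w.2 F ∧ F 0 = z.1 ∧ (z.1, w.1 - C (F (-τ))) ∈ B.graph := by
  rw [LinearPMap.mem_graph_iff]
  constructor
  · rintro ⟨⟨d, hd1, hd2, hd3⟩, rfl, rfl⟩
    refine ⟨_, SobolevSpace.isSobolevRep ⟨d.2, hd2⟩, hd3, ?_⟩
    rw [LinearPMap.mem_graph_iff]
    exact ⟨⟨d.1, hd1⟩, rfl, (add_sub_cancel_right (B ⟨d.1, hd1⟩) _).symm⟩
  · rintro ⟨F, hF, hF0, hB⟩
    rw [LinearPMap.mem_graph_iff] at hB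
    obtain ⟨d, hd1, hd2⟩ := hB
    simp only at hd1 hd2
    have hz2 : z.2 ∈ SobolevSpace X p := ⟨w.2, F, hF⟩
    have hrep := SobolevSpace.isSobolevRep ⟨z.2, hz2⟩
    have hz1 : z.1 ∈ B.domain := hd1 ▸ d.2
    have h0 : (0 : ℝ) ∈ Icc (-1 : ℝ) 0 := right_mem_Icc.2 (by norm_num)
    refine ⟨⟨z, hz1, hz2, (hrep.rep_unique hF h0).trans hF0⟩, rfl, Prod.ext ?_ ?_⟩
    · have hd : d = ⟨z.1, hz1⟩ := Subtype.ext hd1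
      have hFτ := hrep.rep_unique hF (show -τ ∈ Icc (-1 : ℝ) 0 from ⟨by linarith [hτ.2], by linarith [hτ.1]⟩)
      change B ⟨z.1, hz1⟩ + C (SobolevSpace.rep ⟨z.2, hz2⟩ (-τ)) = w.1
      rw [← hd, hFτ, hd2, sub_add_cancel]
    · exact hrep.deriv_unique hF

variable (X p) in
/-- The functional `f ↦ ∫_a^0 f` on the history space. -/
def historyIntegral (a : Icc (-1 : ℝ) 0) : HistorySpace X p →L[ℂ] X :=
  LinearMap.mkContinuous
    { toFun := fun f => ∫ s in (a : ℝ)..0, f s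
      map_add' := fun f g => by
        rw [← intervalIntegral.integral_add (historySpace_intervalIntegrable f a.2).symm
          (historySpace_intervalIntegrable g a.2).symm]
        have := (ae_restrict_iff' measurableSet_Icc).1 (Lp.coeFn_add f g)
        refine intervalIntegral.integral_congr_ae (this.mono fun s hs hI => ?_)
        rw [uIoc_of_le a.2.2] at hI
        exact hs ⟨a.2.1.trans hI.1.le, hI.2⟩
      map_smul' := fun c f => by
        rw [RingHom.id_apply, ← intervalIntegral.integral_smul]
        have := (ae_restrict_iff' measurableSet_Icc).1 (Lp.coeFn_smul c f)
        refine intervalIntegral.integral_congr_ae (this.mono fun s hs hI => ?_)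
        rw [uIoc_of_le a.2.2] at hI
        exact hs ⟨a.2.1.trans hI.1.le, hI.2⟩ } 1 fun f => by
    rw [one_mul]
    refine le_trans ?_ (integral_norm_historySpace_le f)
    refine (intervalIntegral.norm_integral_le_integral_norm a.2.2).trans ?_
    rw [intervalIntegral.integral_of_le a.2.2]
    exact setIntegral_mono_set (integrable_historySpace f).norm
      (Eventually.of_forall fun _ => norm_nonneg _)
      (LE.le.eventuallyLE fun s hs => ⟨a.2.1.trans hs.1.le, hs.2⟩)

theorem historyIntegral_apply (a : Icc (-1 : ℝ) 0) (f : HistorySpace X p) :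
    historyIntegral X p a f = ∫ s in (a : ℝ)..0, f s := rfl

theorem norm_historyIntegral_le (a : Icc (-1 : ℝ) 0) : ‖historyIntegral X p a‖ ≤ 1 :=
  LinearMap.mkContinuous_norm_le _ zero_le_one _

theorem historyIntegral_eq_of_ae (a : Icc (-1 : ℝ) 0) {f : HistorySpace X p} {v : ℝ → X}
    (h : f =ᵐ[historyMeasure] v) : historyIntegral X p a f = ∫ s in (a : ℝ)..0, v s := by
  rw [historyIntegral_apply]
  refine intervalIntegral.integral_congr_ae
    (((ae_restrict_iff' measurableSet_Icc).1 h).mono fun s hs hI => ?_)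
  rw [uIoc_of_le a.2.2] at hI
  exact hs ⟨a.2.1.trans hI.1.le, hI.2⟩

variable {S : C0Semigroup X} {C : X →L[ℂ] X} {τ : ℝ} {z : X × HistorySpace X p} {v : ℝ → X}

/-- Right differentiability of a solution at `0` is right differentiability of the orbit of the
undelayed semigroup. -/
theorem IsDelaySolution.tendsto_slope_iff (hτ0 : 0 < τ) (hτ1 : τ ≤ 1)
    (h : IsDelaySolution S C τ z v) {F : ℝ → X} (hF : ContinuousOn F (Icc (-1) 0))
    (hzF : z.2 =ᵐ[historyMeasure] F) {y : X} :
    Tendsto (fun r : ℝ => r⁻¹ • (v r - z.1)) (𝓝[>] 0) (𝓝 y) ↔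
      Tendsto (fun r : ℝ => r⁻¹ • (S.opReal r z.1 - z.1)) (𝓝[>] 0) (𝓝 (y - C (F (-τ)))) := by
  have hvF := (ae_restrict_iff' measurableSet_Icc).1 (h.history.symm.trans hzF)
  have hshift : ∀ᵐ s : ℝ, s - τ ∈ Icc (-1 : ℝ) 0 → v (s - τ) = F (s - τ) :=
    (measurePreserving_sub_right volume τ).quasiMeasurePreserving.ae hvF
  set g : ℝ → X := fun s => C (F (s - τ)) with hg
  have hmaps (s : ℝ) (hs : s ∈ Ioc 0 τ) : s - τ ∈ Icc (-1 : ℝ) 0 :=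
    ⟨by linarith [hs.1], by linarith [hs.2]⟩
  have hgi : IntegrableOn g (Ioc 0 τ) := by
    refine IntegrableOn.congr_fun_ae (h.integrableOn_forcing hτ0 hτ1 τ) ?_
    refine (ae_restrict_iff' measurableSet_Ioc).2 (hshift.mono fun s hs hI => ?_)
    simp only [hg, hs (hmaps s hI)]
  have hgt : Tendsto g (𝓝[>] 0) (𝓝 (C (F (-τ)))) := by
    refine (C.continuous.tendsto _).comp ?_
    refine (hF (-τ) ⟨by linarith, by linarith⟩).tendsto.comp ?_
    refine tendsto_nhdsWithin_iff.2 ⟨?_, ?_⟩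
    · have : Continuous fun s : ℝ => s - τ := by fun_prop
      simpa using (this.tendsto 0).mono_left nhdsWithin_le_nhds
    · filter_upwards [Ioo_mem_nhdsGT hτ0] with s hs using hmaps s ⟨hs.1, hs.2.le⟩
  -- Before time `τ` the forcing reads only the initial history, whose representative is continuous
  -- at `-τ`. So the averaged convolution contributes exactly `C (F (-τ))` in the limit.
  have havg := S.tendsto_inv_smul_conv hgt (by
    filter_upwards [Ioo_mem_nhdsGT hτ0] with r hr using
      hgi.mono_set (Ioc_subset_Ioc_right hr.2.le))
  have heq : ∀ᶠ r in 𝓝[>] (0 : ℝ),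
      r⁻¹ • (v r - z.1) = r⁻¹ • (S.opReal r z.1 - z.1) + r⁻¹ • S.conv g r := by
    filter_upwards [Ioo_mem_nhdsGT hτ0] with r hr
    have : S.conv (fun s => C (v (s - τ))) r = S.conv g r := by
      refine intervalIntegral.integral_congr_ae (hshift.mono fun s hs hI => ?_)
      rw [uIoc_of_le hr.1.le] at hI
      simp only [hg, hs (hmaps s ⟨hI.1, hI.2.trans hr.2.le⟩)]
    rw [h.mild r hr.1.le, this, ← smul_add]
    congr 1
    abel
  constructor
  · intro h1
    refine (h1.sub havg).congr' (heq.mono fun r hr => ?_)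
    rw [hr, add_sub_cancel_right]
  · intro h1
    have := h1.add havg
    rw [sub_add_cancel] at this
    exact this.congr' (heq.mono fun r hr => hr.symm)

/-- If the history segments of a solution are differentiable at `0` then the initial history is a
Sobolev function with the expected boundary value. -/
theorem IsDelaySolution.isSobolevRep_of_tendsto (hτ0 : 0 < τ) (hτ1 : τ ≤ 1)
    (h : IsDelaySolution S C τ z v) {g : HistorySpace X p}
    (hg : Tendsto (fun r : ℝ => r⁻¹ • (historySegment p v r - z.2)) (𝓝[>] 0) (𝓝 g)) :
    IsSobolevRep z.2 g (fun σ => z.1 + ∫ s in (0 : ℝ)..σ, g s) := by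
  have hint : IntervalIntegrable v volume (-1) 1 :=
    (intervalIntegrable_iff_integrableOn_Ioc_of_le (by norm_num)).2 (h.integrableOn hτ0 hτ1 1)
  have hsub (a b : ℝ) (ha : a ∈ Icc (-1 : ℝ) 1) (hb : b ∈ Icc (-1 : ℝ) 1) :
      IntervalIntegrable v volume a b := by
    refine hint.mono_set ?_
    rw [uIcc_of_le (by norm_num : (-1 : ℝ) ≤ 1)]
    exact uIcc_subset_Icc ha hb
  refine ⟨?_, fun σ _ => by simp⟩
  have hzero : Tendsto (fun r : ℝ => r⁻¹ • ∫ s in (0 : ℝ)..r, v s) (𝓝[>] 0) (𝓝 z.1) := by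
    have hnhds : Icc (0 : ℝ) 1 ∈ 𝓝[>] (0 : ℝ) := Icc_mem_nhdsGT one_pos
    have hc := h.continuousOn hτ0 hτ1 1
    have hd : HasDerivWithinAt (fun t => ∫ s in (0 : ℝ)..t, v s) (v 0) (Ici 0) 0 :=
      intervalIntegral.integral_hasDerivWithinAt_right (t := Ioi 0)
        (hsub 0 0 (by simp) (by simp))
        ⟨Icc 0 1, hnhds, hc.aestronglyMeasurable measurableSet_Icc⟩
        ((hc 0 (by simp)).mono_of_mem_nhdsWithin hnhds)
    have := (hasDerivWithinAt_iff_tendsto_slope.1 hd)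
    rw [Ici_sdiff_left, h.zero_eq] at this
    refine this.congr fun r => ?_
    simp [slope]
  have hae := hint.ae_hasDerivAt_integral
  have hne : ∀ᵐ x : ℝ, x ≠ 0 := by simp [ae_iff, measure_singleton]
  have hhist := (ae_restrict_iff' measurableSet_Icc).1 h.history
  refine (ae_restrict_iff' measurableSet_Icc).2 ?_
  filter_upwards [hae, hne, hhist] with a ha hane hza haI
  have ha0 : a < 0 := lt_of_le_of_ne haI.2 hane
  have hau : a ∈ uIcc (-1 : ℝ) 1 := by
    rw [uIcc_of_le (by norm_num)]; exact ⟨haI.1, by linarith⟩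
  have hda := ha hau 0 (by rw [uIcc_of_le (by norm_num)]; simp)
  have hslope : Tendsto (fun r : ℝ => r⁻¹ • ∫ s in a..(a + r), v s) (𝓝[>] 0) (𝓝 (v a)) := by
    refine ((hasDerivAt_iff_tendsto_slope_zero.1 hda).mono_left
      (nhdsWithin_mono _ fun r (hr : (0 : ℝ) < r) => hr.ne')).congr' ?_
    filter_upwards [Ioo_mem_nhdsGT one_pos] with r hr
    rw [intervalIntegral.integral_interval_sub_left
      (hsub _ _ (by simp) ⟨by linarith [haI.1, hr.1], by linarith [hr.2]⟩)
      (hsub _ _ (by simp) ⟨haI.1, by linarith⟩)]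
  -- Integrating the difference quotient of segments over `[a, 0]` leaves two boundary averages, at
  -- `0` and at `a`. For almost every `a` they converge to `z.1` and `v a`, which yields `v a = z.1
  -- - ∫_a^0 g`.
  have hlim := (((historyIntegral X p ⟨a, haI⟩).continuous.tendsto g).comp hg)
  have hlim2 : Tendsto (fun r : ℝ => r⁻¹ • (∫ s in (0 : ℝ)..r, v s) - r⁻¹ • ∫ s in a..(a + r), v s)
      (𝓝[>] 0) (𝓝 (historyIntegral X p ⟨a, haI⟩ g)) := by
    refine hlim.congr' ?_
    filter_upwards [Ioo_mem_nhdsGT one_pos] with r hr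
    have h1 : historyIntegral X p ⟨a, haI⟩ (historySegment p v r) = ∫ s in (a + r)..r, v s := by
      rw [historyIntegral_eq_of_ae _ (coeFn_historySegment (h.memLp_comp_add hτ0 hτ1 hr.1.le)),
        intervalIntegral.integral_comp_add_right, zero_add]
    have h2 : historyIntegral X p ⟨a, haI⟩ z.2 = ∫ s in a..0, v s :=
      historyIntegral_eq_of_ae _ h.history
    have ham : a ∈ Icc (-1 : ℝ) 1 := ⟨haI.1, by linarith⟩
    have harm : a + r ∈ Icc (-1 : ℝ) 1 := ⟨by linarith [haI.1, hr.1], by linarith [hr.2]⟩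
    have hrm : r ∈ Icc (-1 : ℝ) 1 := ⟨by linarith [hr.1], hr.2.le⟩
    have h0m : (0 : ℝ) ∈ Icc (-1 : ℝ) 1 := by simp
    have h3 := intervalIntegral.integral_add_adjacent_intervals (hsub _ _ ham h0m) (hsub _ _ h0m hrm)
    have h4 := intervalIntegral.integral_add_adjacent_intervals (hsub _ _ ham harm) (hsub _ _ harm hrm)
    simp only [Function.comp_apply]
    rw [(historyIntegral X p ⟨a, haI⟩).map_smul_of_tower, map_sub, h1, h2, ← smul_sub]
    congr 1
    rw [← h4] at h3
    rw [sub_eq_sub_iff_add_eq_add, add_comm _ (∫ s in a..0, v s), h3, add_comm]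
  have huniq := tendsto_nhds_unique hlim2 (hzero.sub hslope)
  rw [historyIntegral_apply] at huniq
  rw [hza haI, intervalIntegral.integral_symm, huniq]
  abel

end Generator

section Generator

set_option linter.unusedSectionVars false

variable {X : Type*} [NormedAddCommGroup X] [NormedSpace ℂ X] [CompleteSpace X]
  {p : ℝ≥0∞} [Fact (1 ≤ p)]
variable {S : C0Semigroup X} {C : X →L[ℂ] X} {τ : ℝ} {z : X × HistorySpace X p} {v : ℝ → X}

/-- A Sobolev history extends to `[-1,1]`, with constant derivative `y` on `(0,1]`. -/
theorem IsSobolevRep.exists_extension {f g : HistorySpace X p} {F : ℝ → X}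
    (hF : IsSobolevRep f g F) (y : X) :
    ∃ G : Lp X p (volume : Measure ℝ), (∀ᵐ s, s ∈ Icc (-1 : ℝ) 0 → G s = g s) ∧
      (∀ t ∈ Icc (-1 : ℝ) 0, F 0 + ∫ s in (0 : ℝ)..t, G s = F t) ∧
      ∀ t ∈ Icc (0 : ℝ) 1, F 0 + ∫ s in (0 : ℝ)..t, G s = F 0 + t • y := by
  have hG : MemLp (indicator (Icc (-1) 0) g + indicator (Ioc 0 1) fun _ => y) p volume :=
    ((memLp_indicator_iff_restrict measurableSet_Icc).2 (Lp.memLp g)).add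
      (memLp_indicator_const p measurableSet_Ioc y (Or.inr (by simp)))
  have hGae := hG.coeFn_toLp
  have h1 : ∀ᵐ s, s ∈ Icc (-1 : ℝ) 0 → hG.toLp _ s = g s := hGae.mono fun s hs hI => by
    rw [hs, Pi.add_apply, indicator_of_mem hI, indicator_of_notMem (fun h => not_lt.2 hI.2 h.1),
      add_zero]
  have h2 : ∀ᵐ s, s ∈ Ioc (0 : ℝ) 1 → hG.toLp _ s = y := hGae.mono fun s hs hI => by
    rw [hs, Pi.add_apply, indicator_of_mem hI, indicator_of_notMem (fun h => not_lt.2 h.2 hI.1),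
      zero_add]
  refine ⟨hG.toLp _, h1, fun t ht => ?_, fun t ht => ?_⟩
  · rw [hF.eq_primitive t ht]
    congr 1
    refine intervalIntegral.integral_congr_ae (h1.mono fun s hs hI => ?_)
    rw [uIoc_of_ge ht.2] at hI
    exact hs ⟨ht.1.trans hI.1.le, hI.2⟩
  · congr 1
    have : ∫ s in (0 : ℝ)..t, hG.toLp _ s = ∫ s in (0 : ℝ)..t, y := by
      refine intervalIntegral.integral_congr_ae (h2.mono fun s hs hI => ?_)
      rw [uIoc_of_le ht.1] at hI
      exact hs ⟨hI.1, hI.2.trans ht.2⟩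
    rw [this, intervalIntegral.integral_const, sub_zero]

/-- History segments of a solution that is right differentiable at `0` and has a Sobolev initial
history are right differentiable at `0`. -/
theorem IsDelaySolution.tendsto_historySegment (hp : p ≠ ∞) (hτ0 : 0 < τ) (hτ1 : τ ≤ 1)
    (h : IsDelaySolution S C τ z v) {g : HistorySpace X p} {F : ℝ → X}
    (hF : IsSobolevRep z.2 g F) (hF0 : F 0 = z.1) {y : X}
    (hy : Tendsto (fun r : ℝ => r⁻¹ • (v r - z.1)) (𝓝[>] 0) (𝓝 y)) :
    Tendsto (fun r : ℝ => r⁻¹ • (historySegment p v r - z.2)) (𝓝[>] 0) (𝓝 g) := by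
  obtain ⟨G, hGg, hGF, hGy⟩ := hF.exists_extension y
  set Φ : ℝ → X := fun t => F 0 + ∫ s in (0 : ℝ)..t, G s with hΦ
  have hGint (a b : ℝ) : IntervalIntegrable G volume a b :=
    ⟨integrableOn_Ioc_of_memLp (Lp.memLp G) a b, integrableOn_Ioc_of_memLp (Lp.memLp G) b a⟩
  have hΦc : Continuous Φ := continuous_const.add (intervalIntegral.continuous_primitive hGint 0)
  rw [Metric.tendsto_nhds]
  intro ε hε
  have hε3 : 0 < ε / 3 := by linarith
  have hr1 := (Metric.tendsto_nhds.1 hy) (ε / 3) hε3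
  obtain ⟨δ, hδ, hδy⟩ := (nhdsGT_basis (0 : ℝ)).eventually_iff.1 hr1
  filter_upwards [eventually_eLpNorm_average_sub_le hp G hε3,
    Ioo_mem_nhdsGT (lt_min hδ one_pos)] with r hr hrI
  have hr0 : 0 < r := hrI.1
  have hrδ : r < δ := hrI.2.trans_le (min_le_left _ _)
  have hr1 : r < 1 := hrI.2.trans_le (min_le_right _ _)
  set a : ℝ → X := fun σ => r⁻¹ • (∫ s in σ..(σ + r), G s) - G σ with ha
  set k : ℝ → X := fun σ => r⁻¹ • (v (σ + r) - Φ (σ + r)) with hk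
  set q : HistorySpace X p := r⁻¹ • (historySegment p v r - z.2) - g with hq
  have hvF : ∀ᵐ s, s ∈ Icc (-1 : ℝ) 0 → v s = F s :=
    (ae_restrict_iff' measurableSet_Icc).1 (h.history.symm.trans hF.ae_eq)
  -- The error splits into an averaging error `a` of the extended derivative `G` and the mismatch
  -- `k` between `v` and the primitive `Φ`. The mismatch vanishes a.e. where `σ + r ≤ 0`, and is
  -- small for `0 < σ + r ≤ r` since `v` and `Φ` have the same right derivative `y` at `0`.
  have hqk : q =ᵐ[historyMeasure] a + k := by
    have hv : ∀ᵐ s ∂historyMeasure, v s = F s := (ae_restrict_iff' measurableSet_Icc).2 hvF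
    have hg : ∀ᵐ s ∂historyMeasure, G s = g s := (ae_restrict_iff' measurableSet_Icc).2 hGg
    filter_upwards [Lp.coeFn_sub (r⁻¹ • (historySegment p v r - z.2)) g,
      Lp.coeFn_smul r⁻¹ (historySegment p v r - z.2), Lp.coeFn_sub (historySegment p v r) z.2,
      coeFn_historySegment (h.memLp_comp_add hτ0 hτ1 hr0.le), h.history, hv, hg,
      ae_restrict_mem measurableSet_Icc] with σ e1 e2 e3 e4 e5 e6 e7 hσ
    have e8 : ∫ s in σ..(σ + r), G s = Φ (σ + r) - Φ σ := by
      simp only [hΦ, add_sub_add_left_eq_sub]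
      exact (intervalIntegral.integral_interval_sub_left (hGint _ _) (hGint _ _)).symm
    have e9 : Φ σ = F σ := hGF σ hσ
    rw [hq, e1, Pi.sub_apply, e2, Pi.smul_apply, e3, Pi.sub_apply, e4, e5, e6, Pi.add_apply,
      ha, hk]
    simp only [e7, e8, e9, smul_sub]
    abel
  have ham : AEStronglyMeasurable a historyMeasure := by
    have : a = fun σ => r⁻¹ • (Φ (σ + r) - Φ σ) - G σ := by
      funext σ
      simp only [ha, hΦ, add_sub_add_left_eq_sub]
      rw [intervalIntegral.integral_interval_sub_left (hGint _ _) (hGint _ _)]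
    rw [this]
    have hc : Continuous fun σ => r⁻¹ • (Φ (σ + r) - Φ σ) := by fun_prop
    exact hc.aestronglyMeasurable.sub (Lp.stronglyMeasurable G).aestronglyMeasurable
  have hkm : AEStronglyMeasurable k historyMeasure := by
    refine ((Lp.aestronglyMeasurable q).sub ham).congr (hqk.mono fun σ hσ => ?_)
    rw [Pi.sub_apply, hσ, Pi.add_apply, add_sub_cancel_left]
  have hkb : ∀ᵐ σ ∂historyMeasure, ‖k σ‖ ≤ ε / 3 := by
    refine (ae_restrict_iff' measurableSet_Icc).2 ?_
    filter_upwards [(measurePreserving_add_right volume r).quasiMeasurePreserving.ae hvF]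
      with σ hσ hI
    simp only [hk]
    rcases le_or_gt (σ + r) 0 with h0 | h0
    · have hm : σ + r ∈ Icc (-1 : ℝ) 0 := ⟨by linarith [hI.1], h0⟩
      rw [hσ hm, hΦ]
      simp only [hGF _ hm, sub_self, smul_zero, norm_zero]
      exact hε3.le
    · have hle : σ + r ≤ r := by linarith [hI.2]
      have h1 := hδy ⟨h0, hle.trans_lt hrδ⟩
      rw [dist_eq_norm] at h1
      have h2 : v (σ + r) - Φ (σ + r) =
          (σ + r) • ((σ + r)⁻¹ • (v (σ + r) - z.1) - y) := by
        have h3 : Φ (σ + r) = z.1 + (σ + r) • y := by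
          rw [← hF0]; exact hGy _ ⟨h0.le, hle.trans hr1.le⟩
        rw [h3, smul_sub, smul_inv_smul₀ h0.ne', sub_add_eq_sub_sub]
      rw [h2, norm_smul, norm_smul, norm_inv, Real.norm_of_nonneg hr0.le, Real.norm_of_nonneg h0.le]
      calc r⁻¹ * ((σ + r) * _) ≤ r⁻¹ * (r * (ε / 3)) := by gcongr
        _ = ε / 3 := by rw [inv_mul_cancel_left₀ hr0.ne']
  have hq2 : eLpNorm q p historyMeasure ≤ ENNReal.ofReal (ε / 3 + ε / 3) := by
    rw [eLpNorm_congr_ae hqk, ENNReal.ofReal_add hε3.le hε3.le]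
    refine (eLpNorm_add_le ham hkm Fact.out).trans (add_le_add ?_ ?_)
    · exact (eLpNorm_mono_measure _ Measure.restrict_le_self).trans hr
    · exact (eLpNorm_le_of_ae_bound hkb).trans (by simp)
  rw [dist_eq_norm, ← hq, Lp.norm_def]
  calc _ ≤ ε / 3 + ε / 3 := ENNReal.toReal_le_of_le_ofReal (by linarith) hq2
    _ < ε := by linarith

/-- The solution semigroup is generated by the delay operator. -/
theorem isGeneratedBy_delaySemigroup {B : X →ₗ.[ℂ] X} (hS : S.IsGeneratedBy B) (hp : p ≠ ∞)
    (hτ0 : 0 < τ) (hτ1 : τ ≤ 1) (hτ : τ ∈ Icc (0 : ℝ) 1) :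
    (delaySemigroup p S C hp hτ0 hτ1).IsGeneratedBy (delayOperator B (pointDelay p C τ hτ)) := by
  rw [C0Semigroup.isGeneratedBy_iff]
  intro z w
  obtain ⟨v, hv⟩ := exists_isDelaySolution (S := S) (C := C) hτ0 z
  have heq : (fun r : ℝ => r⁻¹ • ((delaySemigroup p S C hp hτ0 hτ1).opReal r z - z)) =ᶠ[𝓝[>] 0]
      fun r => (r⁻¹ • (v r - z.1), r⁻¹ • (historySegment p v r - z.2)) := by
    filter_upwards [self_mem_nhdsWithin] with r hr
    rw [delaySemigroup_opReal_apply hp hτ0 hτ1 hv (le_of_lt hr)]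
    rfl
  have hprod : Tendsto (fun r : ℝ => r⁻¹ • ((delaySemigroup p S C hp hτ0 hτ1).opReal r z - z))
      (𝓝[>] 0) (𝓝 w) ↔ Tendsto (fun r : ℝ => r⁻¹ • (v r - z.1)) (𝓝[>] 0) (𝓝 w.1) ∧
        Tendsto (fun r : ℝ => r⁻¹ • (historySegment p v r - z.2)) (𝓝[>] 0) (𝓝 w.2) := by
    rw [tendsto_congr' heq, Prod.tendsto_iff]
  refine Iff.trans ?_ hprod.symm
  rw [mem_graph_delayOperator]
  constructor
  · rintro ⟨F, hF, hF0, hB⟩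
    have h1 := (hv.tendsto_slope_iff hτ0 hτ1 hF.continuousOn hF.ae_eq).2 (hS.mem_graph_iff.1 hB)
    exact ⟨h1, hv.tendsto_historySegment hp hτ0 hτ1 hF hF0 h1⟩
  · rintro ⟨h1, h2⟩
    have hF := hv.isSobolevRep_of_tendsto hτ0 hτ1 h2
    exact ⟨_, hF, by simp,
      hS.mem_graph_iff.2 ((hv.tendsto_slope_iff hτ0 hτ1 hF.continuousOn hF.ae_eq).1 h1)⟩

end Generator

/-! ### Small delays -/

section SmallDelay

set_option linter.unusedSectionVars false

variable {X : Type*} [NormedAddCommGroup X] [NormedSpace ℂ X] [CompleteSpace X]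
  {p : ℝ≥0∞} [Fact (1 ≤ p)]
variable {S : C0Semigroup X} {C : X →L[ℂ] X} {τ : ℝ} {z : X × HistorySpace X p} {v : ℝ → X}

/-- A solution of the delay equation almost solves the equation without delay. -/
theorem IsDelaySolution.norm_sub_undelayed_le (hτ0 : 0 < τ) (hτ1 : τ ≤ 1)
    (h : IsDelaySolution S C τ z v) {M b δ η V : ℝ} (hM0 : 0 ≤ M) (hη0 : 0 ≤ η)
    (hV0 : 0 ≤ V) (hM : ∀ t ≤ b, ‖S.opReal t‖ ≤ M) (hτδ : τ ≤ δ / 2)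
    (hη : ∀ s ∈ Icc (δ / 2) b, ∀ r ∈ Icc (δ / 2) b, |s - r| ≤ τ → ‖S.opReal s - S.opReal r‖ ≤ η)
    (hV : ∀ t ∈ Icc 0 b, ‖v t‖ ≤ V) {t : ℝ} (ht : t ∈ Icc δ b) :
    ‖v t - (S.opReal t (z.1 + C (∫ s in (-τ)..0, v s)) + S.conv (fun s => C (v s)) t)‖ ≤
      η * ‖C‖ * ‖z‖ + b * (η * (‖C‖ * V)) + δ * (M * (‖C‖ * V)) + δ / 2 * (M * (‖C‖ * V)) := by
  -- For `r ≤ m` the times `t - τ - r` and `t - r` stay at least `δ / 2`, where the modulus `η`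
  -- applies. Beyond `m` only the bound `M` on intervals of length at most `δ / 2` is used.
  set m := t - τ - δ / 2 with hm
  have hm0 : 0 ≤ m := by linarith [ht.1]
  have hδt := ht.1
  have htb := ht.2
  have hCv : IntegrableOn (fun s => C (v s)) (Ioc (-1) b) :=
    C.integrable_comp (h.integrableOn hτ0 hτ1 b)
  have hCvi (a c : ℝ) (ha : -1 ≤ a) (hac : a ≤ c) (hcb : c ≤ b) :
      IntegrableOn (fun s => C (v s)) (Ioc a c) := hCv.mono_set (Ioc_subset_Ioc ha hcb)
  set I : ℝ → X := fun r => S.opReal (t - τ - r) (C (v r)) with hI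
  set J : ℝ → X := fun r => S.opReal (t - r) (C (v r)) with hJ
  have hIi (a c : ℝ) (ha : -1 ≤ a) (hac : a ≤ c) (hcb : c ≤ b) : IntervalIntegrable I volume a c :=
    (intervalIntegrable_iff_integrableOn_Ioc_of_le hac).2
      (S.integrableOn_opReal_sub (hCvi a c ha hac hcb) _)
  have hJi (a c : ℝ) (ha : -1 ≤ a) (hac : a ≤ c) (hcb : c ≤ b) : IntervalIntegrable J volume a c :=
    (intervalIntegrable_iff_integrableOn_Ioc_of_le hac).2
      (S.integrableOn_opReal_sub (hCvi a c ha hac hcb) _)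
  have hvi : IntervalIntegrable v volume (-τ) 0 :=
    (intervalIntegrable_iff_integrableOn_Ioc_of_le (by linarith)).2
      (h.integrableOn_history.mono_set (Ioc_subset_Ioc_left (by linarith)))
  have e1 : S.conv (fun s => C (v (s - τ))) t =
      (∫ r in (-τ)..0, I r) + ((∫ r in (0 : ℝ)..m, I r) + ∫ r in m..(t - τ), I r) := by
    rw [intervalIntegral.integral_add_adjacent_intervals (hIi _ _ (by linarith) hm0 (by linarith))
        (hIi _ _ (by linarith) (by linarith) (by linarith)),
      intervalIntegral.integral_add_adjacent_intervals
        (hIi _ _ (by linarith) (by linarith) (by linarith))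
        (hIi _ _ (by linarith) (by linarith) (by linarith))]
    have := intervalIntegral.integral_comp_sub_right (a := 0) (b := t) I τ
    rw [zero_sub] at this
    rw [← this]
    refine intervalIntegral.integral_congr fun s _ => ?_
    simp only [hI]
    congr 2
    ring
  have e2 : S.conv (fun s => C (v s)) t =
      (∫ r in (0 : ℝ)..m, J r) + (∫ r in m..(t - τ), J r) + ∫ r in (t - τ)..t, J r := by
    rw [intervalIntegral.integral_add_adjacent_intervals (hJi _ _ (by linarith) hm0 (by linarith))
        (hJi _ _ (by linarith) (by linarith) (by linarith)),
      intervalIntegral.integral_add_adjacent_intervals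
        (hJi _ _ (by linarith) (by linarith) (by linarith))
        (hJi _ _ (by linarith) (by linarith) (by linarith))]
    rfl
  have e3 : S.opReal t (C (∫ s in (-τ)..0, v s)) = ∫ s in (-τ)..0, S.opReal t (C (v s)) := by
    rw [← ContinuousLinearMap.intervalIntegral_comp_comm _ hvi,
      ← ContinuousLinearMap.intervalIntegral_comp_comm]
    exact ⟨C.integrable_comp hvi.1, C.integrable_comp hvi.2⟩
  have hSC : IntervalIntegrable (fun s => S.opReal t (C (v s))) volume (-τ) 0 :=
    ⟨(S.opReal t).integrable_comp (C.integrable_comp hvi.1),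
      (S.opReal t).integrable_comp (C.integrable_comp hvi.2)⟩
  -- The four integrals produce the four terms of the bound: replacing the history term by its
  -- effective value, comparing the two kernels away from the endpoint, the same near the endpoint,
  -- and the last piece of length `τ` that the delayed integral misses.
  have e4 : v t - (S.opReal t (z.1 + C (∫ s in (-τ)..0, v s)) + S.conv (fun s => C (v s)) t) =
      (∫ r in (-τ)..0, (I r - S.opReal t (C (v r)))) + (∫ r in (0 : ℝ)..m, (I r - J r)) +
        (∫ r in m..(t - τ), (I r - J r)) - ∫ r in (t - τ)..t, J r := by
    rw [intervalIntegral.integral_sub (hIi _ _ (by linarith) (by linarith) (by linarith)) hSC,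
      intervalIntegral.integral_sub (hIi _ _ (by linarith) hm0 (by linarith))
        (hJi _ _ (by linarith) hm0 (by linarith)),
      intervalIntegral.integral_sub (hIi _ _ (by linarith) (by linarith) (by linarith))
        (hJi _ _ (by linarith) (by linarith) (by linarith)),
      h.mild t (by linarith), e1, e2, map_add, e3]
    abel
  have hCV (r : ℝ) (hr : r ∈ Icc 0 b) : ‖C (v r)‖ ≤ ‖C‖ * V := C.le_opNorm_of_le (hV r hr)
  have b1 : ‖∫ r in (-τ)..0, (I r - S.opReal t (C (v r)))‖ ≤ η * ‖C‖ * ‖z‖ := by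
    calc _ ≤ ∫ r in (-τ)..0, η * ‖C‖ * ‖v r‖ := by
          refine intervalIntegral.norm_integral_le_of_norm_le (by linarith) ?_
            (hvi.norm.const_mul _)
          filter_upwards with r hr
          have h1 := hη (t - τ - r) ⟨by linarith [hr.2], by linarith [hr.1]⟩ t
            ⟨by linarith, htb⟩ (by rw [abs_le]; constructor <;> linarith [hr.1, hr.2])
          have h2 := ContinuousLinearMap.le_of_opNorm_le _ h1 (C (v r))
          rw [mul_assoc]
          exact h2.trans (mul_le_mul_of_nonneg_left (C.le_opNorm _) hη0)
      _ = η * ‖C‖ * ∫ r in (-τ)..0, ‖v r‖ := intervalIntegral.integral_const_mul _ _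
      _ ≤ η * ‖C‖ * ∫ r in (-1 : ℝ)..0, ‖v r‖ := by
          gcongr
          refine intervalIntegral.integral_mono_interval (by linarith) (by linarith) le_rfl
            (Eventually.of_forall fun _ => norm_nonneg _) ?_
          exact ((intervalIntegrable_iff_integrableOn_Ioc_of_le (by norm_num)).2
            h.integrableOn_history).norm
      _ ≤ η * ‖C‖ * ‖z‖ := by
          gcongr
          exact h.integral_norm_history_le.trans (norm_snd_le z)
  have b2 : ‖∫ r in (0 : ℝ)..m, (I r - J r)‖ ≤ b * (η * (‖C‖ * V)) := by
    have : ‖∫ r in (0 : ℝ)..m, (I r - J r)‖ ≤ η * (‖C‖ * V) * |m - 0| := by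
      refine intervalIntegral.norm_integral_le_of_norm_le_const fun r hr => ?_
      rw [uIoc_of_le hm0] at hr
      have h1 := hη (t - τ - r) ⟨by linarith [hr.2], by linarith [hr.1]⟩ (t - r)
        ⟨by linarith [hr.2], by linarith [hr.1]⟩
        (by rw [abs_le]; constructor <;> linarith [hr.1, hr.2])
      exact (ContinuousLinearMap.le_of_opNorm_le _ h1 (C (v r))).trans
        (mul_le_mul_of_nonneg_left (hCV r ⟨hr.1.le, by linarith [hr.2]⟩) hη0)
    rw [sub_zero, abs_of_nonneg hm0] at this
    refine this.trans ?_
    rw [mul_comm]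
    gcongr
    linarith
  have hbound (r u : ℝ) (hr : r ∈ Icc 0 b) (hu : u ≤ b) :
      ‖S.opReal u (C (v r))‖ ≤ M * (‖C‖ * V) :=
    (ContinuousLinearMap.le_of_opNorm_le _ (hM u hu) _).trans
      (mul_le_mul_of_nonneg_left (hCV r hr) hM0)
  have b3 : ‖∫ r in m..(t - τ), (I r - J r)‖ ≤ δ * (M * (‖C‖ * V)) := by
    have : ‖∫ r in m..(t - τ), (I r - J r)‖ ≤
        (M * (‖C‖ * V) + M * (‖C‖ * V)) * |t - τ - m| := by
      refine intervalIntegral.norm_integral_le_of_norm_le_const fun r hr => ?_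
      rw [uIoc_of_le (by linarith)] at hr
      have hr0 : 0 ≤ r := hm0.trans hr.1.le
      have hrb : r ≤ b := by linarith [hr.2]
      exact (norm_sub_le _ _).trans (add_le_add (hbound r _ ⟨hr0, hrb⟩ (by linarith))
        (hbound r _ ⟨hr0, hrb⟩ (by linarith)))
    rw [show t - τ - m = δ / 2 by rw [hm]; ring, abs_of_pos (by linarith)] at this
    linarith
  have b4 : ‖∫ r in (t - τ)..t, J r‖ ≤ δ / 2 * (M * (‖C‖ * V)) := by
    have : ‖∫ r in (t - τ)..t, J r‖ ≤ M * (‖C‖ * V) * |t - (t - τ)| := by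
      refine intervalIntegral.norm_integral_le_of_norm_le_const fun r hr => ?_
      rw [uIoc_of_le (by linarith)] at hr
      exact hbound r _ ⟨by linarith [hr.1], hr.2.trans htb⟩ (by linarith [hr.1])
    rw [sub_sub_cancel, abs_of_pos hτ0, mul_comm] at this
    refine this.trans ?_
    gcongr
  rw [e4]
  refine (norm_sub_le _ _).trans (add_le_add ?_ b4)
  refine (norm_add_le _ _).trans (add_le_add ?_ b3)
  exact (norm_add_le _ _).trans (add_le_add b1 b2)

/-- Norm continuity is uniform on compact intervals away from `0`; the delay argument draws on
immediate norm continuity only through this modulus. -/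
theorem C0Semigroup.ImmediatelyNormContinuous.exists_modulus
    (hS : S.ImmediatelyNormContinuous) {a b η : ℝ} (ha : 0 < a) (hη : 0 < η) :
    ∃ κ > 0, ∀ s ∈ Icc a b, ∀ r ∈ Icc a b, |s - r| ≤ κ → ‖S.opReal s - S.opReal r‖ ≤ η := by
  have hc : ContinuousOn S.opReal (Icc a b) :=
    hS.comp continuous_real_toNNReal.continuousOn
      fun s hs => Real.toNNReal_pos.2 (ha.trans_le hs.1)
  obtain ⟨κ, hκ, h⟩ := Metric.uniformContinuousOn_iff.1
    (isCompact_Icc.uniformContinuousOn_of_continuous hc) η hη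
  refine ⟨κ / 2, half_pos hκ, fun s hs r hr hsr => ?_⟩
  rw [← dist_eq_norm]
  exact (h s hs r hr (by rw [Real.dist_eq]; linarith)).le

/-- As the delay tends to zero, solutions of the delay equation converge to orbits of the
undelayed semigroup, uniformly for bounded initial data and on compact subsets of `(0, ∞)`. -/
theorem exists_delaySolution_close (p : ℝ≥0∞) [Fact (1 ≤ p)] {U : C0Semigroup X}
    {B : X →ₗ.[ℂ] X} (hS : S.IsGeneratedBy B) (hSnc : S.ImmediatelyNormContinuous)
    (hU : U.IsGeneratedBy (boundedPerturbation B C)) {a b ε : ℝ} (ha : 0 < a) (hab : a ≤ b)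
    (hε : 0 < ε) :
    ∃ κ : ℝ, 0 < κ ∧ κ ≤ 1 ∧ ∀ τ ∈ Ioo 0 κ, ∀ (z : X × HistorySpace X p) (v : ℝ → X),
      IsDelaySolution S C τ z v → ∀ t ∈ Icc a b,
        ‖v t - U.opReal t (z.1 + C (∫ s in (-τ)..0, v s))‖ ≤ ε * ‖z‖ := by
  have hb : 0 < b := ha.trans_le hab
  obtain ⟨M, hM1, hM⟩ := S.exists_bound_opReal b
  obtain ⟨M', hM1', hM'⟩ := U.exists_bound_opReal b
  obtain ⟨K, hK0, hK⟩ := exists_delaySolution_bound p S C b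
  have hM0 : 0 ≤ M := zero_le_one.trans hM1
  have hM0' : 0 ≤ M' := zero_le_one.trans hM1'
  set c := ‖C‖ with hc
  have hc0 : 0 ≤ c := norm_nonneg _
  set K₂ := K + M' * (1 + c) with hK₂
  set e := Real.exp (M * c * b) with he
  have he0 : 0 < e := Real.exp_pos _
  -- All error terms are at most `η` times these coefficients once `δ ≤ η`, and `e` is the Grönwall
  -- factor. The summand `1` keeps `Q` positive.
  set Q := (c + b * c * K + 2 * (M * c * K) + M * c * K₂ + 1) * e with hQ
  have hQ0 : 0 < Q := by positivity
  set η := ε / (2 * Q) with hη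
  have hη0 : 0 < η := by positivity
  set δ := min a η with hδ
  have hδ0 : 0 < δ := lt_min ha hη0
  obtain ⟨κ, hκ, hmod⟩ := hSnc.exists_modulus (a := δ / 2) (b := b) (half_pos hδ0) hη0
  refine ⟨min (min κ (δ / 2)) 1, by positivity, min_le_right _ _, ?_⟩
  intro τ hτ z v h t ht
  have hτ0 : 0 < τ := hτ.1
  have hτ1 : τ ≤ 1 := hτ.2.le.trans (min_le_right _ _)
  have hτκ : τ ≤ κ := hτ.2.le.trans ((min_le_left _ _).trans (min_le_left _ _))
  have hτδ : τ ≤ δ / 2 := hτ.2.le.trans ((min_le_left _ _).trans (min_le_right _ _))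
  set y := z.1 + C (∫ s in (-τ)..0, v s) with hy
  have hyb : ‖y‖ ≤ (1 + c) * ‖z‖ := by
    have h1 : ‖∫ s in (-τ)..0, v s‖ ≤ ‖z‖ := by
      refine (intervalIntegral.norm_integral_le_integral_norm (by linarith)).trans
        (le_trans ?_ (h.integral_norm_history_le.trans (norm_snd_le z)))
      refine intervalIntegral.integral_mono_interval (by linarith) (by linarith) le_rfl
        (Eventually.of_forall fun _ => norm_nonneg _) ?_
      exact ((intervalIntegrable_iff_integrableOn_Ioc_of_le (by norm_num)).2
        h.integrableOn_history).norm
    calc ‖y‖ ≤ ‖z.1‖ + ‖C (∫ s in (-τ)..0, v s)‖ := norm_add_le _ _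
      _ ≤ ‖z‖ + c * ‖z‖ := add_le_add (norm_fst_le z) (C.le_opNorm_of_le h1)
      _ = _ := by ring
  set w : ℝ → X := fun s => v s - U.opReal s y with hw
  have hwc : ContinuousOn w (Icc 0 b) :=
    (h.continuousOn hτ0 hτ1 b).sub (U.continuous_opReal y).continuousOn
  have hwb (s : ℝ) (hs : s ∈ Icc 0 b) : ‖w s‖ ≤ K₂ * ‖z‖ := by
    calc ‖w s‖ ≤ ‖v s‖ + ‖U.opReal s y‖ := norm_sub_le _ _
      _ ≤ K * ‖z‖ + M' * ((1 + c) * ‖z‖) :=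
        add_le_add (hK τ hτ0 hτ1 z v h s hs) ((ContinuousLinearMap.le_of_opNorm_le _
          (hM' s hs.2) _).trans (mul_le_mul_of_nonneg_left hyb hM0'))
      _ = _ := by ring
  have hwi (s r : ℝ) (hs : 0 ≤ s) (hsr : s ≤ r) (hr : r ≤ b) :
      IntervalIntegrable w volume s r := by
    refine (hwc.mono ?_).intervalIntegrable
    rw [uIcc_of_le hsr]
    exact Icc_subset_Icc hs hr
  set c₀ := (η * c + b * (η * (c * K)) + δ * (M * (c * K)) + δ / 2 * (M * (c * K)) +
    M * c * (δ * K₂)) * ‖z‖ with hc₀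
  -- Grönwall starts at `δ`, since closeness may fail near time zero. On the initial layer `[0, δ]`
  -- the crude bound `K₂` on `w` suffices because the layer is short.
  have hgron := le_mul_exp_of_le_add_integral (φ := fun s => ‖w s‖) (a := δ) (b := b) (c := c₀)
    (K := M * c) (hwc.norm.mono (Icc_subset_Icc_left hδ0.le)) (fun _ _ => norm_nonneg _)
    (by positivity) (by positivity) ?_ t ⟨(min_le_left _ _).trans ht.1, ht.2⟩
  · calc ‖v t - U.opReal t y‖ ≤ c₀ * Real.exp (M * c * (t - δ)) := hgron
      _ ≤ c₀ * e := by
        rw [he]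
        gcongr
        linarith [ht.2]
      _ ≤ ε * ‖z‖ := by
        have hδη : δ ≤ η := min_le_right _ _
        have hMcK : 0 ≤ M * c * K := by positivity
        have hMcK₂ : 0 ≤ M * c * K₂ := by positivity
        have hbcK : 0 ≤ b * c * K := by positivity
        have h1 : η * c + b * (η * (c * K)) + δ * (M * (c * K)) + δ / 2 * (M * (c * K)) +
            M * c * (δ * K₂) ≤ η * (c + b * c * K + 2 * (M * c * K) + M * c * K₂ + 1) := by
          nlinarith [mul_le_mul_of_nonneg_right hδη hMcK, mul_le_mul_of_nonneg_right hδη hMcK₂,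
            mul_nonneg hη0.le hMcK]
        have h2 : η * Q ≤ ε := by
          rw [hη]
          have : ε / (2 * Q) * Q = ε / 2 := by field_simp
          linarith
        calc c₀ * e = (η * c + b * (η * (c * K)) + δ * (M * (c * K)) + δ / 2 * (M * (c * K)) +
            M * c * (δ * K₂)) * (e * ‖z‖) := by rw [hc₀]; ring
          _ ≤ η * (c + b * c * K + 2 * (M * c * K) + M * c * K₂ + 1) * (e * ‖z‖) := by gcongr
          _ = η * Q * ‖z‖ := by rw [hQ]; ring
          _ ≤ ε * ‖z‖ := by gcongr
  · intro s hs
    have hs0 : 0 ≤ s := hδ0.le.trans hs.1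
    have h1 := h.norm_sub_undelayed_le hτ0 hτ1 hM0 hη0.le
      (mul_nonneg hK0 (norm_nonneg z)) hM hτδ
      (fun r hr u hu hru => hmod r hr u hu (hru.trans hτκ)) (hK τ hτ0 hτ1 z v h) hs
    have hCv : IntegrableOn (fun r => C (v r)) (Ioc 0 s) :=
      C.integrable_comp ((h.integrableOn hτ0 hτ1 s).mono_set (Ioc_subset_Ioc_left (by norm_num)))
    have hCU : IntegrableOn (fun r => C (U.opReal r y)) (Ioc 0 s) :=
      ((C.continuous.comp (U.continuous_opReal y)).integrableOn_Icc).mono_set Ioc_subset_Icc_self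
    have hCw : IntegrableOn (fun r => C (w r)) (Ioc 0 s) := by
      refine (hCv.sub hCU).congr (Eventually.of_forall fun r => ?_)
      simp only [hw, map_sub, Pi.sub_apply]
    have hconv : S.conv (fun r => C (w r)) s =
        S.conv (fun r => C (v r)) s - S.conv (fun r => C (U.opReal r y)) s := by
      have hi1 := (intervalIntegrable_iff_integrableOn_Ioc_of_le hs0).2
        (S.integrableOn_opReal_sub hCv s)
      have hi2 := (intervalIntegrable_iff_integrableOn_Ioc_of_le hs0).2
        (S.integrableOn_opReal_sub hCU s)
      simp only [C0Semigroup.conv, hw, map_sub]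
      exact intervalIntegral.integral_sub hi1 hi2
    -- Subtracting the variation of constants formula for `U` at `y` turns the approximate equation
    -- for `v` into a Volterra equation for `w` with a small right side.
    have h2 : w s = (v s - (S.opReal s y + S.conv (fun r => C (v r)) s)) +
        S.conv (fun r => C (w r)) s := by
      rw [hconv, hw]
      simp only
      rw [C0Semigroup.opReal_eq_add_conv hS hU hs0 y]
      abel
    have h3 : ∫ r in (0 : ℝ)..s, ‖C (w r)‖ ≤ c * (δ * (K₂ * ‖z‖) + ∫ r in δ..s, ‖w r‖) := by
      have h4 : ∫ r in (0 : ℝ)..δ, ‖w r‖ ≤ δ * (K₂ * ‖z‖) := by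
        have h5 : ∫ r in (0 : ℝ)..δ, ‖w r‖ ≤ ∫ r in (0 : ℝ)..δ, K₂ * ‖z‖ :=
          intervalIntegral.integral_mono_on hδ0.le
            (hwi 0 δ le_rfl hδ0.le (hs.1.trans hs.2)).norm intervalIntegrable_const
            fun r hr => hwb r ⟨hr.1, hr.2.trans (hs.1.trans hs.2)⟩
        rwa [intervalIntegral.integral_const, sub_zero, smul_eq_mul] at h5
      calc ∫ r in (0 : ℝ)..s, ‖C (w r)‖ ≤ ∫ r in (0 : ℝ)..s, c * ‖w r‖ :=
            intervalIntegral.integral_mono_on hs0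
              ((intervalIntegrable_iff_integrableOn_Ioc_of_le hs0).2 hCw).norm
              ((hwi 0 s le_rfl hs0 hs.2).norm.const_mul c) fun r _ => C.le_opNorm _
        _ = c * ((∫ r in (0 : ℝ)..δ, ‖w r‖) + ∫ r in δ..s, ‖w r‖) := by
            rw [intervalIntegral.integral_const_mul,
              intervalIntegral.integral_add_adjacent_intervals
                (hwi 0 δ le_rfl hδ0.le (hs.1.trans hs.2)).norm (hwi δ s hδ0.le hs.1 hs.2).norm]
        _ ≤ _ := by gcongr
    have h5 := S.norm_conv_le hM hs0 hs.2 hCw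
    calc ‖w s‖ ≤ ‖v s - (S.opReal s y + S.conv (fun r => C (v r)) s)‖ +
          ‖S.conv (fun r => C (w r)) s‖ := by
            conv_lhs => rw [h2]
            exact norm_add_le _ _
      _ ≤ (η * c * ‖z‖ + b * (η * (c * (K * ‖z‖))) + δ * (M * (c * (K * ‖z‖))) +
            δ / 2 * (M * (c * (K * ‖z‖)))) +
          M * (c * (δ * (K₂ * ‖z‖) + ∫ r in δ..s, ‖w r‖)) :=
            add_le_add h1 (h5.trans (mul_le_mul_of_nonneg_left h3 hM0))
      _ = _ := by rw [hc₀]; ring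

end SmallDelay

/-! ### Persistence of stability and hyperbolicity. -/

section Stability

set_option linter.unusedSectionVars false

variable {X : Type*} [NormedAddCommGroup X] [NormedSpace ℂ X] [CompleteSpace X]
  {p : ℝ≥0∞} [Fact (1 ≤ p)]
variable {S : C0Semigroup X} {C : X →L[ℂ] X} {τ : ℝ}

theorem C0Semigroup.memLp_orbit (U : C0Semigroup X) (x : X) (t : ℝ) :
    MemLp (fun σ => U.opReal (σ + t) x) p historyMeasure := by
  have hc : Continuous fun σ => U.opReal (σ + t) x :=
    (U.continuous_opReal x).comp (continuous_add_const t)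
  obtain ⟨N, hN⟩ := (isCompact_Icc (a := (-1 : ℝ)) (b := 0)).exists_bound_of_continuousOn
    hc.continuousOn
  exact MemLp.of_bound hc.aestronglyMeasurable N ((ae_restrict_mem measurableSet_Icc).mono hN)

theorem C0Semigroup.coeFn_historySegment_orbit (U : C0Semigroup X) (x : X) (t : ℝ) :
    historySegment p (fun s => U.opReal s x) t =ᵐ[historyMeasure] fun σ => U.opReal (σ + t) x :=
  coeFn_historySegment (v := fun s => U.opReal s x) (U.memLp_orbit x t)

variable (p) in
/-- The state at time `t` of the undelayed evolution: the value and the history segment. -/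
def C0Semigroup.stateMap (U : C0Semigroup X) (t N : ℝ)
    (hN : ∀ s ∈ Icc (t - 1) t, ‖U.opReal s‖ ≤ N) : X →L[ℂ] (X × HistorySpace X p) :=
  LinearMap.mkContinuous
    { toFun := fun x => (U.opReal t x, historySegment p (fun s => U.opReal s x) t)
      map_add' := fun x y => by
        refine Prod.ext (map_add _ x y)
          (eq_historySegment (v := fun s => U.opReal s (x + y)) ?_).symm
        refine (Lp.coeFn_add _ _).trans (((U.coeFn_historySegment_orbit x t).add
          (U.coeFn_historySegment_orbit y t)).trans (Eventually.of_forall fun σ => ?_))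
        exact (map_add _ x y).symm
      map_smul' := fun c x => by
        refine Prod.ext (map_smul _ c x)
          (eq_historySegment (v := fun s => U.opReal s (c • x)) ?_).symm
        refine (Lp.coeFn_smul _ _).trans (((U.coeFn_historySegment_orbit x t).const_smul
          c).trans (Eventually.of_forall fun σ => ?_))
        exact (map_smul _ c x).symm } N fun x => by
    have hN0 : 0 ≤ N := (norm_nonneg _).trans (hN t ⟨by linarith, le_rfl⟩)
    refine max_le (ContinuousLinearMap.le_of_opNorm_le _ (hN t ⟨by linarith, le_rfl⟩) x) ?_
    refine norm_historySpace_le_of_bound (by positivity) ?_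
    filter_upwards [U.coeFn_historySegment_orbit (p := p) x t,
      ae_restrict_mem measurableSet_Icc] with σ hσ hI
    change ‖historySegment p (fun s => U.opReal s x) t σ‖ ≤ _
    rw [hσ]
    exact ContinuousLinearMap.le_of_opNorm_le _
      (hN _ ⟨by linarith [hI.1], by linarith [hI.2]⟩) x

theorem C0Semigroup.stateMap_apply (U : C0Semigroup X) {t N : ℝ}
    (hN : ∀ s ∈ Icc (t - 1) t, ‖U.opReal s‖ ≤ N) (x : X) :
    U.stateMap p t N hN x = (U.opReal t x, historySegment p (fun s => U.opReal s x) t) := rfl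

theorem C0Semigroup.norm_stateMap_le (U : C0Semigroup X) {t N : ℝ}
    (hN : ∀ s ∈ Icc (t - 1) t, ‖U.opReal s‖ ≤ N) : ‖U.stateMap p t N hN‖ ≤ N :=
  LinearMap.mkContinuous_norm_le _ ((norm_nonneg _).trans (hN t ⟨by linarith, le_rfl⟩)) _

variable (p C) in
/-- The effective initial value `x + C ∫_{a}^0 f` of an initial datum `(x, f)`. -/
def effectiveValue (a : Icc (-1 : ℝ) 0) : (X × HistorySpace X p) →L[ℂ] X :=
  ContinuousLinearMap.fst ℂ X (HistorySpace X p) +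
    C.comp ((historyIntegral X p a).comp (ContinuousLinearMap.snd ℂ X (HistorySpace X p)))

theorem effectiveValue_apply (a : Icc (-1 : ℝ) 0) (z : X × HistorySpace X p) :
    effectiveValue p C a z = z.1 + C (historyIntegral X p a z.2) := rfl

theorem norm_effectiveValue_le (a : Icc (-1 : ℝ) 0) : ‖effectiveValue p C a‖ ≤ 1 + ‖C‖ := by
  refine ContinuousLinearMap.opNorm_le_bound _ (by positivity) fun z => ?_
  rw [effectiveValue_apply, add_mul, one_mul]
  refine (norm_add_le _ _).trans (add_le_add (norm_fst_le z) (C.le_opNorm_of_le ?_))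
  exact (ContinuousLinearMap.le_of_opNorm_le _ (norm_historyIntegral_le a) _).trans
    (by rw [one_mul]; exact norm_snd_le z)

/-- For small delays the solution operator at time `t` is close to a product `G ∘ L` whose reversed
product `L ∘ G` is close to the undelayed solution operator. -/
theorem exists_factorization (p : ℝ≥0∞) [Fact (1 ≤ p)] {U : C0Semigroup X}
    {B : X →ₗ.[ℂ] X} (hS : S.IsGeneratedBy B) (hSnc : S.ImmediatelyNormContinuous)
    (hU : U.IsGeneratedBy (boundedPerturbation B C)) (hp : p ≠ ∞) {t : ℝ≥0} (ht : 1 < t) {N : ℝ}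
    (hN : ∀ s ∈ Icc ((t : ℝ) - 1) t, ‖U.opReal s‖ ≤ N) {ε : ℝ} (hε : 0 < ε) :
    ∃ κ : ℝ, 0 < κ ∧ κ ≤ 1 ∧ ∀ (τ : ℝ) (hτ0 : 0 < τ) (hτ1 : τ ≤ 1), τ < κ →
      ∃ (L : (X × HistorySpace X p) →L[ℂ] X) (G : X →L[ℂ] (X × HistorySpace X p)),
        ‖L‖ ≤ 1 + ‖C‖ ∧ ‖G‖ ≤ N ∧
        ‖(delaySemigroup p S C hp hτ0 hτ1).op t - G.comp L‖ ≤ ε ∧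
        ‖L.comp G - U.op t‖ ≤ ε := by
  have ht' : (1 : ℝ) < t := by exact_mod_cast ht
  have hN0 : 0 ≤ N := (norm_nonneg _).trans (hN t ⟨by linarith, le_rfl⟩)
  -- The comparison interval `[t - 1, t]` is the whole history window; it avoids `0` because `t >
  -- 1`.
  obtain ⟨κ, hκ0, hκ1, hκ⟩ := exists_delaySolution_close p hS hSnc hU
    (a := (t : ℝ) - 1) (b := t) (by linarith) (by linarith) hε
  -- The second constraint bounds `L ∘ G - U(t) = C ∫_{-τ}^0 U(t + s) ds`, whose norm is at most `τ
  -- ‖C‖ N`.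
  refine ⟨min κ (ε / (‖C‖ * N + 1)), by positivity, (min_le_left _ _).trans hκ1, ?_⟩
  intro τ hτ0 hτ1 hτκ
  have hτκ1 : τ < κ := hτκ.trans_le (min_le_left _ _)
  have hτκ2 : τ < ε / (‖C‖ * N + 1) := hτκ.trans_le (min_le_right _ _)
  set a : Icc (-1 : ℝ) 0 := ⟨-τ, by linarith, by linarith⟩ with ha
  refine ⟨effectiveValue p C a, U.stateMap p t N hN, norm_effectiveValue_le a,
    U.norm_stateMap_le hN, ?_, ?_⟩
  · refine ContinuousLinearMap.opNorm_le_bound _ hε.le fun z => ?_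
    obtain ⟨v, hv⟩ := exists_isDelaySolution (S := S) (C := C) hτ0 z
    have hL : effectiveValue p C a z = z.1 + C (∫ s in (-τ)..0, v s) := by
      rw [effectiveValue_apply, historyIntegral_eq_of_ae a hv.history]
    have hclose := hκ τ ⟨hτ0, hτκ1⟩ z v hv
    rw [← hL] at hclose
    set x := effectiveValue p C a z
    rw [sub_apply, ← C0Semigroup.opReal_coe,
      delaySemigroup_opReal_apply hp hτ0 hτ1 hv t.coe_nonneg, ContinuousLinearMap.comp_apply,
      C0Semigroup.stateMap_apply]
    refine max_le (hclose t ⟨by linarith, le_rfl⟩) ?_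
    refine norm_historySpace_le_of_bound (by positivity) ?_
    filter_upwards [Lp.coeFn_sub (historySegment p v t) (historySegment p (fun s => U.opReal s x) t),
      U.coeFn_historySegment_orbit (p := p) x t,
      coeFn_historySegment (hv.memLp_comp_add hτ0 hτ1 t.coe_nonneg),
      ae_restrict_mem measurableSet_Icc] with σ h1 h2 h3 hI
    have h4 := hclose (σ + t) ⟨by linarith [hI.1], by linarith [hI.2]⟩
    rw [← h2, ← h3] at h4
    change ‖(historySegment p v t - historySegment p (fun s => U.opReal s x) t) σ‖ ≤ _
    rwa [h1]
  · refine ContinuousLinearMap.opNorm_le_bound _ hε.le fun x => ?_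
    rw [sub_apply, ContinuousLinearMap.comp_apply, C0Semigroup.stateMap_apply,
      effectiveValue_apply, ← C0Semigroup.opReal_coe, add_sub_cancel_left,
      historyIntegral_eq_of_ae a (U.coeFn_historySegment_orbit (p := p) x t)]
    have h1 : ‖∫ s in (-τ)..0, U.opReal (s + t) x‖ ≤ N * ‖x‖ * |0 - (-τ)| := by
      refine intervalIntegral.norm_integral_le_of_norm_le_const fun s hs => ?_
      rw [uIoc_of_le (by linarith)] at hs
      exact ContinuousLinearMap.le_of_opNorm_le _
        (hN _ ⟨by linarith [hs.1], by linarith [hs.2]⟩) x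
    rw [zero_sub, neg_neg, abs_of_pos hτ0] at h1
    rw [lt_div_iff₀ (by positivity)] at hτκ2
    calc _ ≤ ‖C‖ * (N * ‖x‖ * τ) := C.le_opNorm_of_le h1
      _ = τ * (‖C‖ * N) * ‖x‖ := by ring
      _ ≤ ε * ‖x‖ := by
        gcongr
        nlinarith

/-- Exponential stability is robust under small delays. -/
theorem exists_exponentiallyStable_delaySemigroup (p : ℝ≥0∞) [Fact (1 ≤ p)] {U : C0Semigroup X}
    {B : X →ₗ.[ℂ] X} (hS : S.IsGeneratedBy B) (hSnc : S.ImmediatelyNormContinuous)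
    (hU : U.IsGeneratedBy (boundedPerturbation B C)) (hp : p ≠ ∞) (hUs : U.ExponentiallyStable) :
    ∃ κ : ℝ, 0 < κ ∧ κ ≤ 1 ∧ ∀ (τ : ℝ) (hτ0 : 0 < τ) (hτ1 : τ ≤ 1), τ < κ →
      (delaySemigroup p S C hp hτ0 hτ1).ExponentiallyStable := by
  obtain ⟨M, ω, hω, hM⟩ := hUs
  have hM0 : 0 ≤ M := by
    have := (norm_nonneg _).trans (hM 0)
    exact nonneg_of_mul_nonneg_left this (Real.exp_pos _)
  -- The time `t` is taken so large that `‖G‖ ‖L‖ ≤ 1/4`; the factor `exp ω` accounts for the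
  -- history window reaching back to `t - 1`. Another `1/4` is left for the approximation error.
  have hlim : Tendsto (fun t : ℝ => (M * Real.exp ω * (1 + ‖C‖)) * Real.exp (-ω * t)) atTop
      (𝓝 ((M * Real.exp ω * (1 + ‖C‖)) * 0)) :=
    (Real.tendsto_exp_atBot.comp
      (tendsto_id.const_mul_atTop_of_neg (neg_neg_of_pos hω))).const_mul _
  rw [mul_zero] at hlim
  obtain ⟨t, ht, ht2⟩ := ((hlim.eventually_lt_const (show (0 : ℝ) < 1 / 4 by norm_num)).and
    (eventually_ge_atTop 2)).exists
  lift t to ℝ≥0 using by linarith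
  set N := M * Real.exp (-ω * (t - 1)) with hNdef
  have hN0 : 0 ≤ N := by positivity
  have hN : ∀ s ∈ Icc ((t : ℝ) - 1) t, ‖U.opReal s‖ ≤ N := by
    intro s hs
    have := hM s.toNNReal
    rw [Real.coe_toNNReal s (by linarith [hs.1])] at this
    refine this.trans (mul_le_mul_of_nonneg_left (Real.exp_le_exp.2 ?_) hM0)
    nlinarith [hs.1]
  have hN4 : N * (1 + ‖C‖) ≤ 1 / 4 := by
    have : Real.exp (-ω * (t - 1)) = Real.exp ω * Real.exp (-ω * t) := by
      rw [← Real.exp_add]; congr 1; ring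
    rw [hNdef, this]
    refine le_trans (le_of_eq ?_) ht.le
    ring
  obtain ⟨κ, hκ0, hκ1, hκ⟩ := exists_factorization p hS hSnc hU hp
    (by exact_mod_cast (by linarith : (1 : ℝ) < t)) hN (show (0 : ℝ) < 1 / 4 by norm_num)
  refine ⟨κ, hκ0, hκ1, fun τ hτ0 hτ1 hτκ => ?_⟩
  obtain ⟨L, G, hL, hG, hD, -⟩ := hκ τ hτ0 hτ1 hτκ
  refine C0Semigroup.exponentiallyStable_of_norm_le_half _ (t₁ := t)
    (by exact_mod_cast (by linarith : (0 : ℝ) < t)) ?_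
  calc _ = ‖((delaySemigroup p S C hp hτ0 hτ1).op t - G.comp L) + G.comp L‖ := by
        rw [sub_add_cancel]
    _ ≤ 1 / 4 + N * (1 + ‖C‖) := (norm_add_le _ _).trans (add_le_add hD
        ((ContinuousLinearMap.opNorm_comp_le _ _).trans
          (mul_le_mul hG hL (norm_nonneg _) hN0)))
    _ ≤ 1 / 2 := by linarith

/-- Hyperbolicity is robust under small delays. -/
theorem exists_hyperbolic_delaySemigroup (p : ℝ≥0∞) [Fact (1 ≤ p)] {U : C0Semigroup X}
    {B : X →ₗ.[ℂ] X} (hS : S.IsGeneratedBy B) (hSnc : S.ImmediatelyNormContinuous)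
    (hU : U.IsGeneratedBy (boundedPerturbation B C)) (hp : p ≠ ∞) (hUh : U.Hyperbolic) :
    ∃ κ : ℝ, 0 < κ ∧ κ ≤ 1 ∧ ∀ (τ : ℝ) (hτ0 : 0 < τ) (hτ1 : τ ≤ 1), τ < κ →
      (delaySemigroup p S C hp hτ0 hτ1).Hyperbolic := by
  obtain ⟨t₁, ht₁⟩ := hUh.exists_invertibleWithBound
  set t : ℝ≥0 := max t₁ 2 with ht
  obtain ⟨K, hK⟩ := ht₁ t (le_max_left _ _)
  have ht2 : 2 ≤ t := le_max_right _ _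
  have hK0 : 0 ≤ K := by
    obtain ⟨b, -, -, hb⟩ := hK
    exact (norm_nonneg b).trans hb
  obtain ⟨N, hN1, hN⟩ := U.exists_bound_opReal t
  have hN0 : 0 ≤ N := zero_le_one.trans hN1
  -- Inverse bounds along the chain `U(t)`, `L ∘ G`, `G ∘ L`: `K`, then `2 K` after the first
  -- perturbation, then `K₁` after the swap. The choice of `ε` makes both perturbations admissible,
  -- and none of these constants depends on `τ`.
  set K₁ := 1 + N * (2 * K) * (1 + ‖C‖) with hK₁
  have hK₁0 : 0 < K₁ := by positivity
  set ε := 1 / (2 * (K + K₁)) with hε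
  have hε0 : 0 < ε := by positivity
  have hKε : K * ε ≤ 1 / 2 := by
    rw [hε, mul_one_div, div_le_div_iff₀ (by positivity) (by norm_num)]
    linarith
  have hK₁ε : K₁ * ε ≤ 1 / 2 := by
    rw [hε, mul_one_div, div_le_div_iff₀ (by positivity) (by norm_num)]
    linarith
  obtain ⟨κ, hκ0, hκ1, hκ⟩ := exists_factorization p hS hSnc hU hp
    (one_lt_two.trans_le ht2) (fun s hs => hN s hs.2) hε0
  refine ⟨κ, hκ0, hκ1, fun τ hτ0 hτ1 hτκ => ?_⟩
  obtain ⟨L, G, hL, hG, hD, hD'⟩ := hκ τ hτ0 hτ1 hτκ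
  have h1 := hK.seqDefect_sub (D := L.comp G - U.op t)
    ((mul_le_mul_of_nonneg_left hD' hK0).trans hKε)
  rw [add_sub_cancel] at h1
  obtain ⟨b, hb1, hb2, hb3⟩ := h1.seqDefect_swap
  have h2 : InvertibleWithBound (seqDefect (G.comp L)) K₁ := by
    refine ⟨b, hb1, hb2, hb3.trans ?_⟩
    rw [hK₁]
    gcongr
  have h3 := h2.seqDefect_sub (D := (delaySemigroup p S C hp hτ0 hτ1).op t - G.comp L)
    ((mul_le_mul_of_nonneg_left hD hK₁0.le).trans hK₁ε)
  rw [add_sub_cancel] at h3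
  exact C0Semigroup.hyperbolic_of_invertibleWithBound _ (two_pos.trans_le ht2) h3

end Stability

end

theorem mainTheorem7 {X : Type*} [NormedAddCommGroup X] [NormedSpace ℂ X] [CompleteSpace X]
    (p : ℝ≥0∞) [Fact (1 ≤ p)] (hp : p ≠ ∞)
    (B : X →ₗ.[ℂ] X) (C : X →L[ℂ] X)
    (S : C0Semigroup X) (hS : S.IsGeneratedBy B) (hSnc : S.ImmediatelyNormContinuous)
    (U : C0Semigroup X) (hU : U.IsGeneratedBy (boundedPerturbation B C)) :
    (U.ExponentiallyStable →
      ∃ κ : ℝ, 0 < κ ∧ ∃ hκ : κ ≤ 1, ∀ (τ : ℝ) (hτ : τ ∈ Ioo 0 κ),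
        ∃ T : C0Semigroup (X × HistorySpace X p),
          T.IsGeneratedBy
            (delayOperator B (pointDelay p C τ ⟨hτ.1.le, hτ.2.le.trans hκ⟩)) ∧
          T.ExponentiallyStable) ∧
    (U.Hyperbolic →
      ∃ κ : ℝ, 0 < κ ∧ ∃ hκ : κ ≤ 1, ∀ (τ : ℝ) (hτ : τ ∈ Ioo 0 κ),
        ∃ T : C0Semigroup (X × HistorySpace X p),
          T.IsGeneratedBy
            (delayOperator B (pointDelay p C τ ⟨hτ.1.le, hτ.2.le.trans hκ⟩)) ∧
          T.Hyperbolic) := by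
  constructor
  · intro h
    obtain ⟨κ, hκ0, hκ1, hκ⟩ := exists_exponentiallyStable_delaySemigroup p hS hSnc hU hp h
    exact ⟨κ, hκ0, hκ1, fun τ hτ => ⟨delaySemigroup p S C hp hτ.1 (hτ.2.le.trans hκ1),
      isGeneratedBy_delaySemigroup hS hp _ _ _, hκ τ _ _ hτ.2⟩⟩
  · intro h
    obtain ⟨κ, hκ0, hκ1, hκ⟩ := exists_hyperbolic_delaySemigroup p hS hSnc hU hp h
    exact ⟨κ, hκ0, hκ1, fun τ hτ => ⟨delaySemigroup p S C hp hτ.1 (hτ.2.le.trans hκ1),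
      isGeneratedBy_delaySemigroup hS hp _ _ _, hκ τ _ _ hτ.2⟩⟩
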